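/- Let $d\ge 1$. For a random vector $X$ in $\mathbb R^d$ with density $f$ write $\mathrm{Ent}(X)=-\int_{\mathbb R^d} f\log f$. Call $X$ *isotropic* if $\mathbb E[X]=0$ and $\mathbb E[X_iX_j]=\delta_{ij}$, and *log-concave* if it has a density $f:\mathbb R^d\to[0,\infty)$ such that $-\log f:\mathbb R^d\to(-\infty,\infty]$ is convex. For an isotropic log-concave $X$ with log-concave density $f$, the isotropic constant is $L_X=f(0)^{1/d}$. Say that $X$ satisfies a Poincaré inequality with constant $c>0$ if $c\int f s^2\le\int f|\nabla s|^2$ for every smooth $f$-integrable $s:\mathbb R^d\to\mathbb R$ with $\int fs=0$. The Poincaré constant $c_p(X)\in[0,\infty]$ is the smallest $C$ such that $\int f s^2\le C\int f|\nabla s|^2$ for all such $s$ (it is $\infty$ if there is no finite such $C$, and $e^{\infty}=\infty$). Let $G$ be a standard Gaussian vector in $\mathbb R^d$. **Theorem.** Let $X$ be an isotropic log-concave random vector in $\mathbb R^d$ with log-concave density $f$, and let $Y$ be an independent copy of $X$. Then $X$ and $(X+Y)/\sqrt2$ have finite entropy, and: 1. If, for some $\kappa\in(0,1)$, $X$ satisfies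 the entropy jump $$\mathrm{Ent}\Big(\frac{X+Y}{\sqrt2}\Big)-\mathrm{Ent}(X)\ \ge\ \kappa\,\big(\mathrm{Ent}(G)-\mathrm{Ent}(X)\big),$$ then $L_X\le e^{2/\kappa}$. 2. If $X$ satisfies a Poincaré inequality with constant $c>0$, then $c/8\in(0,1)$ and $X$ satisfies the entropy jump with $\kappa=c/8$. 3. $L_X\le e^{16\,c_p(X)}$. Consequently, the Kannan–Lovász–Simonovits conjecture (there is a universal $c>0$ such that, for every $d\ge1$, every isotropic log-concave random vector in $\mathbb R^d$ satisfies a Poincaré inequality with constant $c$) implies the slicing conjecture (there is a universal $C$ such that, for every $d\ge1$, $L_X\le C$ for every isotropic log-concave random vector $X$ in $\mathbb R^d$). -/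

import Mathlib

open MeasureTheory ProbabilityTheory
open scoped ENNReal ContDiff Gradient

noncomputable section

/-- The Lebesgue density of a (probability) measure `μ` on `ℝ^d`, as a real-valued function; it is
determined up to Lebesgue-null sets. -/
def lebesgueDensity {d : ℕ} (μ : Measure (EuclideanSpace ℝ (Fin d)))
    (x : EuclideanSpace ℝ (Fin d)) : ℝ :=
  (μ.rnDeriv volume x).toReal

/-- The Shannon differential entropy `Ent = - ∫ f log f` of a law `μ` on `ℝ^d` with density `f`.
It is meaningful when `HasFiniteEntropy μ` holds. -/
def entropy {d : ℕ} (μ : Measure (EuclideanSpace ℝ (Fin d))) : ℝ :=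
  -∫ x, lebesgueDensity μ x * Real.log (lebesgueDensity μ x)

/-- `μ` has a density `f` with respect to Lebesgue measure and `f log f` is integrable. -/
def HasFiniteEntropy {d : ℕ} (μ : Measure (EuclideanSpace ℝ (Fin d))) : Prop :=
  μ ≪ volume ∧
    Integrable (fun x => lebesgueDensity μ x * Real.log (lebesgueDensity μ x)) volume

/-- `f : ℝ^d → [0, ∞)` is a density of the law `μ`. -/
structure IsDensityOf {d : ℕ} (f : EuclideanSpace ℝ (Fin d) → ℝ)
    (μ : Measure (EuclideanSpace ℝ (Fin d))) : Prop where
  measurable : Measurable f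
  nonneg : ∀ x, 0 ≤ f x
  eq_withDensity : μ = volume.withDensity (fun x => ENNReal.ofReal (f x))

/-- A nonnegative function `f` is log-concave: `-log f`, with values in `(-∞, ∞]`, is convex.
(Real powers, with `0 ^ 0 = 1` and `0 ^ a = 0` for `a > 0`.) -/
def LogConcave {d : ℕ} (f : EuclideanSpace ℝ (Fin d) → ℝ) : Prop :=
  ∀ x y : EuclideanSpace ℝ (Fin d), ∀ a b : ℝ, 0 ≤ a → 0 ≤ b → a + b = 1 →
    f x ^ a * f y ^ b ≤ f (a • x + b • y)

/-- A law on `ℝ^d` is isotropic: it is centered, with covariance matrix the identity. -/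
structure IsIsotropic {d : ℕ} (μ : Measure (EuclideanSpace ℝ (Fin d))) : Prop where
  centered : ∫ x, x ∂μ = 0
  covariance : ∀ i j : Fin d, ∫ x, x i * x j ∂μ = if i = j then 1 else 0

/-- `μ` is the law of an isotropic log-concave random vector, with log-concave density `f`. -/
structure IsIsotropicLogConcave {d : ℕ} (μ : Measure (EuclideanSpace ℝ (Fin d)))
    (f : EuclideanSpace ℝ (Fin d) → ℝ) : Prop where
  isDensityOf : IsDensityOf f μ
  logConcave : LogConcave f
  isIsotropic : IsIsotropic μ

/-- The Poincaré (spectral gap) inequality with constant `c`: for every smooth `s` with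
`∫ s dμ = 0` one has `c ∫ s² dμ ≤ ∫ |∇ s|² dμ`, as an inequality in `[0, ∞]`. -/
def SatisfiesPoincare {d : ℕ} (μ : Measure (EuclideanSpace ℝ (Fin d))) (c : ℝ) : Prop :=
  ∀ s : EuclideanSpace ℝ (Fin d) → ℝ, ContDiff ℝ ∞ s → Integrable s μ → ∫ x, s x ∂μ = 0 →
    ENNReal.ofReal c * ∫⁻ x, ‖s x‖ₑ ^ 2 ∂μ ≤ ∫⁻ x, ‖∇ s x‖ₑ ^ 2 ∂μ

/-- The Poincaré constant `c_p(μ) ∈ [0, ∞]`: the smallest constant `C` such that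
`∫ s² dμ ≤ C ∫ |∇ s|² dμ` for every smooth `s` with `∫ s dμ = 0`. -/
def poincareConstant {d : ℕ} (μ : Measure (EuclideanSpace ℝ (Fin d))) : ℝ≥0∞ :=
  sInf {C : ℝ≥0∞ | ∀ s : EuclideanSpace ℝ (Fin d) → ℝ, ContDiff ℝ ∞ s → Integrable s μ →
    ∫ x, s x ∂μ = 0 → ∫⁻ x, ‖s x‖ₑ ^ 2 ∂μ ≤ C * ∫⁻ x, ‖∇ s x‖ₑ ^ 2 ∂μ}

/-- The isotropic constant `L_f = f(0)^{1/d}` of an isotropic log-concave density on `ℝ^d`. -/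
def isotropicConstant {d : ℕ} (f : EuclideanSpace ℝ (Fin d) → ℝ) : ℝ :=
  f 0 ^ (1 / (d : ℝ))

/-- The entropy jump with constant `κ`, for a random vector `X` and an independent copy `Y`:
`Ent((X + Y)/√2) - Ent(X) ≥ κ (Ent(G) - Ent(X))` with `G` a standard Gaussian vector. -/
def HasEntropyJump {d : ℕ} {Ω : Type*} [MeasurableSpace Ω] (P : Measure Ω)
    (X Y : Ω → EuclideanSpace ℝ (Fin d)) (κ : ℝ) : Prop :=
  κ * (entropy (stdGaussian (EuclideanSpace ℝ (Fin d))) - entropy (P.map X)) ≤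
    entropy (P.map (fun w => (√2 : ℝ)⁻¹ • (X w + Y w))) - entropy (P.map X)

/-- The Kannan-Lovász-Simonovits conjecture: isotropic log-concave laws satisfy a Poincaré
inequality with a universal constant. -/
def KLSConjecture : Prop :=
  ∃ c : ℝ, 0 < c ∧ ∀ d : ℕ, 1 ≤ d →
    ∀ (μ : Measure (EuclideanSpace ℝ (Fin d))) (f : EuclideanSpace ℝ (Fin d) → ℝ),
      IsProbabilityMeasure μ → IsIsotropicLogConcave μ f → SatisfiesPoincare μ c

/-- The slicing (hyperplane) conjecture: isotropic constants of isotropic log-concave laws are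
universally bounded. -/
def SlicingConjecture : Prop :=
  ∃ C : ℝ, ∀ d : ℕ, 1 ≤ d →
    ∀ (μ : Measure (EuclideanSpace ℝ (Fin d))) (f : EuclideanSpace ℝ (Fin d) → ℝ),
      IsProbabilityMeasure μ → IsIsotropicLogConcave μ f → isotropicConstant f ≤ C

end

/-! The law of `X` is sent through the Gaussian channel `w = r X + G`, and `r` runs from 0 (pure
noise) to infinity (pure signal). Given `w`, let M(w) be the conditional mean of `X` and C(w) its
conditional covariance. Put q = E|M|², K = E‖C‖² (Hilbert-Schmidt), N = E C, n = ‖N‖², and let L be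
the relative entropy of the output with respect to `G`. Two identities govern the flow in `r`: q' =
2rK (`hasDerivAt_estEnergy`) and L' = rq (`hasDerivAt_logPartition`). Log-concavity enters through
the Prékopa-Leindler inequality: the output density is log-concave, the Hessian of its logarithm is
r²C - I, hence r²C ≤ I (`sum_condCov_le`).

Let U = (X + Y)/√2. The normalized sum of the outputs of two channels is the output of the channel
with input U. Knowing both outputs is better than knowing their sum; testing the gain against the
nonnegative matrix I - r²C_U yields `fisher_jump`: (r²/2)(K - n) ≤ 2(q - q_U) + r²(K - K_U). The
left side is a variance of C. A spectral gap c of `X` passes to the output (`variance_obs_le`);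
applied to M minus its mean linear part it bounds that variance from below by the rate at which the
entropy gap between `X` and a Gaussian builds up (`mul_le_of_poincare`, `poincare_dissipation`).
Therefore `jumpFunctional` is nondecreasing in `r`. It vanishes at 0, and as r → ∞ its nonnegativity
becomes the entropy jump with κ = c/8 (`entropy_jump`).

The isotropic constant is reached by two uses of Gibbs' inequality for log-concave densities: Ent(U)
- Ent(X) ≤ (d/2) log 2 and Ent(X) ≤ d - log f(0). Since Ent(G) ≥ d, a jump κ forces κ log f(0) ≤
(d/2) log 2, which is more than enough for exp(2/κ). With κ = c/8 this reads exp(16/c), uniform in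
the dimension; hence KLS implies slicing, and letting 1/c decrease to the Poincaré constant gives
the third bound. -/

set_option linter.unusedSectionVars false

/-! ### The standard Gaussian law: density, translations, moments. -/

section GaussianDensity

variable {E : Type*} [NormedAddCommGroup E] [InnerProductSpace ℝ E] [FiniteDimensional ℝ E]
  [MeasurableSpace E] [BorelSpace E]

/-- The density of the standard Gaussian law on a finite-dimensional inner product space. -/
noncomputable def gaussianDensity (w : E) : ℝ :=
  (2 * Real.pi) ^ (-(Module.finrank ℝ E / 2 : ℝ)) * Real.exp (-(1 / 2) * ‖w‖ ^ 2)

lemma gaussianDensity_pos (w : E) : 0 < gaussianDensity w := by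
  unfold gaussianDensity; positivity

lemma continuous_gaussianDensity : Continuous (gaussianDensity : E → ℝ) := by
  unfold gaussianDensity; fun_prop

lemma integral_gaussianDensity : ∫ w : E, gaussianDensity w = 1 := by
  unfold gaussianDensity
  rw [integral_const_mul, GaussianFourier.integral_rexp_neg_mul_sq_norm (by norm_num),
    Real.rpow_neg (by positivity)]
  rw [show Real.pi / (1 / 2) = 2 * Real.pi by ring]
  exact inv_mul_cancel₀ (by positivity)

lemma integrable_gaussianDensity : Integrable (gaussianDensity : E → ℝ) :=
  Integrable.of_integral_ne_zero (by rw [integral_gaussianDensity]; exact one_ne_zero)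

/-- Both sides have the same characteristic function: the Gaussian Fourier integral with b = 1/2
produces exp(-‖t‖²/2), and the normalising constants cancel. -/
lemma stdGaussian_eq_withDensity :
    stdGaussian E = volume.withDensity fun w : E => ENNReal.ofReal (gaussianDensity w) := by
  have hfin : IsFiniteMeasure (volume.withDensity fun w : E => ENNReal.ofReal (gaussianDensity w)) :=
    isFiniteMeasure_withDensity_ofReal integrable_gaussianDensity.2
  apply Measure.ext_of_charFun
  ext t
  rw [charFun_stdGaussian, charFun_apply,
    integral_withDensity_eq_integral_toReal_smul
      (by exact continuous_gaussianDensity.measurable.ennreal_ofReal)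
      (by filter_upwards with w using ENNReal.ofReal_lt_top)]
  have h := GaussianFourier.integral_cexp_neg_mul_sq_norm_add (V := E) (b := 1 / 2)
    (by norm_num) Complex.I t
  have h2 : ∀ w : E, (ENNReal.ofReal (gaussianDensity w)).toReal • Complex.exp (inner ℝ w t * Complex.I)
      = ((2 * Real.pi) ^ (-(Module.finrank ℝ E / 2 : ℝ)) : ℝ) *
        Complex.exp (-(1 / 2) * ‖w‖ ^ 2 + Complex.I * inner ℝ t w) := by
    intro w
    rw [ENNReal.toReal_ofReal (gaussianDensity_pos w).le, gaussianDensity, Complex.real_smul,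
      Complex.exp_add, real_inner_comm]
    push_cast
    ring_nf
  simp_rw [h2]
  rw [integral_const_mul, h]
  have h3 : ((2 * Real.pi) ^ (-(Module.finrank ℝ E / 2 : ℝ)) : ℝ) *
      ((Real.pi : ℂ) / (1 / 2)) ^ (Module.finrank ℝ E / 2 : ℂ) = 1 := by
    have : ((Real.pi : ℂ) / (1 / 2)) ^ (Module.finrank ℝ E / 2 : ℂ) =
        (((2 * Real.pi) ^ (Module.finrank ℝ E / 2 : ℝ) : ℝ) : ℂ) := by
      rw [Complex.ofReal_cpow (by positivity)]
      push_cast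
      congr 1
      ring
    rw [this, ← Complex.ofReal_mul, ← Real.rpow_add (by positivity)]
    simp
  rw [← mul_assoc, h3, one_mul]
  congr 1
  rw [Complex.I_sq]
  ring

lemma lintegral_stdGaussian {F : E → ℝ≥0∞} (hF : Measurable F) :
    ∫⁻ w, F w ∂(stdGaussian E) = ∫⁻ w, ENNReal.ofReal (gaussianDensity w) * F w := by
  rw [stdGaussian_eq_withDensity, lintegral_withDensity_eq_lintegral_mul _ _ hF]
  · rfl
  · exact continuous_gaussianDensity.measurable.ennreal_ofReal

lemma integral_stdGaussian {G : Type*} [NormedAddCommGroup G] [NormedSpace ℝ G] (F : E → G) :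
    ∫ w, F w ∂(stdGaussian E) = ∫ w, gaussianDensity w • F w := by
  rw [stdGaussian_eq_withDensity, integral_withDensity_eq_integral_toReal_smul
      (by exact continuous_gaussianDensity.measurable.ennreal_ofReal)
      (by filter_upwards with w using ENNReal.ofReal_lt_top)]
  simp_rw [ENNReal.toReal_ofReal (gaussianDensity_pos _).le]

lemma integrable_stdGaussian_iff {G : Type*} [NormedAddCommGroup G] [NormedSpace ℝ G] (F : E → G) :
    Integrable F (stdGaussian E) ↔ Integrable (fun w => gaussianDensity w • F w) := by
  rw [stdGaussian_eq_withDensity, integrable_withDensity_iff_integrable_smul'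
      (by exact continuous_gaussianDensity.measurable.ennreal_ofReal)
      (by filter_upwards with w using ENNReal.ofReal_lt_top)]
  simp_rw [ENNReal.toReal_ofReal (gaussianDensity_pos _).le]

lemma gaussianDensity_sub (w a : E) :
    gaussianDensity (w - a) =
      gaussianDensity w * Real.exp (inner ℝ w a - ‖a‖ ^ 2 / 2) := by
  unfold gaussianDensity
  rw [mul_assoc, ← Real.exp_add, norm_sub_sq_real]
  ring_nf

/-- The Cameron-Martin formula. -/
lemma map_const_add_stdGaussian (a : E) :
    (stdGaussian E).map (fun z => a + z) =
      (stdGaussian E).withDensity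
        fun w => ENNReal.ofReal (Real.exp (inner ℝ w a - ‖a‖ ^ 2 / 2)) := by
  refine Measure.ext_of_lintegral _ fun F hF => ?_
  have hm : Measurable fun w : E => ENNReal.ofReal (Real.exp (inner ℝ w a - ‖a‖ ^ 2 / 2)) := by
    fun_prop
  rw [lintegral_map hF (by fun_prop), lintegral_withDensity_eq_lintegral_mul _ hm hF,
    lintegral_stdGaussian (by fun_prop), lintegral_stdGaussian (hm.mul hF),
    ← lintegral_sub_right_eq_self _ a]
  refine lintegral_congr fun w => ?_
  rw [gaussianDensity_sub, Pi.mul_apply, ENNReal.ofReal_mul (gaussianDensity_pos w).le, mul_assoc]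
  simp

lemma lintegral_const_add_stdGaussian (a : E) {F : E → ℝ≥0∞} (hF : Measurable F) :
    ∫⁻ z, F (a + z) ∂(stdGaussian E) =
      ∫⁻ w, ENNReal.ofReal (Real.exp (inner ℝ w a - ‖a‖ ^ 2 / 2)) * F w ∂(stdGaussian E) := by
  have hm : Measurable fun w : E => ENNReal.ofReal (Real.exp (inner ℝ w a - ‖a‖ ^ 2 / 2)) := by
    fun_prop
  rw [← lintegral_map hF (by fun_prop : Measurable fun z : E => a + z), map_const_add_stdGaussian,
    lintegral_withDensity_eq_lintegral_mul _ hm hF]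
  rfl

lemma integral_norm_sq_stdGaussian (v : E) :
    ∫ z, (inner ℝ z v) ^ 2 ∂(stdGaussian E) = ‖v‖ ^ 2 := by
  have h := variance_dual_stdGaussian (E := E) (innerSL ℝ v)
  rw [variance_of_integral_eq_zero (innerSL ℝ v).continuous.aemeasurable
    (integral_strongDual_stdGaussian _), innerSL_apply_norm] at h
  rw [← h]
  refine integral_congr_ae (.of_forall fun z => ?_)
  simp [real_inner_comm]

lemma integrable_norm_sq_stdGaussian : Integrable (fun z : E => ‖z‖ ^ 2) (stdGaussian E) :=
  (IsGaussian.memLp_two_id (μ := stdGaussian E)).integrable_norm_pow (by norm_num)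

lemma integrable_norm_stdGaussian : Integrable (fun z : E => ‖z‖) (stdGaussian E) :=
  (IsGaussian.integrable_id (μ := stdGaussian E)).norm

end GaussianDensity

/-! ### Gaussian integration by parts and the Gaussian Poincaré inequality. -/

section GaussianPoincare

variable {E : Type*} [NormedAddCommGroup E] [InnerProductSpace ℝ E] [FiniteDimensional ℝ E]
  [MeasurableSpace E] [BorelSpace E]

lemma hasFDerivAt_gaussianDensity (w : E) :
    HasFDerivAt (gaussianDensity : E → ℝ) (-gaussianDensity w • innerSL ℝ w) w := by
  have h1 : HasFDerivAt (fun w : E => -(1 / 2) * ‖w‖ ^ 2) (-innerSL ℝ w) w := by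
    have := ((hasStrictFDerivAt_norm_sq w).hasFDerivAt).const_mul (-(1 / 2) : ℝ)
    refine this.congr_fderiv ?_
    ext v
    simp
  have h2 := (h1.exp).const_mul ((2 * Real.pi) ^ (-(Module.finrank ℝ E / 2 : ℝ)))
  refine h2.congr_fderiv ?_
  ext v
  simp [gaussianDensity]
  ring

lemma abs_le_of_fderiv_le {g : E → ℝ} (hg : Differentiable ℝ g) {M : ℝ}
    (hM : ∀ z, ‖fderiv ℝ g z‖ ≤ M) (z : E) : |g z| ≤ |g 0| + M * ‖z‖ := by
  have h := Convex.norm_image_sub_le_of_norm_fderiv_le (𝕜 := ℝ) (f := g) (s := Set.univ)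
    (fun x _ => hg x) (fun x _ => hM x) convex_univ (Set.mem_univ 0) (Set.mem_univ z)
  rw [sub_zero, Real.norm_eq_abs] at h
  have := abs_sub_abs_le_abs_sub (g z) (g 0)
  linarith

/-- Gaussian integration by parts. -/
lemma integral_mul_inner_stdGaussian {h : E → ℝ} (hh : ContDiff ℝ 1 h) {M : ℝ}
    (hM : ∀ z, ‖fderiv ℝ h z‖ ≤ M) (v : E) :
    ∫ z, h z * inner ℝ v z ∂(stdGaussian E) = ∫ z, fderiv ℝ h z v ∂(stdGaussian E) := by
  have hd := hh.differentiable one_ne_zero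
  have hfd : ∀ z : E, fderiv ℝ gaussianDensity z v = -(gaussianDensity z * inner ℝ v z) := by
    intro z
    rw [(hasFDerivAt_gaussianDensity z).fderiv]
    simp [real_inner_comm]
  have hcf : Continuous fun z => fderiv ℝ h z v :=
    (hh.continuous_fderiv one_ne_zero).clm_apply continuous_const
  have i1 : Integrable (fun z => fderiv ℝ h z v) (stdGaussian E) := by
    refine (integrable_const (M * ‖v‖)).mono' hcf.aestronglyMeasurable (.of_forall fun z => ?_)
    exact ((fderiv ℝ h z).le_opNorm v).trans (by gcongr; exact hM z)
  have i2 : Integrable h (stdGaussian E) := by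
    refine ((integrable_const |h 0|).add (integrable_norm_stdGaussian.const_mul M)).mono'
      hh.continuous.aestronglyMeasurable (.of_forall fun z => abs_le_of_fderiv_le hd hM z)
  have i3 : Integrable (fun z => h z * inner ℝ v z) (stdGaussian E) := by
    refine (((integrable_norm_stdGaussian.const_mul |h 0|).add
      (integrable_norm_sq_stdGaussian.const_mul M)).const_mul ‖v‖).mono'
      (by have := hh.continuous; fun_prop) (.of_forall fun z => ?_)
    rw [norm_mul, Real.norm_eq_abs]
    calc |h z| * ‖inner ℝ v z‖ ≤ (|h 0| + M * ‖z‖) * (‖v‖ * ‖z‖) := by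
          exact mul_le_mul (abs_le_of_fderiv_le hd hM z) (norm_inner_le_norm v z) (norm_nonneg _)
            ((abs_nonneg _).trans (abs_le_of_fderiv_le hd hM z))
      _ = _ := by simp; ring
  rw [integrable_stdGaussian_iff] at i1 i2 i3
  have := integral_mul_fderiv_eq_neg_fderiv_mul_of_integrable (μ := (volume : Measure E))
    (f := h) (g := gaussianDensity) (v := v)
    (i1.congr (.of_forall fun z => by simp [mul_comm]))
    (i3.neg.congr (.of_forall fun z => by simp [hfd]; ring))
    (i2.congr (.of_forall fun z => by simp [mul_comm]))
    (fun x _ => hd x) (fun x _ => (hasFDerivAt_gaussianDensity x).differentiableAt)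
  rw [integral_stdGaussian, integral_stdGaussian]
  simp_rw [hfd] at this
  calc ∫ z, gaussianDensity z • (h z * inner ℝ v z)
      = -∫ z, h z * -(gaussianDensity z * inner ℝ v z) := by
        rw [← integral_neg]
        exact integral_congr_ae (.of_forall fun z => by simp; ring)
    _ = _ := by
        rw [this, neg_neg]
        exact integral_congr_ae (.of_forall fun z => by simp; ring)

lemma map_rotation_stdGaussian (θ : ℝ) :
    MeasurePreserving (ContinuousLinearMap.rotation θ)
      ((stdGaussian E).prod (stdGaussian E)) ((stdGaussian E).prod (stdGaussian E)) :=
  ⟨(ContinuousLinearMap.rotation θ).continuous.measurable,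
    IsGaussian.map_rotation_eq_self (by simp) θ⟩

lemma integral_comp_rotation_stdGaussian (θ : ℝ) {F : E × E → ℝ} (hF : Continuous F) :
    ∫ p, F (ContinuousLinearMap.rotation θ p) ∂((stdGaussian E).prod (stdGaussian E)) =
      ∫ p, F p ∂((stdGaussian E).prod (stdGaussian E)) := by
  rw [← integral_map (ContinuousLinearMap.rotation θ).continuous.aemeasurable
    hF.aestronglyMeasurable, (map_rotation_stdGaussian θ).map_eq]

/-- The Gaussian Poincaré inequality. -/
theorem stdGaussian_poincare {g : E → ℝ} (hg : ContDiff ℝ 1 g) {M : ℝ}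
    (hM : ∀ z, ‖fderiv ℝ g z‖ ≤ M) :
    ∫ z, g z ^ 2 ∂(stdGaussian E) - (∫ z, g z ∂(stdGaussian E)) ^ 2 ≤
      ∫ z, ‖fderiv ℝ g z‖ ^ 2 ∂(stdGaussian E) := by
  set γ := stdGaussian E with hγ
  have hM0 : 0 ≤ M := (norm_nonneg _).trans (hM 0)
  have hd := hg.differentiable one_ne_zero
  have hgc := hg.continuous
  have hfc := hg.continuous_fderiv one_ne_zero
  set I := ∫ z, ‖fderiv ℝ g z‖ ^ 2 ∂γ with hI
  have hIint : Integrable (fun z => ‖fderiv ℝ g z‖ ^ 2) γ := by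
    refine (integrable_const (M ^ 2)).mono' (by fun_prop) (.of_forall fun z => ?_)
    rw [norm_pow, norm_norm]; gcongr; exact hM z
  have iN1 : Integrable (fun p : E × E => ‖p.1‖ ^ 2) (γ.prod γ) :=
    integrable_norm_sq_stdGaussian.comp_fst γ
  have iN2 : Integrable (fun p : E × E => ‖p.2‖ ^ 2) (γ.prod γ) :=
    integrable_norm_sq_stdGaussian.comp_snd γ
  -- A Lipschitz function grows at most linearly, so one quadratic bound dominates every product
  -- that occurs, uniformly in the angle.
  set B : E × E → ℝ := fun p => (|g 0| + M * (‖p.1‖ + ‖p.2‖)) ^ 2 + (M * (‖p.1‖ + ‖p.2‖)) ^ 2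
    with hB
  have iB : Integrable B (γ.prod γ) := by
    refine (((integrable_const (2 * |g 0| ^ 2)).add (iN1.const_mul (6 * M ^ 2))).add
      (iN2.const_mul (6 * M ^ 2))).mono' (by fun_prop) (.of_forall fun p => ?_)
    rw [Real.norm_of_nonneg (by positivity)]
    simp only [hB, Pi.add_apply]
    nlinarith [sq_nonneg (|g 0| - M * (‖p.1‖ + ‖p.2‖)), sq_nonneg (M * ‖p.1‖ - M * ‖p.2‖)]
  have hlin : ∀ (a b : ℝ) (p : E × E), |a| ≤ 1 → |b| ≤ 1 →
      ‖a • p.1 + b • p.2‖ ≤ ‖p.1‖ + ‖p.2‖ := by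
    intro a b p ha hb
    refine (norm_add_le _ _).trans ?_
    rw [norm_smul, norm_smul, Real.norm_eq_abs, Real.norm_eq_abs]
    gcongr
    · exact mul_le_of_le_one_left (norm_nonneg _) ha
    · exact mul_le_of_le_one_left (norm_nonneg _) hb
  have hgrow : ∀ (a b : ℝ) (p : E × E), |a| ≤ 1 → |b| ≤ 1 →
      |g (a • p.1 + b • p.2)| ≤ |g 0| + M * (‖p.1‖ + ‖p.2‖) := by
    intro a b p ha hb
    refine (abs_le_of_fderiv_le hd hM _).trans ?_
    gcongr
    exact hlin a b p ha hb
  have hprod : ∀ x y a b : ℝ, |x| ≤ a → |y| ≤ b → ‖x * y‖ ≤ a ^ 2 + b ^ 2 := by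
    intro x y a b hx hy
    rw [norm_mul, Real.norm_eq_abs, Real.norm_eq_abs]
    nlinarith [abs_nonneg x, abs_nonneg y, sq_nonneg (|x| - |y|), mul_self_le_mul_self (abs_nonneg x) hx,
      mul_self_le_mul_self (abs_nonneg y) hy]
  -- Interpolation by rotations: Ψ is ∫ g² at θ = 0 and (∫ g)² at θ = π/2. Its derivative is Φ.
  set Ψ : ℝ → ℝ := fun θ => ∫ p, g p.1 * g (Real.cos θ • p.1 + Real.sin θ • p.2) ∂(γ.prod γ)
    with hΨ
  set Φ : ℝ → ℝ := fun θ => ∫ p, g p.1 * fderiv ℝ g (Real.cos θ • p.1 + Real.sin θ • p.2)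
    (-Real.sin θ • p.1 + Real.cos θ • p.2) ∂(γ.prod γ) with hΦ
  have hg1 : ∀ p : E × E, |g p.1| ≤ |g 0| + M * (‖p.1‖ + ‖p.2‖) := by
    intro p
    simpa using hgrow 1 0 p (by simp) (by simp)
  have hsin := fun θ => Real.abs_sin_le_one θ
  have hcos := fun θ => Real.abs_cos_le_one θ
  have hnsin : ∀ θ, |-Real.sin θ| ≤ 1 := fun θ => by rw [abs_neg]; exact hsin θ
  have hderiv : ∀ θ, HasDerivAt Ψ (Φ θ) θ := by
    intro θ
    refine (hasDerivAt_integral_of_dominated_loc_of_deriv_le (𝕜 := ℝ) (μ := γ.prod γ)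
      (F := fun θ p => g p.1 * g (Real.cos θ • p.1 + Real.sin θ • p.2))
      (F' := fun θ p => g p.1 * fderiv ℝ g (Real.cos θ • p.1 + Real.sin θ • p.2)
        (-Real.sin θ • p.1 + Real.cos θ • p.2)) (bound := B) (s := Set.univ)
      Filter.univ_mem (.of_forall fun θ => ?_) ?_ ?_ (.of_forall fun p θ _ => ?_) iB
      (.of_forall fun p θ _ => ?_)).2
    · fun_prop
    · refine (iB.const_mul 2).mono' (by fun_prop) (.of_forall fun p => ?_)
      refine (hprod _ _ _ _ (hg1 p) (hgrow _ _ p (hcos θ) (hsin θ))).trans ?_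
      simp only [hB]
      nlinarith [sq_nonneg (M * (‖p.1‖ + ‖p.2‖))]
    · fun_prop
    · refine hprod _ _ _ (M * (‖p.1‖ + ‖p.2‖)) (hg1 p) ?_
      rw [← Real.norm_eq_abs]
      refine (ContinuousLinearMap.le_opNorm _ _).trans ?_
      gcongr
      · exact hM _
      · exact hlin _ _ p (hnsin θ) (hcos θ)
    · have h1 : HasDerivAt (fun θ => Real.cos θ • p.1 + Real.sin θ • p.2)
          (-Real.sin θ • p.1 + Real.cos θ • p.2) θ :=
        ((Real.hasDerivAt_cos θ).smul_const p.1).add ((Real.hasDerivAt_sin θ).smul_const p.2)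
      exact ((hd _).hasFDerivAt.comp_hasDerivAt θ h1).const_mul (g p.1)
  have hbound : ∀ θ, 0 ≤ Real.sin θ → -(Real.sin θ * I) ≤ Φ θ := by
    intro θ hθ
    set c := Real.cos θ
    set s := Real.sin θ
    set G : E → E := fun a => (InnerProductSpace.toDual ℝ E).symm (fderiv ℝ g a) with hG
    have hGc : Continuous G := (InnerProductSpace.toDual ℝ E).symm.continuous.comp hfc
    have hGn : ∀ a, ‖G a‖ = ‖fderiv ℝ g a‖ := fun a => by simp [hG]
    have hGi : ∀ a b, fderiv ℝ g a b = inner ℝ (G a) b := fun a b => by simp [hG]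
    -- Rotation invariance moves the angle into the factor without derivative. The second variable
    -- then occurs linearly in the other factor, ready for integration by parts.
    have e1 : Φ θ = ∫ p : E × E, g (c • p.1 - s • p.2) * inner ℝ (G p.1) p.2 ∂(γ.prod γ) := by
      rw [← integral_comp_rotation_stdGaussian θ (by fun_prop)]
      refine integral_congr_ae (.of_forall fun p => ?_)
      have hcs : c ^ 2 + s ^ 2 = 1 := Real.cos_sq_add_sin_sq θ
      have : c • (c • p.1 + s • p.2) - s • (-s • p.1 + c • p.2) = p.1 := by
        rw [show c • (c • p.1 + s • p.2) - s • (-s • p.1 + c • p.2) = (c ^ 2 + s ^ 2) • p.1 by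
          module, hcs, one_smul]
      simp only [ContinuousLinearMap.rotation_apply]
      change _ = g (c • (c • p.1 + s • p.2) - s • (-s • p.1 + c • p.2)) * _
      rw [this, hGi]
    have i1 : Integrable (fun p : E × E => g (c • p.1 - s • p.2) * inner ℝ (G p.1) p.2)
        (γ.prod γ) := by
      refine iB.mono' (by fun_prop) (.of_forall fun p => hprod _ _ _ _ ?_ ?_)
      · have := hgrow c (-s) p (hcos θ) (hnsin θ)
        rwa [neg_smul, ← sub_eq_add_neg] at this
      · rw [← hGi, ← Real.norm_eq_abs]
        refine (ContinuousLinearMap.le_opNorm _ _).trans ?_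
        gcongr
        · exact hM _
        · linarith [norm_nonneg p.1]
    have hb : ∀ a b, |inner ℝ (G (c • a - s • b)) (G a)| ≤ M * M := by
      intro a b
      refine (abs_real_inner_le_norm _ _).trans ?_
      rw [hGn, hGn]
      gcongr <;> exact hM _
    have i2 : Integrable (fun p : E × E => inner ℝ (G (c • p.1 - s • p.2)) (G p.1))
        (γ.prod γ) := by
      refine (integrable_const (M * M)).mono' (by fun_prop) (.of_forall fun p => hb _ _)
    have e2 : Φ θ = ∫ p : E × E, -s * inner ℝ (G (c • p.1 - s • p.2)) (G p.1) ∂(γ.prod γ) := by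
      rw [e1, integral_prod _ i1, integral_prod _ (i2.const_mul _)]
      refine integral_congr_ae (.of_forall fun a => ?_)
      have hfd : ∀ b, HasFDerivAt (fun b => g (c • a - s • b))
          ((fderiv ℝ g (c • a - s • b)).comp (-(s • ContinuousLinearMap.id ℝ E))) b := by
        intro b
        refine HasFDerivAt.comp (g := g) b (hd _).hasFDerivAt ?_
        simpa using ((hasFDerivAt_id b).const_smul s).const_sub (c • a)
      have := integral_mul_inner_stdGaussian (h := fun b => g (c • a - s • b)) (M := M)
        (hg.comp (by fun_prop)) (fun b => ?_) (G a)
      · simp only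
        rw [this]
        refine integral_congr_ae (.of_forall fun b => ?_)
        simp only
        rw [(hfd b).fderiv]
        simp [hGi]
      · rw [(hfd b).fderiv]
        refine (ContinuousLinearMap.opNorm_comp_le _ _).trans ?_
        calc _ ≤ M * 1 := by
              gcongr
              · exact hM _
              · rw [norm_neg, norm_smul]
                exact mul_le_one₀ (by simpa using hsin θ) (norm_nonneg _)
                  ContinuousLinearMap.norm_id_le
          _ = M := mul_one M
    have e3 : ∫ p : E × E, ‖fderiv ℝ g (c • p.1 - s • p.2)‖ ^ 2 ∂(γ.prod γ) = I := by
      have h4 : ∫ p : E × E, ‖fderiv ℝ g p.1‖ ^ 2 ∂(γ.prod γ) = I := by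
        rw [integral_prod _ (hIint.comp_fst γ)]; simp [hI]
      rw [← h4, ← integral_comp_rotation_stdGaussian (-θ)
        (F := fun p => ‖fderiv ℝ g p.1‖ ^ 2) (by fun_prop)]
      refine integral_congr_ae (.of_forall fun p => ?_)
      simp [c, s, sub_eq_add_neg, ContinuousLinearMap.rotation_apply]
    have i3 : Integrable (fun p : E × E => ‖fderiv ℝ g (c • p.1 - s • p.2)‖ ^ 2) (γ.prod γ) := by
      refine (integrable_const (M ^ 2)).mono' (by fun_prop) (.of_forall fun z => ?_)
      rw [norm_pow, norm_norm]; gcongr; exact hM _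
    have h4 : ∫ p : E × E, ‖fderiv ℝ g p.1‖ ^ 2 ∂(γ.prod γ) = I := by
      rw [integral_prod _ (hIint.comp_fst γ)]; simp [hI]
    -- Cauchy-Schwarz and the inequality of means: both gradients have the same law, by rotation
    -- invariance.
    have e4 : ∫ p : E × E, inner ℝ (G (c • p.1 - s • p.2)) (G p.1) ∂(γ.prod γ) ≤ I := by
      calc _ ≤ ∫ p : E × E, (1 / 2 * ‖fderiv ℝ g (c • p.1 - s • p.2)‖ ^ 2 +
            1 / 2 * ‖fderiv ℝ g p.1‖ ^ 2) ∂(γ.prod γ) := by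
            refine integral_mono i2 ((i3.const_mul _).add ((hIint.comp_fst γ).const_mul _))
              fun p => ?_
            have := real_inner_le_norm (G (c • p.1 - s • p.2)) (G p.1)
            rw [hGn, hGn] at this
            simp only
            nlinarith [sq_nonneg (‖fderiv ℝ g (c • p.1 - s • p.2)‖ - ‖fderiv ℝ g p.1‖)]
        _ = I := by
            rw [integral_add (i3.const_mul _) ((hIint.comp_fst γ).const_mul _),
              integral_const_mul, integral_const_mul, e3, h4]
            ring
    rw [e2, integral_const_mul]
    nlinarith
  -- The bound Ψ' ≥ -I sin θ says that this difference has nonnegative derivative; comparing the end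
  -- points is the inequality.
  have hmono : MonotoneOn (fun θ => Ψ θ - I * Real.cos θ) (Set.Icc 0 (Real.pi / 2)) := by
    have hd2 : ∀ θ, HasDerivAt (fun θ => Ψ θ - I * Real.cos θ) (Φ θ - I * -Real.sin θ) θ :=
      fun θ => (hderiv θ).sub ((Real.hasDerivAt_cos θ).const_mul I)
    refine monotoneOn_of_deriv_nonneg (convex_Icc _ _)
      (fun θ _ => (hd2 θ).continuousAt.continuousWithinAt)
      (fun θ _ => (hd2 θ).differentiableAt.differentiableWithinAt) fun θ hθ => ?_
    rw [interior_Icc] at hθ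
    rw [(hd2 θ).deriv]
    have := hbound θ (Real.sin_nonneg_of_nonneg_of_le_pi hθ.1.le (by linarith [hθ.2, Real.pi_pos]))
    linarith
  have h0 : Ψ 0 = ∫ z, g z ^ 2 ∂γ := by
    simp only [hΨ, Real.cos_zero, Real.sin_zero, one_smul, zero_smul, add_zero]
    have := integral_prod_mul (μ := γ) (ν := γ) (fun z => g z ^ 2) (fun _ => (1 : ℝ))
    simpa [sq] using this
  have h1 : Ψ (Real.pi / 2) = (∫ z, g z ∂γ) ^ 2 := by
    simp only [hΨ, Real.cos_pi_div_two, Real.sin_pi_div_two, one_smul, zero_smul, zero_add]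
    rw [integral_prod_mul, sq]
  have := hmono (Set.left_mem_Icc.2 (by positivity)) (Set.right_mem_Icc.2 (by positivity))
    (by positivity)
  simp only [h0, h1, Real.cos_zero, Real.cos_pi_div_two] at this
  linarith

end GaussianPoincare

/-! ### Exponentially tilted moments and their regularity. -/

section Tilt

variable {E : Type} [NormedAddCommGroup E] [InnerProductSpace ℝ E] [FiniteDimensional ℝ E]
  [MeasurableSpace E] [BorelSpace E]

/-- The exponent of the likelihood of the observation `w = r x + z`, `z` Gaussian. -/
noncomputable def tiltExponent (r : ℝ) (w x : E) : ℝ := r * inner ℝ w x - r ^ 2 * ‖x‖ ^ 2 / 2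

lemma continuous_tiltExponent : Continuous fun p : ℝ × E × E => tiltExponent p.1 p.2.1 p.2.2 := by
  unfold tiltExponent; fun_prop

@[fun_prop]
lemma Continuous.tiltExponent {α : Type*} [TopologicalSpace α] {r : α → ℝ} {w x : α → E}
    (hr : Continuous r) (hw : Continuous w) (hx : Continuous x) :
    Continuous fun a => tiltExponent (r a) (w a) (x a) :=
  continuous_tiltExponent.comp (hr.prodMk (hw.prodMk hx))

/-- Completing the square. The bound involves neither `r` nor `x`, so tilted integrals are dominated
locally uniformly in both parameters, including r = 0. -/
lemma tiltExponent_le (r : ℝ) (w x : E) : tiltExponent r w x ≤ ‖w‖ ^ 2 / 2 := by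
  have h := sq_nonneg ‖w - r • x‖
  rw [norm_sub_sq_real, real_inner_smul_right, norm_smul, mul_pow, Real.norm_eq_abs, sq_abs] at h
  unfold tiltExponent
  linarith

lemma tiltExponent_eq (r : ℝ) (w x : E) :
    tiltExponent r w x = ‖w‖ ^ 2 / 2 - ‖w - r • x‖ ^ 2 / 2 := by
  rw [norm_sub_sq_real, real_inner_smul_right, norm_smul, mul_pow, Real.norm_eq_abs, sq_abs]
  unfold tiltExponent
  ring

/-- The unnormalised posterior moment of `P`. -/
noncomputable def tiltMoment {F : Type*} [NormedAddCommGroup F] [NormedSpace ℝ F] (μ : Measure E)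
    (r : ℝ) (P : E → F) (w : E) : F := ∫ x, Real.exp (tiltExponent r w x) • P x ∂μ

/-- `P` is integrable against all the Gaussian-damped exponentials. -/
def TiltIntegrable {F : Type*} [NormedAddCommGroup F] (μ : Measure E) (r : ℝ) (P : E → F) : Prop :=
  AEStronglyMeasurable P μ ∧
    ∀ R : ℝ, Integrable (fun x => Real.exp (R * ‖x‖ - r ^ 2 * ‖x‖ ^ 2 / 2) * ‖P x‖) μ

lemma MeasureTheory.Integrable.tiltIntegrable {F : Type*} [NormedAddCommGroup F] {μ : Measure E}
    {P : E → F} (hP : Integrable P μ) {r : ℝ} (hr : 0 < r) : TiltIntegrable μ r P := by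
  refine ⟨hP.1, fun R => ?_⟩
  refine (hP.norm.const_mul (Real.exp (R ^ 2 / (2 * r ^ 2)))).mono' ?_ (.of_forall fun x => ?_)
  · exact (Continuous.aestronglyMeasurable (by fun_prop)).mul hP.1.norm
  · rw [Real.norm_of_nonneg (by positivity)]
    gcongr
    rw [le_div_iff₀ (by positivity)]
    nlinarith [sq_nonneg (R - r ^ 2 * ‖x‖)]

variable {F : Type} [NormedAddCommGroup F] [NormedSpace ℝ F]

lemma continuous_smulRight_innerSL (r : ℝ) :
    Continuous fun p : E × F => (r • innerSL ℝ p.1).smulRight p.2 := by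
  have h1 : Continuous fun p : E × F => r • innerSL ℝ p.1 := by fun_prop
  exact (isBoundedBilinearMap_smulRight (𝕜 := ℝ) (E := E) (F := F)).continuous.comp
    (h1.prodMk continuous_snd)

lemma MeasureTheory.AEStronglyMeasurable.continuous_comp_graph {H : Type*} [NormedAddCommGroup H]
    {μ : Measure E} {P : E → F} (hP : AEStronglyMeasurable P μ) {G : E × F → H}
    (hG : Continuous G) : AEStronglyMeasurable (fun x => G (x, P x)) μ :=
  hG.comp_aestronglyMeasurable (aestronglyMeasurable_id.prodMk hP)

/-- Differentiating in the observation multiplies the integrand by r⟨x, ·⟩. The extra ‖x‖ is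
absorbed by exp ‖x‖, that is, by passing from R to R + 1; quantifying over all R makes the class
stable under differentiation. -/
lemma TiltIntegrable.smulRight {μ : Measure E} {P : E → F} {r : ℝ} (hP : TiltIntegrable μ r P) :
    TiltIntegrable μ r fun x => (r • innerSL ℝ x).smulRight (P x) := by
  have hm : AEStronglyMeasurable (fun x => (r • innerSL ℝ x).smulRight (P x)) μ :=
    hP.1.continuous_comp_graph (continuous_smulRight_innerSL r)
  refine ⟨hm, fun R => ?_⟩
  refine ((hP.2 (R + 1)).const_mul |r|).mono' ?_ (.of_forall fun x => ?_)
  · exact (Continuous.aestronglyMeasurable (by fun_prop)).mul hm.norm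
  · rw [Real.norm_of_nonneg (by positivity), ContinuousLinearMap.norm_smulRight_apply, norm_smul,
      innerSL_apply_norm, Real.norm_eq_abs]
    have h1 : ‖x‖ ≤ Real.exp ‖x‖ := by linarith [Real.add_one_le_exp ‖x‖]
    calc _ ≤ Real.exp (R * ‖x‖ - r ^ 2 * ‖x‖ ^ 2 / 2) * (|r| * Real.exp ‖x‖ * ‖P x‖) := by gcongr
      _ = _ := by
        rw [show (R + 1) * ‖x‖ - r ^ 2 * ‖x‖ ^ 2 / 2 =
          (R * ‖x‖ - r ^ 2 * ‖x‖ ^ 2 / 2) + ‖x‖ by ring, Real.exp_add]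
        ring

lemma TiltIntegrable.integrable {μ : Measure E} {P : E → F} {r : ℝ} (hP : TiltIntegrable μ r P)
    (w : E) : Integrable (fun x => Real.exp (tiltExponent r w x) • P x) μ := by
  refine (hP.2 (|r| * ‖w‖)).mono' ?_ (.of_forall fun x => ?_)
  · exact (Continuous.aestronglyMeasurable (by fun_prop)).smul hP.1
  · rw [norm_smul, Real.norm_of_nonneg (by positivity), tiltExponent]
    refine mul_le_mul_of_nonneg_right (Real.exp_le_exp.2 (sub_le_sub_right ?_ _)) (norm_nonneg _)
    calc r * inner ℝ w x ≤ |r| * |inner ℝ w x| := by rw [← abs_mul]; exact le_abs_self _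
      _ ≤ |r| * (‖w‖ * ‖x‖) := by gcongr; exact abs_real_inner_le_norm w x
      _ = _ := by ring

lemma hasFDerivAt_tiltMoment {μ : Measure E} {P : E → F} {r : ℝ}
    (hP : TiltIntegrable μ r P) (w : E) :
    HasFDerivAt (tiltMoment μ r P)
      (tiltMoment μ r (fun x => (r • innerSL ℝ x).smulRight (P x)) w) w := by
  have hP' := hP.smulRight
  refine (hasFDerivAt_integral_of_dominated_of_fderiv_le (μ := μ)
    (F := fun w x => Real.exp (tiltExponent r w x) • P x)
    (F' := fun w x => Real.exp (tiltExponent r w x) • (r • innerSL ℝ x).smulRight (P x))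
    (Metric.ball_mem_nhds w one_pos) (.of_forall fun w => (hP.integrable w).1) (hP.integrable w)
    (hP'.integrable w).1 (.of_forall fun x v hv => ?_) (hP'.2 (|r| * (‖w‖ + 1)))
    (.of_forall fun x v _ => ?_))
  · rw [norm_smul, Real.norm_of_nonneg (by positivity), tiltExponent]
    have hv' : ‖v‖ ≤ ‖w‖ + 1 := by
      rw [mem_ball_iff_norm] at hv
      linarith [norm_le_norm_add_norm_sub' v w]
    refine mul_le_mul_of_nonneg_right (Real.exp_le_exp.2 (sub_le_sub_right ?_ _)) (norm_nonneg _)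
    calc r * inner ℝ v x ≤ |r| * |inner ℝ v x| := by rw [← abs_mul]; exact le_abs_self _
      _ ≤ |r| * (‖v‖ * ‖x‖) := by gcongr; exact abs_real_inner_le_norm v x
      _ ≤ |r| * ((‖w‖ + 1) * ‖x‖) := by gcongr
      _ = _ := by ring
  · have h1 : HasFDerivAt (fun v => tiltExponent r v x) (r • innerSL ℝ x) v := by
      have := (((innerSL ℝ x).hasFDerivAt (x := v)).const_mul r).sub_const (r ^ 2 * ‖x‖ ^ 2 / 2)
      refine this.congr_of_eventuallyEq (.of_forall fun v => ?_)
      simp [tiltExponent, real_inner_comm]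
    refine (h1.exp.smul_const (P x)).congr_fderiv ?_
    ext u
    simp [mul_smul]

/-- The derivative is again a tilted moment, now with values in `E →L[ℝ] F`, so the induction on the
order of smoothness must let `F` vary. Keeping `E` and `F` in one universe makes this possible. -/
lemma contDiff_tiltMoment {μ : Measure E} {P : E → F} {r : ℝ}
    (hP : TiltIntegrable μ r P) : ContDiff ℝ ∞ (tiltMoment μ r P) := by
  rw [contDiff_infty]
  intro n
  induction n generalizing F with
  | zero =>
    exact contDiff_zero.2 (continuous_iff_continuousAt.2 fun w =>
      (hasFDerivAt_tiltMoment hP w).continuousAt)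
  | succ n ih =>
    push_cast
    rw [contDiff_succ_iff_fderiv]
    refine ⟨fun w => (hasFDerivAt_tiltMoment hP w).differentiableAt, by simp, ?_⟩
    rw [show fderiv ℝ (tiltMoment μ r P) = tiltMoment μ r
      (fun x => (r • innerSL ℝ x).smulRight (P x)) from
      funext fun w => (hasFDerivAt_tiltMoment hP w).fderiv]
    exact ih hP.smulRight

/-- Continuity jointly in the signal strength and the observation is what the envelope argument
needs, where both vary. -/
lemma continuous_tiltMoment {μ : Measure E} {P : E → F} (hP : Integrable P μ) :
    Continuous fun p : ℝ × E => tiltMoment μ p.1 P p.2 := by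
  rw [continuous_iff_continuousAt]
  intro p
  refine continuousAt_of_dominated (bound := fun x => Real.exp ((‖p.2‖ + 1) ^ 2 / 2) * ‖P x‖)
    (.of_forall fun q => ?_) ?_ (hP.norm.const_mul _) (.of_forall fun x => ?_)
  · exact (Continuous.aestronglyMeasurable (by fun_prop)).smul hP.1
  · filter_upwards [Metric.ball_mem_nhds p one_pos] with q hq
    refine .of_forall fun x => ?_
    rw [norm_smul, Real.norm_of_nonneg (by positivity)]
    have hq' : ‖q.2‖ ≤ ‖p.2‖ + 1 := by
      rw [mem_ball_iff_norm] at hq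
      have := (norm_snd_le (q - p)).trans hq.le
      rw [Prod.snd_sub] at this
      linarith [norm_le_norm_add_norm_sub' q.2 p.2]
    gcongr
    exact (tiltExponent_le _ _ _).trans (by gcongr)
  · exact Continuous.continuousAt (by fun_prop)

end Tilt

/-! ### Bayes' rule for the Gaussian channel. -/

section Posterior

variable {E : Type} [NormedAddCommGroup E] [InnerProductSpace ℝ E] [FiniteDimensional ℝ E]
  [MeasurableSpace E] [BorelSpace E]

/-- The normalising constant of the posterior law; it is the density of the law of `r x + z` with
respect to the Gaussian law of `z`. -/
noncomputable def partitionFn (μ : Measure E) (r : ℝ) (w : E) : ℝ :=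
  ∫ x, Real.exp (tiltExponent r w x) ∂μ

/-- The posterior mean of `P x` when `x` has law `μ` and `w = r x + z` is observed. -/
noncomputable def postMean (μ : Measure E) (r : ℝ) (P : E → ℝ) (w : E) : ℝ :=
  ∫ x, P x ∂(μ.tilted (tiltExponent r w))

variable {μ : Measure E} [IsProbabilityMeasure μ] {r : ℝ} {P : E → ℝ}

lemma partitionFn_eq (μ : Measure E) (r : ℝ) : partitionFn μ r = tiltMoment μ r fun _ => (1 : ℝ) := by
  ext w; simp [partitionFn, tiltMoment]

lemma integrable_exp_tiltExponent (r : ℝ) (w : E) :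
    Integrable (fun x => Real.exp (tiltExponent r w x)) μ := by
  refine (integrable_const (Real.exp (‖w‖ ^ 2 / 2))).mono'
    (Continuous.aestronglyMeasurable (by fun_prop)) (.of_forall fun x => ?_)
  rw [Real.norm_of_nonneg (by positivity)]
  gcongr
  exact tiltExponent_le r w x

lemma partitionFn_pos (r : ℝ) (w : E) : 0 < partitionFn μ r w :=
  integral_exp_pos (integrable_exp_tiltExponent r w)

instance isProbabilityMeasure_posterior (r : ℝ) (w : E) :
    IsProbabilityMeasure (μ.tilted (tiltExponent r w)) :=
  isProbabilityMeasure_tilted (integrable_exp_tiltExponent r w)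

lemma postMean_eq (μ : Measure E) (r : ℝ) (P : E → ℝ) (w : E) :
    postMean μ r P w = tiltMoment μ r P w / partitionFn μ r w := by
  rw [postMean, integral_tilted, tiltMoment, partitionFn, ← integral_div]
  refine integral_congr_ae (.of_forall fun x => ?_)
  simp only [smul_eq_mul]
  ring

lemma MeasureTheory.Integrable.exp_tiltExponent_mul (hP : Integrable P μ) (r : ℝ) (w : E) :
    Integrable (fun x => Real.exp (tiltExponent r w x) * P x) μ := by
  refine (hP.norm.const_mul (Real.exp (‖w‖ ^ 2 / 2))).mono'
    ((Continuous.aestronglyMeasurable (by fun_prop)).mul hP.1) (.of_forall fun x => ?_)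
  rw [norm_mul, Real.norm_of_nonneg (Real.exp_pos _).le]
  gcongr
  exact tiltExponent_le r w x

lemma MeasureTheory.Integrable.posterior (hP : Integrable P μ) (r : ℝ) (w : E) :
    Integrable P (μ.tilted (tiltExponent r w)) := by
  rw [integrable_tilted_iff (integrable_exp_tiltExponent r w)]
  exact hP.exp_tiltExponent_mul r w

lemma contDiff_partitionFn (hr : 0 < r) : ContDiff ℝ ∞ (partitionFn μ r) := by
  rw [partitionFn_eq]
  exact contDiff_tiltMoment ((integrable_const 1).tiltIntegrable hr)

lemma contDiff_postMean (hr : 0 < r) (hP : Integrable P μ) : ContDiff ℝ ∞ (postMean μ r P) := by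
  rw [show postMean μ r P = fun w => tiltMoment μ r P w / partitionFn μ r w from
    funext fun w => postMean_eq μ r P w]
  exact (contDiff_tiltMoment (hP.tiltIntegrable hr)).div (contDiff_partitionFn hr)
    fun w => (partitionFn_pos r w).ne'

lemma continuous_partitionFn : Continuous fun p : ℝ × E => partitionFn μ p.1 p.2 := by
  have := continuous_tiltMoment (μ := μ) (P := fun _ => (1 : ℝ)) (integrable_const 1)
  simpa only [← partitionFn_eq] using this

lemma continuous_postMean (hP : Integrable P μ) :
    Continuous fun p : ℝ × E => postMean μ p.1 P p.2 := by
  simp_rw [postMean_eq]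
  exact (continuous_tiltMoment hP).div continuous_partitionFn fun p => (partitionFn_pos _ _).ne'

lemma fderiv_tiltMoment_apply (hr : 0 < r) (hP : Integrable P μ) (w v : E) :
    fderiv ℝ (tiltMoment μ r P) w v = r * tiltMoment μ r (fun x => P x * inner ℝ x v) w := by
  have hP' := hP.tiltIntegrable hr
  rw [(hasFDerivAt_tiltMoment hP' w).fderiv, tiltMoment,
    ContinuousLinearMap.integral_apply (hP'.smulRight.integrable w), tiltMoment,
    ← integral_const_mul]
  refine integral_congr_ae (.of_forall fun x => ?_)
  simp
  ring

lemma fderiv_partitionFn_apply (hr : 0 < r) (w v : E) :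
    fderiv ℝ (partitionFn μ r) w v =
      partitionFn μ r w * (r * postMean μ r (fun x => inner ℝ x v) w) := by
  rw [partitionFn_eq, fderiv_tiltMoment_apply hr (integrable_const 1), ← partitionFn_eq,
    postMean_eq]
  have := (partitionFn_pos (μ := μ) r w).ne'
  simp only [one_mul]
  field_simp

/-- The derivative of a posterior mean is `r` times a posterior covariance. It comes from
differentiating the product of `postMean` and `partitionFn`, which is a plain tilted moment. -/
lemma fderiv_postMean_apply (hr : 0 < r) (hP : Integrable P μ) (w v : E) :
    fderiv ℝ (postMean μ r P) w v = r * (postMean μ r (fun x => P x * inner ℝ x v) w -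
      postMean μ r P w * postMean μ r (fun x => inner ℝ x v) w) := by
  have hZ := (partitionFn_pos (μ := μ) r w).ne'
  have h1 : DifferentiableAt ℝ (tiltMoment μ r P) w :=
    (hasFDerivAt_tiltMoment (hP.tiltIntegrable hr) w).differentiableAt
  have h2 : DifferentiableAt ℝ (partitionFn μ r) w :=
    (contDiff_partitionFn hr).differentiable (by simp) w
  have h3 : postMean μ r P * partitionFn μ r = tiltMoment μ r P := by
    ext v
    simp only [Pi.mul_apply]
    rw [postMean_eq, div_mul_cancel₀ _ (partitionFn_pos (μ := μ) r v).ne']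
  have h4 : DifferentiableAt ℝ (postMean μ r P) w :=
    (contDiff_postMean hr hP).differentiable (by simp) w
  have h5 := congrArg (fun f => fderiv ℝ f w v) h3
  rw [fderiv_mul h4 h2, fderiv_tiltMoment_apply hr hP] at h5
  simp only [_root_.add_apply, _root_.smul_apply, smul_eq_mul] at h5
  rw [fderiv_partitionFn_apply hr] at h5
  rw [postMean_eq μ r (fun x => P x * inner ℝ x v)]
  field_simp
  linear_combination h5

lemma fderiv_log_partitionFn_apply (hr : 0 < r) (w v : E) :
    fderiv ℝ (fun w => Real.log (partitionFn μ r w)) w v =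
      r * postMean μ r (fun x => inner ℝ x v) w := by
  have hZ := (partitionFn_pos (μ := μ) r w).ne'
  rw [fderiv.log ((contDiff_partitionFn hr).differentiable (by simp) w) hZ]
  simp only [_root_.smul_apply, smul_eq_mul]
  rw [fderiv_partitionFn_apply hr]
  field_simp

/-- Bayes' rule in disguise: Cameron-Martin in each fibre gives the joint law of input and output a
density against a product measure. Integrating first over the input then exhibits the tilted law as
the conditional law of the input. -/
lemma map_shear_prod_stdGaussian (μ : Measure E) [IsProbabilityMeasure μ] (r : ℝ) :
    (μ.prod (stdGaussian E)).map (fun p => (p.1, r • p.1 + p.2)) =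
      (μ.prod (stdGaussian E)).withDensity
        fun p => ENNReal.ofReal (Real.exp (tiltExponent r p.2 p.1)) := by
  refine Measure.ext_of_lintegral _ fun G hG => ?_
  have hm : Measurable fun p : E × E => ENNReal.ofReal (Real.exp (tiltExponent r p.2 p.1)) := by
    have : Continuous fun p : E × E => tiltExponent r p.2 p.1 := by fun_prop
    fun_prop
  rw [lintegral_map hG (by fun_prop), lintegral_withDensity_eq_lintegral_mul _ hm hG,
    lintegral_prod (fun p : E × E => G (p.1, r • p.1 + p.2))
      (hG.comp (by fun_prop)).aemeasurable, lintegral_prod _ (hm.mul hG).aemeasurable]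
  refine lintegral_congr fun x => ?_
  rw [lintegral_const_add_stdGaussian (r • x) (F := fun w => G (x, w)) (by fun_prop)]
  refine lintegral_congr fun w => ?_
  simp [tiltExponent, real_inner_smul_right, norm_smul, mul_pow]

lemma integrable_shear_iff {G : E × E → ℝ} (hG : Measurable G) :
    Integrable (fun p : E × E => G (p.1, r • p.1 + p.2)) (μ.prod (stdGaussian E)) ↔
      Integrable (fun p : E × E => Real.exp (tiltExponent r p.2 p.1) * G p)
        (μ.prod (stdGaussian E)) := by
  have hc : Continuous fun p : E × E => tiltExponent r p.2 p.1 := by fun_prop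
  rw [← Function.comp_def G, ← integrable_map_measure hG.aestronglyMeasurable (by fun_prop),
    map_shear_prod_stdGaussian, integrable_withDensity_iff_integrable_smul' (by fun_prop)
      (by filter_upwards with w using ENNReal.ofReal_lt_top)]
  simp_rw [ENNReal.toReal_ofReal (Real.exp_pos _).le, smul_eq_mul]

lemma integral_shear {G : E × E → ℝ} (hG : Measurable G) :
    ∫ p : E × E, G (p.1, r • p.1 + p.2) ∂(μ.prod (stdGaussian E)) =
      ∫ p : E × E, Real.exp (tiltExponent r p.2 p.1) * G p ∂(μ.prod (stdGaussian E)) := by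
  have hc : Continuous fun p : E × E => tiltExponent r p.2 p.1 := by fun_prop
  rw [← integral_map (φ := fun p : E × E => (p.1, r • p.1 + p.2)) (by fun_prop)
    hG.aestronglyMeasurable,
    map_shear_prod_stdGaussian, integral_withDensity_eq_integral_toReal_smul (by fun_prop)
      (by filter_upwards with w using ENNReal.ofReal_lt_top)]
  simp_rw [ENNReal.toReal_ofReal (Real.exp_pos _).le, smul_eq_mul]

lemma integral_mul_eq_integral_tiltMoment {F : E → ℝ} (hF : Measurable F) (hP : Measurable P)
    (hi : Integrable (fun p : E × E => F (r • p.1 + p.2) * P p.1) (μ.prod (stdGaussian E))) :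
    ∫ p : E × E, F (r • p.1 + p.2) * P p.1 ∂(μ.prod (stdGaussian E)) =
      ∫ w, F w * tiltMoment μ r P w ∂(stdGaussian E) := by
  have hG : Measurable fun p : E × E => F p.2 * P p.1 := by fun_prop
  rw [integral_shear (G := fun p => F p.2 * P p.1) hG, integral_prod_symm]
  · refine integral_congr_ae (.of_forall fun w => ?_)
    simp only [tiltMoment]
    rw [← integral_const_mul]
    refine integral_congr_ae (.of_forall fun x => ?_)
    simp only [smul_eq_mul]
    ring
  · exact (integrable_shear_iff (G := fun p => F p.2 * P p.1) hG).1 hi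

lemma integral_comp_eq_integral_partitionFn {F : E → ℝ} (hF : Measurable F)
    (hi : Integrable (fun p : E × E => F (r • p.1 + p.2)) (μ.prod (stdGaussian E))) :
    ∫ p : E × E, F (r • p.1 + p.2) ∂(μ.prod (stdGaussian E)) =
      ∫ w, F w * partitionFn μ r w ∂(stdGaussian E) := by
  have := integral_mul_eq_integral_tiltMoment (μ := μ) (r := r) (P := fun _ => 1) hF
    measurable_const (by simpa using hi)
  simpa [partitionFn_eq] using this

/-- The tower property for the posterior mean. -/
lemma integral_mul_postMean {F : E → ℝ} (hF : Measurable F) (hP : Measurable P)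
    (hPi : Integrable P μ)
    (hi : Integrable (fun p : E × E => F (r • p.1 + p.2) * P p.1) (μ.prod (stdGaussian E)))
    (hi' : Integrable (fun p : E × E => F (r • p.1 + p.2) * postMean μ r P (r • p.1 + p.2))
      (μ.prod (stdGaussian E))) :
    ∫ p : E × E, F (r • p.1 + p.2) * P p.1 ∂(μ.prod (stdGaussian E)) =
      ∫ p : E × E, F (r • p.1 + p.2) * postMean μ r P (r • p.1 + p.2)
        ∂(μ.prod (stdGaussian E)) := by
  have hm : Measurable (postMean μ r P) :=
    ((continuous_postMean hPi).comp (Continuous.prodMk_right r)).measurable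
  rw [integral_mul_eq_integral_tiltMoment hF hP hi,
    integral_comp_eq_integral_partitionFn (F := fun w => F w * postMean μ r P w) (hF.mul hm) hi']
  refine integral_congr_ae (.of_forall fun w => ?_)
  simp only
  rw [postMean_eq, mul_assoc, div_mul_cancel₀ _ (partitionFn_pos r w).ne']

lemma integrable_inner (h2 : Integrable (fun x => ‖x‖ ^ 2) μ) (v : E) :
    Integrable (fun x => inner ℝ x v) μ := by
  refine ((integrable_const 1).add h2).const_mul ‖v‖ |>.mono'
    (Continuous.aestronglyMeasurable (by fun_prop)) (.of_forall fun x => ?_)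
  refine (norm_inner_le_norm x v).trans ?_
  simp only [Pi.add_apply]
  nlinarith [norm_nonneg v, sq_nonneg (‖x‖ - 1), sq_nonneg ‖x‖, mul_nonneg (norm_nonneg v) (sq_nonneg (‖x‖ - 1)),
    mul_nonneg (norm_nonneg v) (sq_nonneg ‖x‖)]

lemma integrable_inner_mul_inner (h2 : Integrable (fun x => ‖x‖ ^ 2) μ) (u v : E) :
    Integrable (fun x => inner ℝ x u * inner ℝ x v) μ := by
  refine (h2.const_mul (‖u‖ * ‖v‖)).mono'
    (Continuous.aestronglyMeasurable (by fun_prop)) (.of_forall fun x => ?_)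
  rw [norm_mul]
  calc _ ≤ (‖x‖ * ‖u‖) * (‖x‖ * ‖v‖) := by
        gcongr <;> exact norm_inner_le_norm _ _
    _ = _ := by ring

lemma integral_norm_sub_sq (h2 : Integrable (fun x => ‖x‖ ^ 2) μ)
    (h0 : ∀ v, ∫ x, inner ℝ x v ∂μ = 0) (r : ℝ) (w : E) :
    ∫ x, ‖w - r • x‖ ^ 2 ∂μ = ‖w‖ ^ 2 + r ^ 2 * ∫ x, ‖x‖ ^ 2 ∂μ := by
  have : ∀ x, ‖w - r • x‖ ^ 2 = ‖w‖ ^ 2 + (r ^ 2 * ‖x‖ ^ 2 + (-2 * r) * inner ℝ x w) := by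
    intro x
    rw [norm_sub_sq_real, real_inner_smul_right, norm_smul, mul_pow, Real.norm_eq_abs, sq_abs,
      real_inner_comm]
    ring
  simp_rw [this]
  have i1 : Integrable (fun x => r ^ 2 * ‖x‖ ^ 2) μ := h2.const_mul _
  have i2 : Integrable (fun x => (-2 * r) * inner ℝ x w) μ := (integrable_inner h2 w).const_mul _
  have i3 : Integrable (fun x => r ^ 2 * ‖x‖ ^ 2 + (-2 * r) * inner ℝ x w) μ := i1.add i2
  rw [integral_add (integrable_const _) i3, integral_add i1 i2, integral_const_mul,
    integral_const_mul, h0]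
  simp

lemma integrable_norm_sub_sq (h2 : Integrable (fun x => ‖x‖ ^ 2) μ) (hr : 0 < r) (w : E) :
    Integrable (fun x => ‖w - r • x‖ ^ 2) μ := by
  refine ((integrable_const (2 * ‖w‖ ^ 2)).add (h2.const_mul (2 * r ^ 2))).mono'
    (Continuous.aestronglyMeasurable (by fun_prop)) (.of_forall fun x => ?_)
  rw [Real.norm_of_nonneg (by positivity)]
  have := norm_sub_le w (r • x)
  rw [norm_smul, Real.norm_of_nonneg hr.le] at this
  simp only [Pi.add_apply]
  calc ‖w - r • x‖ ^ 2 ≤ (‖w‖ + r * ‖x‖) ^ 2 := pow_le_pow_left₀ (norm_nonneg _) this 2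
    _ ≤ _ := by nlinarith [sq_nonneg (‖w‖ - r * ‖x‖)]

/-- The posterior weight is a decreasing function of `h`, hence negatively correlated with it, so
conditioning lowers the mean of `h`. -/
lemma postMean_le_of_exp_tiltExponent {h : E → ℝ} (ih : Integrable h μ) {w : E}
    (hh : ∀ x, tiltExponent r w x = ‖w‖ ^ 2 / 2 - h x / 2) :
    postMean μ r h w ≤ ∫ x, h x ∂μ := by
  set H := ∫ x, h x ∂μ with hHi
  rw [postMean_eq, div_le_iff₀ (partitionFn_pos r w)]
  -- The weight may be replaced by its value where h = H: the error has the favourable sign on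
  -- either side of the mean.
  have h1 : ∀ x, Real.exp (tiltExponent r w x) * (h x - H) ≤
      Real.exp (‖w‖ ^ 2 / 2 - H / 2) * (h x - H) := by
    intro x
    rw [hh]
    rcases le_total (h x) H with h | h
    · exact mul_le_mul_of_nonpos_right (Real.exp_le_exp.2 (by linarith)) (by linarith)
    · exact mul_le_mul_of_nonneg_right (Real.exp_le_exp.2 (by linarith)) (by linarith)
  have h3 := integral_mono (μ := μ)
    ((ih.sub (integrable_const H)).exp_tiltExponent_mul r w)
    ((ih.sub (integrable_const H)).const_mul _) h1
  rw [integral_const_mul] at h3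
  simp only [Pi.sub_apply] at h3
  rw [integral_sub ih (integrable_const _), ← hHi] at h3
  simp only [mul_sub] at h3
  rw [integral_sub (ih.exp_tiltExponent_mul r w) ((integrable_const H).exp_tiltExponent_mul r w),
    integral_mul_const] at h3
  simp only [integral_const, probReal_univ, one_smul, sub_self] at h3
  simp only [tiltMoment, smul_eq_mul, partitionFn]
  linarith

lemma norm_sq_le_of_norm_sub (hr : 0 < r) (w x : E) :
    ‖x‖ ^ 2 ≤ 2 * ‖w‖ ^ 2 / r ^ 2 + 2 / r ^ 2 * ‖w - r • x‖ ^ 2 := by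
  have := norm_sub_norm_le (r • x) w
  rw [norm_smul, Real.norm_of_nonneg hr.le, norm_sub_rev] at this
  have h4 : r ^ 2 * ‖x‖ ^ 2 ≤ 2 * ‖w‖ ^ 2 + 2 * ‖w - r • x‖ ^ 2 := by
    rw [← mul_pow]
    calc (r * ‖x‖) ^ 2 ≤ (‖w - r • x‖ + ‖w‖) ^ 2 :=
          pow_le_pow_left₀ (by positivity) (by linarith) 2
      _ ≤ _ := by nlinarith [sq_nonneg (‖w‖ - ‖w - r • x‖)]
  rw [div_mul_eq_mul_div, ← add_div, le_div_iff₀ (by positivity)]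
  linarith

/-- Apply the correlation inequality to ‖w - r x‖², the quantity that the likelihood penalises. The
outcome, at most quadratic growth in `w`, makes posterior means square integrable along the channel.
-/
lemma postMean_norm_sq_le (hr : 0 < r) (h2 : Integrable (fun x => ‖x‖ ^ 2) μ)
    (h0 : ∀ v, ∫ x, inner ℝ x v ∂μ = 0) (w : E) :
    postMean μ r (fun x => ‖x‖ ^ 2) w ≤
      4 * ‖w‖ ^ 2 / r ^ 2 + 2 * ∫ x, ‖x‖ ^ 2 ∂μ := by
  have ih := integrable_norm_sub_sq h2 hr w
  have key := postMean_le_of_exp_tiltExponent ih (tiltExponent_eq r w)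
  rw [integral_norm_sub_sq h2 h0] at key
  have i1 : Integrable (fun x => 2 / r ^ 2 * ‖w - r • x‖ ^ 2) (μ.tilted (tiltExponent r w)) :=
    (ih.posterior r w).const_mul _
  have h5 : postMean μ r (fun x => ‖x‖ ^ 2) w ≤
      ∫ x, (2 * ‖w‖ ^ 2 / r ^ 2 + 2 / r ^ 2 * ‖w - r • x‖ ^ 2) ∂(μ.tilted (tiltExponent r w)) :=
    integral_mono (h2.posterior r w) ((integrable_const _).add i1) (norm_sq_le_of_norm_sub hr w)
  rw [integral_add (integrable_const _) i1, integral_const_mul] at h5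
  simp only [integral_const, probReal_univ, one_smul] at h5
  change _ ≤ _ + 2 / r ^ 2 * postMean μ r (fun x => ‖w - r • x‖ ^ 2) w at h5
  refine h5.trans ?_
  calc _ ≤ 2 * ‖w‖ ^ 2 / r ^ 2 + 2 / r ^ 2 * (‖w‖ ^ 2 + r ^ 2 * ∫ x, ‖x‖ ^ 2 ∂μ) := by gcongr
    _ = _ := by
        field_simp
        ring

/-- The posterior covariance is nonnegative. -/
lemma postMean_sq_le {P : E → ℝ} (hP : Integrable P μ) (hP2 : Integrable (fun x => P x ^ 2) μ)
    (r : ℝ) (w : E) : postMean μ r P w ^ 2 ≤ postMean μ r (fun x => P x ^ 2) w := by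
  have h1 := hP.posterior r w
  have h2 := hP2.posterior r w
  set m := postMean μ r P w with hm
  have h : 0 ≤ ∫ x, (P x - m) ^ 2 ∂(μ.tilted (tiltExponent r w)) :=
    integral_nonneg fun x => sq_nonneg _
  have h3 : ∀ x, (P x - m) ^ 2 = P x ^ 2 + ((-2 * m) * P x + m ^ 2) := fun x => by ring
  simp_rw [h3] at h
  have i1 : Integrable (fun x => (-2 * m) * P x) (μ.tilted (tiltExponent r w)) := h1.const_mul _
  have i2 : Integrable (fun x => (-2 * m) * P x + m ^ 2) (μ.tilted (tiltExponent r w)) :=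
    i1.add (integrable_const _)
  rw [integral_add h2 i2, integral_add i1 (integrable_const _), integral_const_mul] at h
  simp only [integral_const, probReal_univ, one_smul] at h
  change 0 ≤ postMean μ r (fun x => P x ^ 2) w + (-2 * m * postMean μ r P w + m ^ 2) at h
  rw [← hm] at h
  linarith

end Posterior

/-! ### The Prékopa-Leindler inequality. -/

section PrekopaLeindler

open scoped Pointwise

/-- The one-dimensional Brunn-Minkowski inequality. -/
lemma Real.volume_add_le_of_add_mem {A B C : Set ℝ} (hA : MeasurableSet A) (hB : MeasurableSet B)
    (hA0 : A.Nonempty) (hB0 : B.Nonempty) (h : ∀ x ∈ A, ∀ y ∈ B, x + y ∈ C) :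
    volume A + volume B ≤ volume C := by
  rcases eq_or_ne (volume C) ⊤ with hC | hC
  · rw [hC]; exact le_top
  obtain ⟨a, ha⟩ := hA0
  obtain ⟨b, hb⟩ := hB0
  have hBC : volume B ≤ volume C := by
    rw [← measure_vadd volume a B]
    refine measure_mono ?_
    rintro _ ⟨y, hy, rfl⟩
    exact h a ha y hy
  have hAC : volume A ≤ volume C := by
    rw [← measure_vadd volume b A]
    refine measure_mono ?_
    rintro _ ⟨x, hx, rfl⟩
    have := h x hx b hb
    rwa [add_comm] at this
  refine ENNReal.le_of_forall_pos_le_add fun ε hε _ => ?_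
  have hε2 : (ε / 2 : ℝ≥0∞) ≠ 0 := by simp [hε.ne']
  obtain ⟨K, hKA, hK, hKv⟩ := hA.exists_isCompact_lt_add (hAC.trans_lt hC.lt_top).ne hε2
  obtain ⟨L, hLB, hL, hLv⟩ := hB.exists_isCompact_lt_add (hBC.trans_lt hC.lt_top).ne hε2
  -- The points `a` and `b` are added only so that extreme points exist even if the compact
  -- approximations are empty.
  have hK' : IsCompact (insert a K) := hK.insert a
  have hL' : IsCompact (insert b L) := hL.insert b
  obtain ⟨k, hkK, hk⟩ := hK'.exists_isGreatest (Set.insert_nonempty a K)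
  obtain ⟨l, hlL, hl⟩ := hL'.exists_isLeast (Set.insert_nonempty b L)
  have hKA' : insert a K ⊆ A := Set.insert_subset ha hKA
  have hLB' : insert b L ⊆ B := Set.insert_subset hb hLB
  -- Translate K by the least point of L and L by the greatest point of K: the translates lie on
  -- opposite sides of k + l and can meet only there.
  have hsub : (l +ᵥ K) ∪ (k +ᵥ L) ⊆ C := by
    rintro _ (⟨x, hx, rfl⟩ | ⟨y, hy, rfl⟩)
    · have := h x (hKA hx) l (hLB' hlL)
      rwa [add_comm] at this
    · exact h k (hKA' hkK) y (hLB hy)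
  have hdisj : AEDisjoint volume (l +ᵥ K) (k +ᵥ L) := by
    refine measure_mono_null ?_ (Real.volume_singleton (a := k + l))
    rintro _ ⟨⟨x, hx, rfl⟩, ⟨y, hy, hxy⟩⟩
    have h1 : x ≤ k := hk (Set.mem_insert_of_mem a hx)
    have h2 : l ≤ y := hl (Set.mem_insert_of_mem b hy)
    simp only [vadd_eq_add] at hxy ⊢
    rw [Set.mem_singleton_iff]
    linarith
  have hU : volume K + volume L ≤ volume C := by
    rw [← measure_vadd volume l K, ← measure_vadd volume k L,
      ← measure_union₀ (hL.measurableSet.const_vadd k).nullMeasurableSet hdisj]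
    exact measure_mono hsub
  calc volume A + volume B ≤ (volume K + ε / 2) + (volume L + ε / 2) := by gcongr
    _ = volume K + volume L + (ε / 2 + ε / 2) := by ring
    _ ≤ volume C + ε := by rw [ENNReal.add_halves]; gcongr

/-- When both suprema equal 1, the superlevel sets at each level below 1 are nonempty, and the
weighted sum of those of `f` and `g` lies in that of `h`. One-dimensional Brunn-Minkowski,
integrated over levels, gives even the arithmetic mean of the integrals. -/
lemma Real.prekopaLeindler_of_le_one {f g h : ℝ → ℝ} (hf : Measurable f) (hg : Measurable g)
    (hh : Measurable h) (f0 : ∀ x, 0 ≤ f x) (g0 : ∀ x, 0 ≤ g x) (h0 : ∀ x, 0 ≤ h x)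
    (f1 : ∀ x, f x ≤ 1) (g1 : ∀ x, g x ≤ 1) (fs : ∀ t < 1, ∃ x, t < f x) (gs : ∀ t < 1, ∃ x, t < g x)
    {a b : ℝ} (ha : 0 < a) (hb : 0 < b) (hab : a + b = 1)
    (hfg : ∀ x y, f x ^ a * g y ^ b ≤ h (a • x + b • y)) :
    ENNReal.ofReal a * (∫⁻ x, ENNReal.ofReal (f x)) +
        ENNReal.ofReal b * (∫⁻ x, ENNReal.ofReal (g x)) ≤
      ∫⁻ x, ENNReal.ofReal (h x) := by
  rw [lintegral_eq_lintegral_meas_lt volume (.of_forall f0) hf.aemeasurable,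
    lintegral_eq_lintegral_meas_lt volume (.of_forall g0) hg.aemeasurable,
    lintegral_eq_lintegral_meas_lt volume (.of_forall h0) hh.aemeasurable,
    ← lintegral_const_mul' _ _ ENNReal.ofReal_ne_top,
    ← lintegral_const_mul' _ _ ENNReal.ofReal_ne_top]
  rw [← lintegral_add_left' ]
  · refine setLIntegral_mono_ae' measurableSet_Ioi (.of_forall fun t ht => ?_)
    rw [Set.mem_Ioi] at ht
    rcases lt_or_ge t 1 with h1 | h1
    · have e : ∀ (c : ℝ) (hc : 0 < c) (s : Set ℝ), ENNReal.ofReal c * volume s = volume (c • s) := by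
        intro c hc s
        rw [Measure.addHaar_smul]
        simp [abs_of_pos hc]
      rw [e a ha, e b hb]
      refine Real.volume_add_le_of_add_mem ((measurableSet_lt measurable_const hf).const_smul₀ a)
        ((measurableSet_lt measurable_const hg).const_smul₀ b)
        (Set.Nonempty.smul_set (fs t h1)) (Set.Nonempty.smul_set (gs t h1)) ?_
      rintro _ ⟨x, hx, rfl⟩ _ ⟨y, hy, rfl⟩
      refine lt_of_lt_of_le ?_ (hfg x y)
      calc t = t ^ a * t ^ b := by rw [← Real.rpow_add ht, hab, Real.rpow_one]
        _ < f x ^ a * g y ^ b := by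
          have h2 := Real.rpow_lt_rpow ht.le (show t < f x from hx) ha
          have h3 := Real.rpow_lt_rpow ht.le (show t < g y from hy) hb
          exact mul_lt_mul'' h2 h3 (by positivity) (by positivity)
    · have e1 : {x | t < f x} = ∅ := Set.eq_empty_of_forall_notMem fun x hx =>
        absurd (lt_of_lt_of_le hx (f1 x)) (not_lt.2 h1)
      have e2 : {x | t < g x} = ∅ := Set.eq_empty_of_forall_notMem fun x hx =>
        absurd (lt_of_lt_of_le hx (g1 x)) (not_lt.2 h1)
      simp [e1, e2]
  · have : Antitone fun t => volume {x | t < f x} := fun s t hst =>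
      measure_mono fun x hx => lt_of_le_of_lt hst hx
    exact (this.measurable.const_mul _).aemeasurable

lemma ENNReal.geom_mean_le_arith_mean2 {a b : ℝ} (ha : 0 < a) (hb : 0 < b) (hab : a + b = 1)
    (u v : ℝ≥0∞) : u ^ a * v ^ b ≤ ENNReal.ofReal a * u + ENNReal.ofReal b * v := by
  rcases eq_or_ne u ⊤ with rfl | hu
  · rw [ENNReal.mul_top (by simpa using ha)]; simp
  rcases eq_or_ne v ⊤ with rfl | hv
  · rw [ENNReal.mul_top (by simpa using hb)]; simp
  lift u to NNReal using hu
  lift v to NNReal using hv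
  have := NNReal.geom_mean_le_arith_mean2_weighted a.toNNReal b.toNNReal u v
    (by rw [← Real.toNNReal_add ha.le hb.le, hab, Real.toNNReal_one])
  rw [Real.coe_toNNReal _ ha.le, Real.coe_toNNReal _ hb.le] at this
  rw [← ENNReal.coe_rpow_of_nonneg _ ha.le, ← ENNReal.coe_rpow_of_nonneg _ hb.le]
  simp only [ENNReal.ofReal]
  exact_mod_cast this

/-- The Prékopa-Leindler inequality for the measure `μ`. -/
def PrekopaLeindler {V : Type*} [AddCommMonoid V] [SMul ℝ V] [MeasurableSpace V]
    (μ : Measure V) : Prop :=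
  ∀ (f g h : V → ℝ≥0∞), Measurable f → Measurable g → Measurable h →
    ∀ a b : ℝ, 0 < a → 0 < b → a + b = 1 → (∀ x y, f x ^ a * g y ^ b ≤ h (a • x + b • y)) →
      (∫⁻ x, f x ∂μ) ^ a * (∫⁻ x, g x ∂μ) ^ b ≤ ∫⁻ x, h x ∂μ

/-- The inequality is homogeneous, so `f` and `g` may be divided by their suprema; the inequality of
means then turns the arithmetic mean into the geometric one. Truncating the third function at 1
keeps it finite without harming the hypothesis. -/
lemma Real.prekopaLeindler_of_bounded {f g h : ℝ → ℝ≥0∞} (hf : Measurable f) (hg : Measurable g)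
    (hh : Measurable h) {a b : ℝ} (ha : 0 < a) (hb : 0 < b) (hab : a + b = 1)
    (hfg : ∀ x y, f x ^ a * g y ^ b ≤ h (a • x + b • y)) {M : ℝ≥0∞} (hM : M ≠ ⊤)
    (fM : ∀ x, f x ≤ M) (gM : ∀ x, g x ≤ M) :
    (∫⁻ x, f x) ^ a * (∫⁻ x, g x) ^ b ≤ ∫⁻ x, h x := by
  set s := ⨆ x, f x with hs
  set s' := ⨆ x, g x with hs'
  have hst : s ≠ ⊤ := ((iSup_le fM).trans_lt hM.lt_top).ne
  have hst' : s' ≠ ⊤ := ((iSup_le gM).trans_lt hM.lt_top).ne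
  rcases eq_or_ne s 0 with h0 | h0
  · have : ∀ x, f x = 0 := fun x => le_antisymm ((le_iSup f x).trans h0.le) bot_le
    simp [this, ENNReal.zero_rpow_of_pos ha]
  rcases eq_or_ne s' 0 with h0' | h0'
  · have : ∀ x, g x = 0 := fun x => le_antisymm ((le_iSup g x).trans h0'.le) bot_le
    simp [this, ENNReal.zero_rpow_of_pos hb]
  set c := s ^ a * s' ^ b with hc
  have hc0 : c ≠ 0 := by simp [hc, h0, h0', ha.not_gt, hb.not_gt, hst, hst']
  have hct : c ≠ ⊤ := ENNReal.mul_ne_top (ENNReal.rpow_ne_top_of_nonneg ha.le hst)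
    (ENNReal.rpow_ne_top_of_nonneg hb.le hst')
  set F : ℝ → ℝ≥0∞ := fun x => f x / s with hF
  set G : ℝ → ℝ≥0∞ := fun x => g x / s' with hG
  set H : ℝ → ℝ≥0∞ := fun x => min (h x / c) 1 with hH
  have F1 : ∀ x, F x ≤ 1 := fun x => ENNReal.div_le_of_le_mul (by rw [one_mul]; exact le_iSup f x)
  have G1 : ∀ x, G x ≤ 1 := fun x => ENNReal.div_le_of_le_mul (by rw [one_mul]; exact le_iSup g x)
  have H1 : ∀ x, H x ≤ 1 := fun x => min_le_right _ _
  have sup : ∀ (f : ℝ → ℝ≥0∞) (s : ℝ≥0∞), s = ⨆ x, f x → s ≠ 0 → s ≠ ⊤ → (∀ x, f x / s ≤ 1) →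
      ∀ t < (1 : ℝ), ∃ x, t < (f x / s).toReal := by
    intro f s hs h0 ht f1 t ht1
    by_contra! hcon
    have h2 : ∀ x, f x ≤ ENNReal.ofReal t * s := by
      intro x
      rw [← ENNReal.div_le_iff h0 ht]
      exact ENNReal.le_ofReal_iff_toReal_le ((f1 x).trans_lt ENNReal.one_lt_top).ne
        (ENNReal.toReal_nonneg.trans (hcon x)) |>.2 (hcon x)
    have h3 : s ≤ ENNReal.ofReal t * s := by
      conv_lhs => rw [hs]
      exact iSup_le h2
    have h4 : ENNReal.ofReal t * s < 1 * s := by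
      refine ENNReal.mul_lt_mul_left h0 ht ?_
      rw [← ENNReal.ofReal_one]
      exact ENNReal.ofReal_lt_ofReal_iff one_pos |>.2 ht1
    rw [one_mul] at h4
    exact absurd h3 (not_le.2 h4)
  have hFt : ∀ x, F x ≠ ⊤ := fun x => ((F1 x).trans_lt ENNReal.one_lt_top).ne
  have hGt : ∀ x, G x ≠ ⊤ := fun x => ((G1 x).trans_lt ENNReal.one_lt_top).ne
  have hHt : ∀ x, H x ≠ ⊤ := fun x => ((H1 x).trans_lt ENNReal.one_lt_top).ne
  have key := Real.prekopaLeindler_of_le_one (f := fun x => (F x).toReal)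
    (g := fun x => (G x).toReal) (h := fun x => (H x).toReal)
    (hf.div_const s).ennreal_toReal (hg.div_const s').ennreal_toReal
    ((hh.div_const c).min measurable_const).ennreal_toReal
    (fun _ => ENNReal.toReal_nonneg) (fun _ => ENNReal.toReal_nonneg)
    (fun _ => ENNReal.toReal_nonneg)
    (fun x => ENNReal.toReal_le_of_le_ofReal one_pos.le (by simpa using F1 x))
    (fun x => ENNReal.toReal_le_of_le_ofReal one_pos.le (by simpa using G1 x))
    (sup f s hs h0 hst F1) (sup g s' hs' h0' hst' G1) ha hb hab (by
      intro x y
      rw [ENNReal.toReal_rpow, ENNReal.toReal_rpow, ← ENNReal.toReal_mul]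
      refine ENNReal.toReal_mono (hHt _) (le_min ?_ ?_)
      · rw [ENNReal.le_div_iff_mul_le (.inl hc0) (.inl hct)]
        calc F x ^ a * G y ^ b * c = (F x * s) ^ a * (G y * s') ^ b := by
              rw [ENNReal.mul_rpow_of_nonneg _ _ ha.le, ENNReal.mul_rpow_of_nonneg _ _ hb.le, hc]
              ring
          _ = f x ^ a * g y ^ b := by
              rw [hF, hG, ENNReal.div_mul_cancel h0 hst, ENNReal.div_mul_cancel h0' hst']
          _ ≤ _ := hfg x y
      · exact mul_le_one' (ENNReal.rpow_le_one (F1 x) ha.le) (ENNReal.rpow_le_one (G1 y) hb.le))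
  simp only [ENNReal.ofReal_toReal (hFt _), ENNReal.ofReal_toReal (hGt _),
    ENNReal.ofReal_toReal (hHt _)] at key
  have key2 := (ENNReal.geom_mean_le_arith_mean2 ha hb hab _ _).trans key
  have eF : ∫⁻ x, f x = (∫⁻ x, F x) * s := by
    rw [← lintegral_mul_const' _ _ hst]
    exact lintegral_congr fun x => (ENNReal.div_mul_cancel h0 hst).symm
  have eG : ∫⁻ x, g x = (∫⁻ x, G x) * s' := by
    rw [← lintegral_mul_const' _ _ hst']
    exact lintegral_congr fun x => (ENNReal.div_mul_cancel h0' hst').symm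
  calc (∫⁻ x, f x) ^ a * (∫⁻ x, g x) ^ b = ((∫⁻ x, F x) ^ a * (∫⁻ x, G x) ^ b) * c := by
        rw [eF, eG, ENNReal.mul_rpow_of_nonneg _ _ ha.le, ENNReal.mul_rpow_of_nonneg _ _ hb.le, hc]
        ring
    _ ≤ (∫⁻ x, H x) * c := by gcongr
    _ = ∫⁻ x, H x * c := (lintegral_mul_const' _ _ hct).symm
    _ ≤ ∫⁻ x, h x := lintegral_mono fun x => by
        calc H x * c ≤ h x / c * c := by gcongr; exact min_le_left _ _
          _ = h x := ENNReal.div_mul_cancel hc0 hct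

lemma lintegral_eq_iSup_lintegral_min {f : ℝ → ℝ≥0∞} (hf : Measurable f) :
    Filter.Tendsto (fun n : ℕ => ∫⁻ x, min (f x) n) Filter.atTop (nhds (∫⁻ x, f x)) := by
  refine lintegral_tendsto_of_tendsto_of_monotone (fun n => (hf.min measurable_const).aemeasurable)
    (.of_forall fun x m n hmn => min_le_min_left _ (by exact_mod_cast hmn)) (.of_forall fun x => ?_)
  have := (tendsto_const_nhds (x := f x)).min ENNReal.tendsto_nat_nhds_top
  simpa using this

lemma Real.prekopaLeindler : PrekopaLeindler (volume : Measure ℝ) := by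
  intro f g h hf hg hh a b ha hb hab hfg
  -- With vanishing integrals removed, the product of the truncated integrals converges even if a
  -- factor is infinite: no 0 · ∞ occurs.
  rcases eq_or_ne (∫⁻ x, f x) 0 with h0 | h0
  · simp [h0, ENNReal.zero_rpow_of_pos ha]
  rcases eq_or_ne (∫⁻ x, g x) 0 with h0' | h0'
  · simp [h0', ENNReal.zero_rpow_of_pos hb]
  have hF := ((ENNReal.continuous_rpow_const (y := a)).tendsto _).comp
    (lintegral_eq_iSup_lintegral_min hf)
  have hG := ((ENNReal.continuous_rpow_const (y := b)).tendsto _).comp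
    (lintegral_eq_iSup_lintegral_min hg)
  refine le_of_tendsto (ENNReal.Tendsto.mul hF (.inl ?_) hG (.inl ?_)) (.of_forall fun n => ?_)
  · simp [h0, ha.le]
  · simp [h0', hb.le]
  · refine Real.prekopaLeindler_of_bounded (hf.min measurable_const) (hg.min measurable_const) hh ha
      hb hab (fun x y => ?_) (ENNReal.natCast_ne_top n) (fun x => min_le_right _ _)
      (fun x => min_le_right _ _)
    refine le_trans ?_ (hfg x y)
    gcongr <;> exact min_le_left _ _

/-- Tensorisation: the inequality in the fibres is exactly the hypothesis for the fibre integrals on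
the base. -/
lemma PrekopaLeindler.prod {V W : Type*} [AddCommMonoid V] [SMul ℝ V] [MeasurableSpace V]
    [AddCommMonoid W] [SMul ℝ W] [MeasurableSpace W] {μ : Measure V} {ν : Measure W} [SFinite ν]
    (hμ : PrekopaLeindler μ) (hν : PrekopaLeindler ν) : PrekopaLeindler (μ.prod ν) := by
  intro f g h hf hg hh a b ha hb hab hfg
  rw [lintegral_prod _ hf.aemeasurable, lintegral_prod _ hg.aemeasurable,
    lintegral_prod _ hh.aemeasurable]
  refine hμ _ _ _ hf.lintegral_prod_right' hg.lintegral_prod_right' hh.lintegral_prod_right' a b ha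
    hb hab fun x x' => ?_
  exact hν _ _ _ (hf.comp measurable_prodMk_left) (hg.comp measurable_prodMk_left)
    (hh.comp measurable_prodMk_left) a b ha hb hab fun y y' => hfg (x, y) (x', y')

lemma PrekopaLeindler.of_measurePreserving {V W : Type*} [AddCommMonoid V] [SMul ℝ V]
    [MeasurableSpace V] [AddCommMonoid W] [SMul ℝ W] [MeasurableSpace W] {μ : Measure V}
    {ν : Measure W} (hμ : PrekopaLeindler μ) (e : V ≃ᵐ W) (he : MeasurePreserving e μ ν)
    (hlin : ∀ (a b : ℝ) x y, e (a • x + b • y) = a • e x + b • e y) : PrekopaLeindler ν := by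
  intro f g h hf hg hh a b ha hb hab hfg
  rw [← he.lintegral_comp hf, ← he.lintegral_comp hg, ← he.lintegral_comp hh]
  refine hμ _ _ _ (hf.comp e.measurable) (hg.comp e.measurable) (hh.comp e.measurable) a b ha hb hab
    fun x y => ?_
  simp only [Function.comp_apply, hlin]
  exact hfg _ _

lemma prekopaLeindler_pi (n : ℕ) : PrekopaLeindler (volume : Measure (Fin n → ℝ)) := by
  induction n with
  | zero =>
    intro f g h hf hg hh a b ha hb hab hfg
    rw [Measure.volume_pi_eq_dirac 0, lintegral_dirac' _ hf, lintegral_dirac' _ hg,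
      lintegral_dirac' _ hh]
    simpa using hfg 0 0
  | succ n ih =>
    refine (Real.prekopaLeindler.prod ih).of_measurePreserving
      (MeasurableEquiv.piFinSuccAbove (fun _ => ℝ) 0).symm
      (volume_preserving_piFinSuccAbove (fun _ => ℝ) 0).symm fun a b x y => ?_
    rw [MeasurableEquiv.symm_apply_eq]
    ext i <;> rfl

theorem prekopaLeindler_euclideanSpace (n : ℕ) :
    PrekopaLeindler (volume : Measure (EuclideanSpace ℝ (Fin n))) :=
  (prekopaLeindler_pi n).of_measurePreserving (MeasurableEquiv.toLp 2 (Fin n → ℝ))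
    (EuclideanSpace.volume_preserving_symm_measurableEquiv_toLp (Fin n)).symm fun _ _ _ _ => rfl

end PrekopaLeindler

/-! ### Log-concave densities, finiteness of entropy, Gibbs' inequality. -/

section LogConcaveBasics

variable {d : ℕ}

lemma LogConcave.convex_support {f : EuclideanSpace ℝ (Fin d) → ℝ} (hf : LogConcave f) :
    Convex ℝ {x | 0 < f x} := by
  intro x hx y hy a b ha hb hab
  exact lt_of_lt_of_le (mul_pos (Real.rpow_pos_of_pos hx _) (Real.rpow_pos_of_pos hy _))
    (hf x y a b ha hb hab)

lemma LogConcave.concaveOn_log {f : EuclideanSpace ℝ (Fin d) → ℝ} (hf : LogConcave f) :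
    ConcaveOn ℝ {x | 0 < f x} fun x => Real.log (f x) := by
  refine ⟨hf.convex_support, fun x hx y hy a b ha hb hab => ?_⟩
  have hx' : 0 < f x := hx
  have hy' : 0 < f y := hy
  have := Real.log_le_log (mul_pos (Real.rpow_pos_of_pos hx' _) (Real.rpow_pos_of_pos hy' _))
    (hf x y a b ha hb hab)
  rwa [Real.log_mul (Real.rpow_pos_of_pos hx' _).ne' (Real.rpow_pos_of_pos hy' _).ne',
    Real.log_rpow hx', Real.log_rpow hy'] at this

lemma LogConcave.continuousAt {f : EuclideanSpace ℝ (Fin d) → ℝ} (hf : LogConcave f)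
    {x : EuclideanSpace ℝ (Fin d)} (hx : x ∈ interior {x | 0 < f x}) : ContinuousAt f x := by
  have h1 := hf.concaveOn_log.continuousOn_interior.continuousAt (isOpen_interior.mem_nhds hx)
  refine (Real.continuous_exp.continuousAt.comp h1).congr ?_
  filter_upwards [isOpen_interior.mem_nhds hx] with y hy
  exact Real.exp_log (interior_subset hy : y ∈ {x | 0 < f x})

lemma LogConcave.volume_frontier_support {f : EuclideanSpace ℝ (Fin d) → ℝ} (hf : LogConcave f) :
    volume (frontier {x | 0 < f x}) = 0 := hf.convex_support.addHaar_frontier volume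

variable {μ : Measure (EuclideanSpace ℝ (Fin d))} {f : EuclideanSpace ℝ (Fin d) → ℝ}

lemma IsDensityOf.lintegral_eq (hf : IsDensityOf f μ) {F : EuclideanSpace ℝ (Fin d) → ℝ≥0∞}
    (hF : Measurable F) : ∫⁻ x, F x ∂μ = ∫⁻ x, ENNReal.ofReal (f x) * F x := by
  rw [hf.eq_withDensity, lintegral_withDensity_eq_lintegral_mul _ hf.measurable.ennreal_ofReal hF]
  rfl

lemma IsDensityOf.lintegral_eq_one [IsProbabilityMeasure μ] (hf : IsDensityOf f μ) :
    ∫⁻ x, ENNReal.ofReal (f x) = 1 := by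
  have := hf.lintegral_eq (F := fun _ => 1) measurable_const
  simpa using this.symm

lemma IsDensityOf.integral_eq (hf : IsDensityOf f μ) (F : EuclideanSpace ℝ (Fin d) → ℝ) :
    ∫ x, F x ∂μ = ∫ x, f x * F x := by
  rw [hf.eq_withDensity, integral_withDensity_eq_integral_toReal_smul hf.measurable.ennreal_ofReal
    (by filter_upwards with w using ENNReal.ofReal_lt_top)]
  simp_rw [ENNReal.toReal_ofReal (hf.nonneg _), smul_eq_mul]

lemma IsDensityOf.integrable_iff (hf : IsDensityOf f μ) (F : EuclideanSpace ℝ (Fin d) → ℝ) :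
    Integrable F μ ↔ Integrable fun x => f x * F x := by
  rw [hf.eq_withDensity, integrable_withDensity_iff_integrable_smul' hf.measurable.ennreal_ofReal
    (by filter_upwards with w using ENNReal.ofReal_lt_top)]
  simp_rw [ENNReal.toReal_ofReal (hf.nonneg _), smul_eq_mul]

lemma IsDensityOf.ae_pos (hf : IsDensityOf f μ) : ∀ᵐ x ∂μ, 0 < f x := by
  have h : μ {x | f x ≤ 0} = 0 := by
    have hm : MeasurableSet {x | f x ≤ 0} := measurableSet_le hf.measurable measurable_const
    rw [hf.eq_withDensity, withDensity_apply _ hm]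
    refine (setLIntegral_congr_fun hm fun x hx => ?_).trans (lintegral_zero)
    exact ENNReal.ofReal_eq_zero.2 hx
  rw [ae_iff]
  simpa only [not_lt] using h

lemma IsDensityOf.absolutelyContinuous (hf : IsDensityOf f μ) : μ ≪ volume := by
  rw [hf.eq_withDensity]; exact withDensity_absolutelyContinuous _ _

lemma IsDensityOf.lebesgueDensity_ae_eq (hf : IsDensityOf f μ) :
    lebesgueDensity μ =ᵐ[volume] f := by
  have h := Measure.rnDeriv_withDensity (volume : Measure (EuclideanSpace ℝ (Fin d)))
    hf.measurable.ennreal_ofReal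
  rw [← hf.eq_withDensity] at h
  filter_upwards [h] with x hx
  rw [lebesgueDensity, hx, ENNReal.toReal_ofReal (hf.nonneg x)]

lemma IsDensityOf.entropy_eq (hf : IsDensityOf f μ) :
    entropy μ = -∫ x, Real.log (f x) ∂μ := by
  rw [hf.integral_eq, entropy]
  congr 1
  refine integral_congr_ae ?_
  filter_upwards [hf.lebesgueDensity_ae_eq] with x hx
  rw [hx]

lemma IsDensityOf.hasFiniteEntropy_iff (hf : IsDensityOf f μ) :
    HasFiniteEntropy μ ↔ Integrable (fun x => Real.log (f x)) μ := by
  rw [hf.integrable_iff, HasFiniteEntropy]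
  refine ⟨fun h => h.2.congr ?_, fun h => ⟨hf.absolutelyContinuous, h.congr ?_⟩⟩
  · filter_upwards [hf.lebesgueDensity_ae_eq] with x hx
    rw [hx]
  · filter_upwards [hf.lebesgueDensity_ae_eq] with x hx
    rw [hx]

lemma LogConcave.interior_support_nonempty [IsProbabilityMeasure μ] (hlc : LogConcave f)
    (hf : IsDensityOf f μ) : (interior {x | 0 < f x}).Nonempty := by
  by_contra h
  rw [Set.not_nonempty_iff_eq_empty] at h
  have h1 : volume {x | 0 < f x} = 0 := by
    refine measure_mono_null ?_ hlc.volume_frontier_support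
    rw [frontier, h, Set.sdiff_empty]
    exact subset_closure
  have h2 : ∀ᵐ x ∂μ, ¬ 0 < f x := by
    rw [ae_iff]
    simpa using hf.absolutelyContinuous h1
  obtain ⟨x, hx, hx'⟩ := (h2.and hf.ae_pos).exists
  exact hx hx'

/-- An integrable log-concave function is bounded. -/
lemma LogConcave.exists_le [IsProbabilityMeasure μ] (hlc : LogConcave f) (hf : IsDensityOf f μ) :
    ∃ M, 0 < M ∧ ∀ x, f x ≤ M := by
  obtain ⟨x0, hx0⟩ := hlc.interior_support_nonempty hf
  have hpos : 0 < f x0 := (interior_subset hx0 : x0 ∈ {x | 0 < f x})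
  set δ := f x0 / 2 with hδ
  have hδ0 : 0 < δ := by positivity
  have h1 : ∀ᶠ z in nhds x0, δ < f z := (hlc.continuousAt hx0).eventually_const_lt (by linarith)
  obtain ⟨ρ, hρ, hball⟩ := Metric.eventually_nhds_iff_ball.1 h1
  set v := (volume (Metric.ball x0 (ρ / 2))).toReal with hv
  have hv' : ∀ y : EuclideanSpace ℝ (Fin d), volume (Metric.ball y (ρ / 2)) = ENNReal.ofReal v := by
    intro y
    rw [hv, ENNReal.ofReal_toReal (measure_ball_lt_top (μ := volume) (x := x0)).ne, Measure.addHaar_ball_center,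
      ← Measure.addHaar_ball_center volume x0]
  have hv0 : 0 < v := ENNReal.toReal_pos (Metric.measure_ball_pos volume x0 (by positivity)).ne'
    measure_ball_lt_top.ne
  refine ⟨(1 / v) ^ 2 / δ, by positivity, fun x => ?_⟩
  -- A large value at `x` forces large values on a whole ball around the midpoint of `x` and `x0`,
  -- whose volume does not depend on `x`; total mass one then bounds f x.
  have h2 : ∀ y ∈ Metric.ball ((1 / 2 : ℝ) • x + (1 / 2 : ℝ) • x0) (ρ / 2),
      √(f x * δ) ≤ f y := by
    intro y hy
    have hz : (2 : ℝ) • y - x ∈ Metric.ball x0 ρ := by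
      rw [mem_ball_iff_norm] at hy ⊢
      have : (2 : ℝ) • y - x - x0 = (2 : ℝ) • (y - ((1 / 2 : ℝ) • x + (1 / 2 : ℝ) • x0)) := by
        module
      rw [this, norm_smul]
      norm_num
      linarith
    have h3 := hlc x ((2 : ℝ) • y - x) (1 / 2) (1 / 2) (by norm_num) (by norm_num) (by norm_num)
    rw [show (1 / 2 : ℝ) • x + (1 / 2 : ℝ) • ((2 : ℝ) • y - x) = y by module] at h3
    rw [← Real.sqrt_eq_rpow, ← Real.sqrt_eq_rpow, ← Real.sqrt_mul (hf.nonneg x)] at h3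
    refine le_trans (Real.sqrt_le_sqrt ?_) h3
    exact mul_le_mul_of_nonneg_left (hball _ hz).le (hf.nonneg x)
  have h4 : ENNReal.ofReal (√(f x * δ) * v) ≤ 1 := by
    calc _ = ∫⁻ y in Metric.ball ((1 / 2 : ℝ) • x + (1 / 2 : ℝ) • x0) (ρ / 2),
          ENNReal.ofReal (√(f x * δ)) := by
          rw [setLIntegral_const, hv', ENNReal.ofReal_mul (Real.sqrt_nonneg _)]
      _ ≤ ∫⁻ y in Metric.ball ((1 / 2 : ℝ) • x + (1 / 2 : ℝ) • x0) (ρ / 2),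
          ENNReal.ofReal (f y) :=
          setLIntegral_mono' measurableSet_ball fun y hy => ENNReal.ofReal_le_ofReal (h2 y hy)
      _ ≤ ∫⁻ y, ENNReal.ofReal (f y) := setLIntegral_le_lintegral _ _
      _ = 1 := hf.lintegral_eq_one
  rw [ENNReal.ofReal_le_one, ← le_div_iff₀ hv0] at h4
  rw [le_div_iff₀ hδ0]
  have h5 := Real.sq_sqrt (mul_nonneg (hf.nonneg x) hδ0.le)
  rw [← h5]
  exact pow_le_pow_left₀ (Real.sqrt_nonneg _) h4 2

/-- For p ≤ 1, either p ≥ exp(-s) and |log p| ≤ s, or p is so small that p|log p| ≤ 2√p ≤ 2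
exp(-s/2). With s = ‖x‖² the second moment and a Gaussian integral control the entropy integrand. -/
lemma abs_mul_log_le {p M s : ℝ} (hp : 0 ≤ p) (hM : p ≤ M) (hs : 0 ≤ s) :
    |p * Real.log p| ≤ p * |Real.log M| + p * s + 2 * Real.exp (-(1 / 2) * s) := by
  rcases hp.eq_or_lt with rfl | hp
  · simp; positivity
  rw [abs_mul, abs_of_pos hp]
  have e0 := (Real.exp_pos (-(1 / 2) * s)).le
  rcases le_total 1 p with h1 | h1
  · have h2 : |Real.log p| ≤ |Real.log M| := by
      rw [abs_of_nonneg (Real.log_nonneg h1), abs_of_nonneg (Real.log_nonneg (h1.trans hM))]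
      exact Real.log_le_log hp hM
    nlinarith [mul_nonneg hp.le hs, mul_le_mul_of_nonneg_left h2 hp.le]
  · rw [abs_of_nonpos (Real.log_nonpos hp.le h1)]
    have hpM : 0 ≤ p * |Real.log M| := by positivity
    rcases le_total (Real.exp (-s)) p with h2 | h2
    · have h3 : -Real.log p ≤ s := by
        have := Real.log_le_log (Real.exp_pos _) h2
        rw [Real.log_exp] at this
        linarith
      nlinarith [mul_le_mul_of_nonneg_left h3 hp.le]
    · have hq : 0 < √p := Real.sqrt_pos.2 hp
      have h3 : -Real.log p ≤ 2 / √p := by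
        have h4 := Real.log_le_sub_one_of_pos (inv_pos.2 hq)
        rw [Real.log_inv, Real.log_sqrt hp.le] at h4
        have : 2 / √p = 2 * (√p)⁻¹ := by ring
        rw [this]; linarith
      have h5 : √p ≤ Real.exp (-(1 / 2) * s) := by
        rw [show -(1 / 2) * s = -s / 2 by ring, Real.exp_half]
        exact Real.sqrt_le_sqrt h2
      have h6 : p * -Real.log p ≤ 2 * √p := by
        calc p * -Real.log p ≤ p * (2 / √p) := mul_le_mul_of_nonneg_left h3 hp.le
          _ = 2 * √p := by
            rw [mul_div_assoc', mul_comm p 2, mul_div_assoc, Real.div_sqrt]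
      nlinarith [mul_nonneg hp.le hs]

lemma IsDensityOf.integrable_log [IsProbabilityMeasure μ] (hf : IsDensityOf f μ) {M : ℝ}
    (hM : ∀ x, f x ≤ M) (h2 : Integrable (fun x => ‖x‖ ^ 2) μ) :
    Integrable (fun x => Real.log (f x)) μ := by
  have i0 : Integrable f := by
    have := (hf.integrable_iff (fun _ => 1)).1 (integrable_const 1)
    simpa using this
  have i1 := (hf.integrable_iff _).1 h2
  have i2 : Integrable fun x : EuclideanSpace ℝ (Fin d) => Real.exp (-(1 / 2) * ‖x‖ ^ 2) := by
    have := (integrable_gaussianDensity (E := EuclideanSpace ℝ (Fin d))).const_mul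
      (((2 * Real.pi) ^ (-(Module.finrank ℝ (EuclideanSpace ℝ (Fin d)) / 2 : ℝ)))⁻¹)
    refine this.congr (.of_forall fun x => ?_)
    simp only [gaussianDensity]
    rw [inv_mul_cancel_left₀]
    positivity
  rw [hf.integrable_iff]
  refine (((i0.mul_const |Real.log M|).add i1).add (i2.const_mul 2)).mono'
    (hf.measurable.mul (Real.measurable_log.comp hf.measurable)).aestronglyMeasurable
    (.of_forall fun x => ?_)
  exact abs_mul_log_le (hf.nonneg x) (hM x) (sq_nonneg _)

/-- Gibbs' inequality. -/
lemma IsDensityOf.integral_log_le [IsProbabilityMeasure μ] (hf : IsDensityOf f μ)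
    (hi : Integrable (fun x => Real.log (f x)) μ) {h : EuclideanSpace ℝ (Fin d) → ℝ}
    (hm : Measurable h) (h1 : ∫⁻ x, ENNReal.ofReal (h x) ≤ 1)
    (hpos : ∀ᵐ x ∂μ, 0 < h x) (hhi : Integrable (fun x => Real.log (h x)) μ) :
    ∫ x, Real.log (h x) ∂μ ≤ ∫ x, Real.log (f x) ∂μ := by
  have hle : ∫⁻ x, ENNReal.ofReal (h x / f x) ∂μ ≤ 1 := by
    rw [hf.lintegral_eq (F := fun x => ENNReal.ofReal (h x / f x))
      (hm.div hf.measurable).ennreal_ofReal]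
    refine le_trans (lintegral_mono fun x => ?_) h1
    rw [← ENNReal.ofReal_mul (hf.nonneg x)]
    rcases (hf.nonneg x).eq_or_lt with h0 | h0
    · rw [← h0]; simp
    · rw [mul_div_cancel₀ _ h0.ne']
  have hnn : 0 ≤ᵐ[μ] fun x => h x / f x := by
    filter_upwards [hpos] with x hx using div_nonneg hx.le (hf.nonneg x)
  have hint : Integrable (fun x => h x / f x) μ := by
    refine ⟨(hm.div hf.measurable).aestronglyMeasurable, ?_⟩
    rw [hasFiniteIntegral_iff_ofReal hnn]
    exact hle.trans_lt ENNReal.one_lt_top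
  have hval : ∫ x, h x / f x ∂μ ≤ 1 := by
    rw [integral_eq_lintegral_of_nonneg_ae hnn (hm.div hf.measurable).aestronglyMeasurable]
    exact ENNReal.toReal_le_of_le_ofReal one_pos.le (by simpa using hle)
  -- This is log u ≤ u - 1 at u = h/f. Only total mass at most one is needed of `h`, so
  -- sub-densities are allowed as test functions.
  have hcomp : ∫ x, (Real.log (h x) - Real.log (f x)) ∂μ ≤ ∫ x, (h x / f x - 1) ∂μ := by
    refine integral_mono_ae (hhi.sub hi) (hint.sub (integrable_const 1)) ?_
    filter_upwards [hpos, hf.ae_pos] with x hx hx'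
    have := Real.log_le_sub_one_of_pos (div_pos hx hx')
    rwa [Real.log_div hx.ne' hx'.ne'] at this
  rw [integral_sub hhi hi, integral_sub hint (integrable_const 1)] at hcomp
  simp only [integral_const, probReal_univ, one_smul] at hcomp
  linarith

end LogConcaveBasics

/-! ### Isotropic laws, the Gaussian entropy, normalized self-convolution. -/

section Isotropic

variable {d : ℕ} {μ : Measure (EuclideanSpace ℝ (Fin d))}

/-- The integral of a non-integrable function is 0 by convention, so the covariance value 1 already
contains integrability. -/
lemma IsIsotropic.integrable_coord_sq (h : IsIsotropic μ) (i : Fin d) :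
    Integrable (fun x : EuclideanSpace ℝ (Fin d) => x i * x i) μ :=
  Integrable.of_integral_ne_zero (by rw [h.covariance i i]; simp)

lemma IsIsotropic.integrable_norm_sq (h : IsIsotropic μ) : Integrable (fun x => ‖x‖ ^ 2) μ := by
  have : ∀ x : EuclideanSpace ℝ (Fin d), ‖x‖ ^ 2 = ∑ i, x i * x i := by
    intro x
    rw [EuclideanSpace.real_norm_sq_eq]
    simp_rw [sq]
  simp_rw [this]
  exact integrable_finsetSum _ fun i _ => h.integrable_coord_sq i

lemma IsIsotropic.integral_norm_sq (h : IsIsotropic μ) : ∫ x, ‖x‖ ^ 2 ∂μ = d := by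
  have : ∀ x : EuclideanSpace ℝ (Fin d), ‖x‖ ^ 2 = ∑ i, x i * x i := by
    intro x
    rw [EuclideanSpace.real_norm_sq_eq]
    simp_rw [sq]
  simp_rw [this]
  rw [integral_finsetSum _ fun i _ => h.integrable_coord_sq i]
  simp [h.covariance]

lemma integrable_coord [IsProbabilityMeasure μ] (h2 : Integrable (fun x => ‖x‖ ^ 2) μ) (i : Fin d) :
    Integrable (fun x : EuclideanSpace ℝ (Fin d) => x i) μ := by
  have := integrable_inner h2 (EuclideanSpace.single i 1)
  simpa [EuclideanSpace.inner_single_right] using this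

lemma integrable_coord_mul_coord [IsProbabilityMeasure μ] (h2 : Integrable (fun x => ‖x‖ ^ 2) μ)
    (i j : Fin d) : Integrable (fun x : EuclideanSpace ℝ (Fin d) => x i * x j) μ := by
  have := integrable_inner_mul_inner h2 (EuclideanSpace.single i 1) (EuclideanSpace.single j 1)
  simpa [EuclideanSpace.inner_single_right] using this

lemma integrable_id_of_norm_sq [IsProbabilityMeasure μ] (h2 : Integrable (fun x => ‖x‖ ^ 2) μ) :
    Integrable (fun x : EuclideanSpace ℝ (Fin d) => x) μ := by
  refine ((integrable_const 1).add h2).mono' (by fun_prop) (.of_forall fun x => ?_)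
  simp only [Pi.add_apply]
  nlinarith [sq_nonneg (‖x‖ - 1), sq_nonneg ‖x‖]

lemma IsIsotropic.integral_inner [IsProbabilityMeasure μ] (h : IsIsotropic μ)
    (v : EuclideanSpace ℝ (Fin d)) : ∫ x, inner ℝ x v ∂μ = 0 := by
  have := _root_.integral_inner (𝕜 := ℝ) (integrable_id_of_norm_sq h.integrable_norm_sq) v
  rw [h.centered, inner_zero_right] at this
  rw [← this]
  exact integral_congr_ae (.of_forall fun x => real_inner_comm _ _)

lemma IsIsotropic.integral_coord [IsProbabilityMeasure μ] (h : IsIsotropic μ) (i : Fin d) :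
    ∫ x, x i ∂μ = 0 := by
  have := h.integral_inner (EuclideanSpace.single i 1)
  simpa [EuclideanSpace.inner_single_right] using this

lemma integral_coord_stdGaussian (i : Fin d) :
    ∫ x, x i ∂(stdGaussian (EuclideanSpace ℝ (Fin d))) = 0 := by
  have := integral_strongDual_stdGaussian (E := EuclideanSpace ℝ (Fin d))
    (innerSL ℝ (EuclideanSpace.single i 1))
  simpa [EuclideanSpace.inner_single_left] using this

lemma integral_coord_mul_coord_stdGaussian (i j : Fin d) :
    ∫ x, x i * x j ∂(stdGaussian (EuclideanSpace ℝ (Fin d))) = if i = j then 1 else 0 := by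
  have h2 := integrable_norm_sq_stdGaussian (E := EuclideanSpace ℝ (Fin d))
  have key : ∀ k : Fin d, ∫ x, x k * x k ∂(stdGaussian (EuclideanSpace ℝ (Fin d))) = 1 := by
    intro k
    have := integral_norm_sq_stdGaussian (E := EuclideanSpace ℝ (Fin d)) (EuclideanSpace.single k 1)
    simpa [EuclideanSpace.inner_single_right, sq] using this
  split_ifs with hij
  · subst hij; exact key i
  -- Off the diagonal, polarise: test the variance on the sum of two basis vectors.
  · have h1 := integral_norm_sq_stdGaussian (E := EuclideanSpace ℝ (Fin d))
      (EuclideanSpace.single i 1 + EuclideanSpace.single j 1)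
    have e1 : ‖(EuclideanSpace.single i 1 + EuclideanSpace.single j 1 :
        EuclideanSpace ℝ (Fin d))‖ ^ 2 = 2 := by
      rw [norm_add_sq_real]
      simp [EuclideanSpace.inner_single_right, Ne.symm hij]
      norm_num
    rw [e1] at h1
    have e2 : ∀ x : EuclideanSpace ℝ (Fin d),
        inner ℝ x (EuclideanSpace.single i 1 + EuclideanSpace.single j 1) ^ 2 =
          x i * x i + (x j * x j + 2 * (x i * x j)) := by
      intro x
      rw [inner_add_right]
      simp [EuclideanSpace.inner_single_right]
      ring
    simp_rw [e2] at h1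
    have i1 := integrable_coord_mul_coord h2 i i
    have i2 := integrable_coord_mul_coord h2 j j
    have i3 : Integrable (fun x : EuclideanSpace ℝ (Fin d) => 2 * (x i * x j)) (stdGaussian _) :=
      (integrable_coord_mul_coord h2 i j).const_mul 2
    have i4 : Integrable (fun x : EuclideanSpace ℝ (Fin d) => x j * x j + 2 * (x i * x j))
      (stdGaussian _) := i2.add i3
    rw [integral_add i1 i4, integral_add i2 i3, integral_const_mul, key, key] at h1
    linarith

lemma isIsotropic_stdGaussian : IsIsotropic (stdGaussian (EuclideanSpace ℝ (Fin d))) :=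
  ⟨integral_id_stdGaussian, integral_coord_mul_coord_stdGaussian⟩

lemma isDensityOf_stdGaussian :
    IsDensityOf gaussianDensity (stdGaussian (EuclideanSpace ℝ (Fin d))) :=
  ⟨continuous_gaussianDensity.measurable, fun x => (gaussianDensity_pos x).le,
    stdGaussian_eq_withDensity⟩

lemma log_gaussianDensity (x : EuclideanSpace ℝ (Fin d)) :
    Real.log (gaussianDensity x) = -(d / 2 * Real.log (2 * Real.pi)) - ‖x‖ ^ 2 / 2 := by
  rw [gaussianDensity, Real.log_mul (by positivity) (by positivity), Real.log_exp,
    Real.log_rpow (by positivity)]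
  simp
  ring

lemma entropy_stdGaussian :
    entropy (stdGaussian (EuclideanSpace ℝ (Fin d))) = d / 2 * Real.log (2 * Real.pi) + d / 2 := by
  rw [isDensityOf_stdGaussian.entropy_eq]
  simp_rw [log_gaussianDensity]
  rw [integral_sub (integrable_const _) (integrable_norm_sq_stdGaussian.div_const 2),
    integral_div, isIsotropic_stdGaussian.integral_norm_sq]
  simp
  ring

/-- The law of `(X + Y) / √2` for independent `X`, `Y` of law `μ`. -/
noncomputable def selfConvolution (μ : Measure (EuclideanSpace ℝ (Fin d))) :
    Measure (EuclideanSpace ℝ (Fin d)) :=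
  (μ.prod μ).map fun p => (√2 : ℝ)⁻¹ • (p.1 + p.2)

/-- The density of `(X + Y) / √2` for independent `X`, `Y` with density `f`. -/
noncomputable def selfConvolutionDensity (f : EuclideanSpace ℝ (Fin d) → ℝ)
    (u : EuclideanSpace ℝ (Fin d)) : ℝ :=
  (∫⁻ x, ENNReal.ofReal (√2 ^ d * (f x * f ((√2 : ℝ) • u - x)))).toReal

instance [IsProbabilityMeasure μ] : IsProbabilityMeasure (selfConvolution μ) :=
  Measure.isProbabilityMeasure_map (by fun_prop)

lemma lintegral_selfConvolution (μ : Measure (EuclideanSpace ℝ (Fin d)))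
    {F : EuclideanSpace ℝ (Fin d) → ℝ≥0∞} (hF : Measurable F) :
    ∫⁻ u, F u ∂(selfConvolution μ) = ∫⁻ p, F ((√2 : ℝ)⁻¹ • (p.1 + p.2)) ∂(μ.prod μ) := by
  rw [selfConvolution, lintegral_map hF (by fun_prop)]

lemma integral_selfConvolution (μ : Measure (EuclideanSpace ℝ (Fin d)))
    {F : EuclideanSpace ℝ (Fin d) → ℝ} (hF : Measurable F) :
    ∫ u, F u ∂(selfConvolution μ) = ∫ p, F ((√2 : ℝ)⁻¹ • (p.1 + p.2)) ∂(μ.prod μ) := by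
  rw [selfConvolution, integral_map (by fun_prop) hF.aestronglyMeasurable]

lemma integrable_selfConvolution_iff (μ : Measure (EuclideanSpace ℝ (Fin d)))
    {F : EuclideanSpace ℝ (Fin d) → ℝ} (hF : Measurable F) :
    Integrable F (selfConvolution μ) ↔
      Integrable (fun p => F ((√2 : ℝ)⁻¹ • (p.1 + p.2))) (μ.prod μ) := by
  rw [selfConvolution, integrable_map_measure hF.aestronglyMeasurable (by fun_prop)]
  rfl

variable [IsProbabilityMeasure μ]

lemma IsIsotropic.selfConvolution (h : IsIsotropic μ) : IsIsotropic (selfConvolution μ) := by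
  have h2 := h.integrable_norm_sq
  have s2 : (√2 : ℝ)⁻¹ * (√2 : ℝ)⁻¹ = 1 / 2 := by
    rw [← mul_inv, Real.mul_self_sqrt (by norm_num)]; norm_num
  refine ⟨?_, fun i j => ?_⟩
  · have i1 := integrable_id_of_norm_sq h2
    rw [_root_.selfConvolution, integral_map (by fun_prop) (by fun_prop), integral_smul,
      integral_add (i1.comp_fst μ) (i1.comp_snd μ)]
    rw [integral_prod _ (i1.comp_fst μ), integral_prod _ (i1.comp_snd μ)]
    simp [h.centered]
  · rw [integral_selfConvolution μ (F := fun u => u i * u j) (by fun_prop)]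
    have e : ∀ p : EuclideanSpace ℝ (Fin d) × EuclideanSpace ℝ (Fin d),
        ((√2 : ℝ)⁻¹ • (p.1 + p.2)) i * ((√2 : ℝ)⁻¹ • (p.1 + p.2)) j =
          (1 / 2) * ((p.1 i * p.1 j + p.2 i * p.2 j) + (p.1 i * p.2 j + p.1 j * p.2 i)) := by
      intro p
      simp only [PiLp.smul_apply, PiLp.add_apply, smul_eq_mul]
      rw [← s2]; ring
    simp_rw [e]
    have a1 := (integrable_coord_mul_coord h2 i j).comp_fst μ
    have a2 := (integrable_coord_mul_coord h2 i j).comp_snd μ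
    have a3 := (integrable_coord h2 i).mul_prod (integrable_coord h2 j)
    have a4 := (integrable_coord h2 j).mul_prod (integrable_coord h2 i)
    have b1 := a1.add a2
    have b2 := a3.add a4
    simp only [Pi.add_def] at b1 b2
    rw [integral_const_mul, integral_add b1 b2, integral_add a1 a2, integral_add a3 a4,
      integral_prod_mul (fun x : EuclideanSpace ℝ (Fin d) => x i)
        (fun x : EuclideanSpace ℝ (Fin d) => x j),
      integral_prod_mul (fun x : EuclideanSpace ℝ (Fin d) => x j)
        (fun x : EuclideanSpace ℝ (Fin d) => x i),
      integral_prod _ a1, integral_prod _ a2]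
    simp [h.integral_coord, h.covariance]
    split_ifs <;> norm_num

end Isotropic

/-! ### Log-concavity of marginals and of convolutions. -/

section LogConcaveMarginals

variable {d : ℕ}

/-- Marginals of log-concave functions are log-concave. -/
lemma logConcave_marginal {G : EuclideanSpace ℝ (Fin d) → EuclideanSpace ℝ (Fin d) → ℝ}
    (hm : ∀ u, Measurable (G u)) (h0 : ∀ u x, 0 ≤ G u x)
    (hG : ∀ u v x y : EuclideanSpace ℝ (Fin d), ∀ a b : ℝ, 0 ≤ a → 0 ≤ b → a + b = 1 →
      G u x ^ a * G v y ^ b ≤ G (a • u + b • v) (a • x + b • y))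
    (hfin : ∀ u, ∫⁻ x, ENNReal.ofReal (G u x) ≠ ⊤) :
    LogConcave fun u => (∫⁻ x, ENNReal.ofReal (G u x)).toReal := by
  intro u v a b ha hb hab
  -- `PrekopaLeindler` asks for positive weights; the extreme weights are trivial here.
  rcases ha.eq_or_lt with rfl | ha
  · obtain rfl : b = 1 := by linarith
    simp
  rcases hb.eq_or_lt with rfl | hb
  · obtain rfl : a = 1 := by linarith
    simp
  have key := prekopaLeindler_euclideanSpace d (fun x => ENNReal.ofReal (G u x))
    (fun x => ENNReal.ofReal (G v x)) (fun x => ENNReal.ofReal (G (a • u + b • v) x))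
    (hm _).ennreal_ofReal (hm _).ennreal_ofReal (hm _).ennreal_ofReal a b ha hb hab (fun x y => by
      rw [ENNReal.ofReal_rpow_of_nonneg (h0 _ _) ha.le, ENNReal.ofReal_rpow_of_nonneg (h0 _ _) hb.le,
        ← ENNReal.ofReal_mul (Real.rpow_nonneg (h0 _ _) _)]
      exact ENNReal.ofReal_le_ofReal (hG u v x y a b ha.le hb.le hab))
  have := ENNReal.toReal_mono (hfin _) key
  rwa [ENNReal.toReal_mul, ← ENNReal.toReal_rpow, ← ENNReal.toReal_rpow] at this

lemma logConcave_gaussianDensity :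
    LogConcave (gaussianDensity (E := EuclideanSpace ℝ (Fin d))) := by
  intro x y a b ha hb hab
  rw [← Real.exp_log (gaussianDensity_pos (a • x + b • y)),
    ← Real.exp_log (gaussianDensity_pos x), ← Real.exp_log (gaussianDensity_pos y),
    ← Real.exp_mul, ← Real.exp_mul, ← Real.exp_add, Real.exp_le_exp]
  simp_rw [log_gaussianDensity]
  have h1 : ‖a • x + b • y‖ ^ 2 ≤ a * ‖x‖ ^ 2 + b * ‖y‖ ^ 2 := by
    rw [norm_add_sq_real, norm_smul, norm_smul, inner_smul_left, inner_smul_right]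
    simp only [Real.norm_eq_abs, abs_of_nonneg ha, abs_of_nonneg hb, conj_trivial]
    have e : a * ‖x‖ ^ 2 + b * ‖y‖ ^ 2 -
        ((a * ‖x‖) ^ 2 + 2 * (a * (b * inner ℝ x y)) + (b * ‖y‖) ^ 2) = a * b * ‖x - y‖ ^ 2 := by
      rw [norm_sub_sq_real]
      obtain rfl : b = 1 - a := by linarith
      ring
    have := mul_nonneg (mul_nonneg ha hb) (sq_nonneg ‖x - y‖)
    linarith
  obtain rfl : b = 1 - a := by linarith
  linarith

lemma gaussianDensity_le (x : EuclideanSpace ℝ (Fin d)) :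
    gaussianDensity x ≤ gaussianDensity (0 : EuclideanSpace ℝ (Fin d)) := by
  rw [← Real.exp_log (gaussianDensity_pos x),
    ← Real.exp_log (gaussianDensity_pos (0 : EuclideanSpace ℝ (Fin d))), Real.exp_le_exp,
    log_gaussianDensity, log_gaussianDensity]
  simp
  positivity

variable {μ : Measure (EuclideanSpace ℝ (Fin d))} {f : EuclideanSpace ℝ (Fin d) → ℝ}

/-- Boundedness of `f` makes the convolution finite at every point, so that `toReal` in
`selfConvolutionDensity` loses nothing. -/
lemma lintegral_selfConvolutionDensity_le [IsProbabilityMeasure μ] (hf : IsDensityOf f μ) {M : ℝ}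
    (hM : ∀ x, f x ≤ M) (u : EuclideanSpace ℝ (Fin d)) :
    ∫⁻ x, ENNReal.ofReal (√2 ^ d * (f x * f ((√2 : ℝ) • u - x))) ≤
      ENNReal.ofReal (√2 ^ d * M) := by
  have hM0 : 0 ≤ M := (hf.nonneg 0).trans (hM 0)
  calc _ ≤ ∫⁻ x, ENNReal.ofReal (√2 ^ d * M) * ENNReal.ofReal (f x) := by
        refine lintegral_mono fun x => ?_
        rw [← ENNReal.ofReal_mul (by positivity)]
        refine ENNReal.ofReal_le_ofReal ?_
        rw [mul_assoc, mul_comm M]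
        have := hf.nonneg x
        gcongr
        exact hM _
    _ = _ := by
        rw [lintegral_const_mul _ hf.measurable.ennreal_ofReal, hf.lintegral_eq_one, mul_one]

lemma ofReal_selfConvolutionDensity [IsProbabilityMeasure μ] (hf : IsDensityOf f μ) {M : ℝ}
    (hM : ∀ x, f x ≤ M) (u : EuclideanSpace ℝ (Fin d)) :
    ENNReal.ofReal (selfConvolutionDensity f u) =
      ∫⁻ x, ENNReal.ofReal (√2 ^ d * (f x * f ((√2 : ℝ) • u - x))) :=
  ENNReal.ofReal_toReal
    ((lintegral_selfConvolutionDensity_le hf hM u).trans_lt ENNReal.ofReal_lt_top).ne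

lemma lintegral_eq_lintegral_smul_sub {g : EuclideanSpace ℝ (Fin d) → ℝ≥0∞} (hg : Measurable g)
    {c : ℝ} (hc : 0 < c) (x : EuclideanSpace ℝ (Fin d)) :
    ∫⁻ y, g y = ENNReal.ofReal (c ^ d) * ∫⁻ u, g (c • u - x) := by
  have h1 : ∫⁻ u, g (c • u - x) = ENNReal.ofReal |(c ^ d)⁻¹| * ∫⁻ y, g (y - x) := by
    have := Measure.map_addHaar_smul (volume : Measure (EuclideanSpace ℝ (Fin d))) hc.ne'
    rw [finrank_euclideanSpace_fin] at this
    rw [← smul_eq_mul, ← lintegral_smul_measure, ← this, lintegral_map (by fun_prop) (by fun_prop)]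
  have hp := pow_pos hc d
  rw [h1, lintegral_sub_right_eq_self g x, ← mul_assoc, ← ENNReal.ofReal_mul hp.le, abs_of_pos
    (inv_pos.2 hp), mul_inv_cancel₀ hp.ne']
  simp

lemma IsDensityOf.selfConvolution [IsProbabilityMeasure μ] (hf : IsDensityOf f μ) {M : ℝ}
    (hM : ∀ x, f x ≤ M) : IsDensityOf (selfConvolutionDensity f) (selfConvolution μ) := by
  have hfm := hf.measurable
  have hjm : Measurable fun p : EuclideanSpace ℝ (Fin d) × EuclideanSpace ℝ (Fin d) =>
      ENNReal.ofReal (√2 ^ d * (f p.2 * f ((√2 : ℝ) • p.1 - p.2))) := by fun_prop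
  refine ⟨(hjm.lintegral_prod_right').ennreal_toReal, fun u => ENNReal.toReal_nonneg, ?_⟩
  refine Measure.ext_of_lintegral _ fun F hF => ?_
  have hsm : Measurable fun p : EuclideanSpace ℝ (Fin d) × EuclideanSpace ℝ (Fin d) =>
      F ((√2 : ℝ)⁻¹ • (p.1 + p.2)) := by fun_prop
  have hjm2 : Measurable fun u => ∫⁻ x, ENNReal.ofReal (√2 ^ d * (f x * f ((√2 : ℝ) • u - x))) :=
    hjm.lintegral_prod_right'
  rw [lintegral_selfConvolution μ hF, lintegral_prod _ hsm.aemeasurable]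
  simp_rw [ofReal_selfConvolutionDensity hf hM]
  rw [lintegral_withDensity_eq_lintegral_mul _ hjm2 hF]
  have e1 : ∀ x : EuclideanSpace ℝ (Fin d), ∫⁻ y, F ((√2 : ℝ)⁻¹ • (x + y)) ∂μ =
      ∫⁻ u, ENNReal.ofReal (√2 ^ d * f ((√2 : ℝ) • u - x)) * F u := by
    intro x
    rw [hf.lintegral_eq (by fun_prop), lintegral_eq_lintegral_smul_sub (by fun_prop)
      (by positivity : (0:ℝ) < √2) x, ← lintegral_const_mul _ (by fun_prop)]
    refine lintegral_congr fun u => ?_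
    rw [add_sub_cancel, inv_smul_smul₀ (by positivity), ← mul_assoc,
      ← ENNReal.ofReal_mul (by positivity)]
  simp_rw [e1]
  rw [hf.lintegral_eq (Measurable.lintegral_prod_right' (f := fun p : EuclideanSpace ℝ (Fin d) ×
    EuclideanSpace ℝ (Fin d) => ENNReal.ofReal (√2 ^ d * f ((√2 : ℝ) • p.2 - p.1)) * F p.2)
    (by fun_prop))]
  have e2 : ∀ x : EuclideanSpace ℝ (Fin d), ENNReal.ofReal (f x) *
      ∫⁻ u, ENNReal.ofReal (√2 ^ d * f ((√2 : ℝ) • u - x)) * F u =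
      ∫⁻ u, ENNReal.ofReal (√2 ^ d * (f x * f ((√2 : ℝ) • u - x))) * F u := by
    intro x
    rw [← lintegral_const_mul _ (by fun_prop)]
    refine lintegral_congr fun u => ?_
    rw [← mul_assoc, ← ENNReal.ofReal_mul (hf.nonneg x)]
    congr 2; ring
  simp_rw [e2]
  rw [lintegral_lintegral_swap (by fun_prop)]
  refine lintegral_congr fun u => ?_
  rw [lintegral_mul_const _ (by fun_prop)]
  rfl

/-- The integrand is jointly log-concave in `(u, x)`, being a product of `f` along linear maps; the
convolution is its marginal. -/
lemma LogConcave.selfConvolutionDensity [IsProbabilityMeasure μ] (hlc : LogConcave f)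
    (hf : IsDensityOf f μ) {M : ℝ} (hM : ∀ x, f x ≤ M) :
    LogConcave (selfConvolutionDensity f) := by
  have hfm := hf.measurable
  have h0 := hf.nonneg
  refine logConcave_marginal (G := fun u x => √2 ^ d * (f x * f ((√2 : ℝ) • u - x)))
    (fun u => by fun_prop) (fun u x => by have := h0 x; have := h0 ((√2 : ℝ) • u - x); positivity)
    (fun u v x y a b ha hb hab => ?_) (fun u =>
      ((lintegral_selfConvolutionDensity_le hf hM u).trans_lt ENNReal.ofReal_lt_top).ne)
  have h1 := hlc x y a b ha hb hab
  have h2 := hlc ((√2 : ℝ) • u - x) ((√2 : ℝ) • v - y) a b ha hb hab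
  have e : (√2 : ℝ) • (a • u + b • v) - (a • x + b • y) =
    a • ((√2 : ℝ) • u - x) + b • ((√2 : ℝ) • v - y) := by module
  rw [e]
  have e3 : ((√2 : ℝ) ^ d) ^ a * ((√2 : ℝ) ^ d) ^ b = √2 ^ d := by
    rw [← Real.rpow_add (by positivity), hab, Real.rpow_one]
  rw [Real.mul_rpow (by positivity) (mul_nonneg (h0 _) (h0 _)), Real.mul_rpow (h0 _) (h0 _),
    Real.mul_rpow (by positivity) (mul_nonneg (h0 _) (h0 _)), Real.mul_rpow (h0 _) (h0 _)]
  calc _ = (((√2 : ℝ) ^ d) ^ a * ((√2 : ℝ) ^ d) ^ b) * ((f x ^ a * f y ^ b) *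
        (f ((√2 : ℝ) • u - x) ^ a * f ((√2 : ℝ) • v - y) ^ b)) := by ring
    _ ≤ _ := by
      rw [e3]
      refine mul_le_mul_of_nonneg_left (mul_le_mul h1 h2 ?_ (h0 _)) (by positivity)
      exact mul_nonneg (Real.rpow_nonneg (h0 _) _) (Real.rpow_nonneg (h0 _) _)

lemma ofReal_partitionFn_mul_gaussianDensity [IsProbabilityMeasure μ] (hf : IsDensityOf f μ)
    (r : ℝ) (w : EuclideanSpace ℝ (Fin d)) :
    ENNReal.ofReal (partitionFn μ r w * gaussianDensity w) =
      ∫⁻ x, ENNReal.ofReal (f x * gaussianDensity (w - r • x)) := by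
  rw [partitionFn, ← integral_mul_const, ofReal_integral_eq_lintegral_ofReal,
    hf.lintegral_eq]
  · refine lintegral_congr fun x => ?_
    rw [← ENNReal.ofReal_mul (hf.nonneg x), gaussianDensity_sub, tiltExponent]
    congr 2
    rw [inner_smul_right, norm_smul, mul_pow, Real.norm_eq_abs, sq_abs, real_inner_comm, mul_comm]
  · have : Continuous (tiltExponent r w) := by unfold tiltExponent; fun_prop
    fun_prop
  · exact (integrable_exp_tiltExponent r w).mul_const _
  · exact .of_forall fun x => by have := gaussianDensity_pos w; positivity

/-- The density of r X + G is the marginal in `x` of the jointly log-concave function f(x)γ(w - r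
x), with γ the Gaussian density. The bound on conditional covariances rests on this. -/
lemma LogConcave.partitionFn_mul_gaussianDensity [IsProbabilityMeasure μ] (hlc : LogConcave f)
    (hf : IsDensityOf f μ) (r : ℝ) :
    LogConcave fun w => partitionFn μ r w * gaussianDensity w := by
  have hfm := hf.measurable
  have h0 := hf.nonneg
  have hgm := (continuous_gaussianDensity (E := EuclideanSpace ℝ (Fin d))).measurable
  have key := logConcave_marginal (G := fun w x => f x * gaussianDensity (w - r • x))
    (fun w => by fun_prop) (fun w x => mul_nonneg (h0 x) (gaussianDensity_pos _).le)
    (fun u v x y a b ha hb hab => ?_) (fun w => ?_)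
  · refine (congrArg LogConcave (funext fun w => ?_)).mp key
    rw [← ofReal_partitionFn_mul_gaussianDensity hf, ENNReal.toReal_ofReal]
    exact mul_nonneg (partitionFn_pos _ _).le (gaussianDensity_pos _).le
  · have h1 := hlc x y a b ha hb hab
    have h2 := logConcave_gaussianDensity (u - r • x) (v - r • y) a b ha hb hab
    have e : a • u + b • v - r • (a • x + b • y) = a • (u - r • x) + b • (v - r • y) := by module
    rw [e, Real.mul_rpow (h0 _) (gaussianDensity_pos _).le,
      Real.mul_rpow (h0 _) (gaussianDensity_pos _).le, mul_mul_mul_comm]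
    exact mul_le_mul h1 h2 (mul_nonneg (Real.rpow_nonneg (gaussianDensity_pos _).le _)
      (Real.rpow_nonneg (gaussianDensity_pos _).le _)) (h0 _)
  · rw [← ofReal_partitionFn_mul_gaussianDensity hf]
    exact ENNReal.ofReal_ne_top

end LogConcaveMarginals

/-! ### Entropy of log-concave laws and the isotropic constant. -/

section EntropyBounds

variable {d : ℕ} {μ : Measure (EuclideanSpace ℝ (Fin d))} {f : EuclideanSpace ℝ (Fin d) → ℝ}
  [IsProbabilityMeasure μ]

lemma IsDensityOf.lintegral_comp_smul (hf : IsDensityOf f μ) {c : ℝ} (hc : 0 < c) :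
    ∫⁻ x, ENNReal.ofReal (c ^ d * f (c • x)) = 1 := by
  have hfm := hf.measurable
  have h := lintegral_eq_lintegral_smul_sub (g := fun x => ENNReal.ofReal (f x))
    (by fun_prop) hc 0
  rw [hf.lintegral_eq_one] at h
  simp_rw [ENNReal.ofReal_mul (pow_nonneg hc.le d)]
  rw [lintegral_const_mul _ (by fun_prop)]
  simpa using h.symm

/-- Gibbs' inequality with a test function interpolating geometrically between `f` and f(0):
log-concavity bounds it by the rescaled density l^d f(l x), of mass one. Dividing by 1 - l and
letting l tend to 1 gives the constant `d`. -/
lemma LogConcave.log_le_integral_log (hlc : LogConcave f) (hf : IsDensityOf f μ)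
    (hi : Integrable (fun x => Real.log (f x)) μ) (h0 : 0 < f 0) :
    Real.log (f 0) ≤ ∫ x, Real.log (f x) ∂μ + d := by
  have hfm := hf.measurable
  have key : ∀ l : ℝ, 0 < l → l < 1 →
      Real.log (f 0) ≤ ∫ x, Real.log (f x) ∂μ + d * l⁻¹ := by
    intro l hl hl1
    have hlog : ∀ x, 0 < f x → Real.log (l ^ d * (f x ^ l * f 0 ^ (1 - l))) =
        (d * Real.log l + (1 - l) * Real.log (f 0)) + l * Real.log (f x) := by
      intro x hx
      rw [Real.log_mul (by positivity) (by positivity), Real.log_mul (by positivity)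
        (by positivity), Real.log_rpow hx, Real.log_rpow h0, Real.log_pow]
      ring
    have hae : (fun x => Real.log (l ^ d * (f x ^ l * f 0 ^ (1 - l)))) =ᵐ[μ] fun x =>
        (d * Real.log l + (1 - l) * Real.log (f 0)) + l * Real.log (f x) := by
      filter_upwards [hf.ae_pos] with x hx using hlog x hx
    have hint : Integrable (fun x =>
        (d * Real.log l + (1 - l) * Real.log (f 0)) + l * Real.log (f x)) μ :=
      (integrable_const _).add (hi.const_mul l)
    have h := hf.integral_log_le hi (h := fun x => l ^ d * (f x ^ l * f 0 ^ (1 - l)))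
      (by fun_prop) ?_ ?_ (hint.congr hae.symm)
    · rw [integral_congr_ae hae, integral_add (integrable_const _) (hi.const_mul l),
        integral_const_mul, integral_const] at h
      simp only [probReal_univ, one_smul] at h
      -- This elementary bound produces a factor 1 - l, which can then be cancelled.
      have h1 : -Real.log l ≤ l⁻¹ - 1 := by
        rw [← Real.log_inv]; exact Real.log_le_sub_one_of_pos (by positivity)
      have h2 : (d : ℝ) * -Real.log l ≤ d * (l⁻¹ - 1) := by gcongr
      have h3 : l⁻¹ - 1 = (1 - l) * l⁻¹ := by field_simp
      have h4 : (1 - l) * Real.log (f 0) ≤ (1 - l) * (∫ x, Real.log (f x) ∂μ + d * l⁻¹) := by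
        rw [h3] at h2; linarith
      exact le_of_mul_le_mul_left h4 (by linarith)
    · calc _ ≤ ∫⁻ x, ENNReal.ofReal (l ^ d * f (l • x)) := by
            refine lintegral_mono fun x => ENNReal.ofReal_le_ofReal ?_
            have := hlc x 0 l (1 - l) hl.le (by linarith) (by ring)
            rw [smul_zero, add_zero] at this
            gcongr
        _ ≤ 1 := (hf.lintegral_comp_smul hl).le
    · filter_upwards [hf.ae_pos] with x hx
      positivity
  have hlim : Filter.Tendsto (fun l : ℝ => ∫ x, Real.log (f x) ∂μ + d * l⁻¹)
      (nhdsWithin 1 (Set.Iio 1)) (nhds (∫ x, Real.log (f x) ∂μ + d * (1:ℝ)⁻¹)) := by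
    have : ContinuousAt (fun l : ℝ => ∫ x, Real.log (f x) ∂μ + d * l⁻¹) 1 := by
      fun_prop (disch := norm_num)
    exact this.tendsto.mono_left nhdsWithin_le_nhds
  rw [inv_one, mul_one] at hlim
  refine ge_of_tendsto hlim ?_
  filter_upwards [Ioo_mem_nhdsLT (zero_lt_one (α := ℝ))] with l hl using key l hl.1 hl.2

/-- Gibbs' inequality for (X + Y)/√2 against the density of √2 X. At (x + y)/√2 the test density
evaluates `f` at the midpoint of `x` and `y`, where log-concavity gives the average of the two
logarithms; the scaling costs (d/2) log 2. -/
lemma LogConcave.integral_log_selfConvolution_ge (hlc : LogConcave f) (hf : IsDensityOf f μ)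
    {M : ℝ} (hM : ∀ x, f x ≤ M) (hi : Integrable (fun x => Real.log (f x)) μ)
    (hi' : Integrable (fun x => Real.log (_root_.selfConvolutionDensity f x)) (_root_.selfConvolution μ)) :
    ∫ x, Real.log (f x) ∂μ - d / 2 * Real.log 2 ≤
      ∫ x, Real.log (_root_.selfConvolutionDensity f x) ∂(_root_.selfConvolution μ) := by
  have hfm := hf.measurable
  have hs : (0:ℝ) < √2 := by positivity
  have e2 : (√2 : ℝ)⁻¹ * (√2 : ℝ)⁻¹ = 1 / 2 := by
    rw [← mul_inv, Real.mul_self_sqrt (by norm_num)]; norm_num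
  set h : EuclideanSpace ℝ (Fin d) → ℝ := fun u => (√2)⁻¹ ^ d * f ((√2 : ℝ)⁻¹ • u) with hh
  have hm : Measurable h := by fun_prop
  have hmid : ∀ p : EuclideanSpace ℝ (Fin d) × EuclideanSpace ℝ (Fin d),
      h ((√2 : ℝ)⁻¹ • (p.1 + p.2)) = (√2)⁻¹ ^ d * f ((1/2 : ℝ) • p.1 + (1/2 : ℝ) • p.2) := by
    intro p
    simp only [hh, smul_smul, e2, smul_add]
  have hp1 : ∀ᵐ p ∂(μ.prod μ), 0 < f p.1 :=
    Measure.quasiMeasurePreserving_fst.ae hf.ae_pos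
  have hp2 : ∀ᵐ p ∂(μ.prod μ), 0 < f p.2 :=
    Measure.quasiMeasurePreserving_snd.ae hf.ae_pos
  have hlog : ∀ p : EuclideanSpace ℝ (Fin d) × EuclideanSpace ℝ (Fin d), 0 < f p.1 → 0 < f p.2 →
      0 < f ((1/2 : ℝ) • p.1 + (1/2 : ℝ) • p.2) ∧
      Real.log (h ((√2 : ℝ)⁻¹ • (p.1 + p.2))) = Real.log (f ((1/2 : ℝ) • p.1 + (1/2 : ℝ) • p.2)) -
        d / 2 * Real.log 2 ∧ (1 / 2) * (Real.log (f p.1) + Real.log (f p.2)) ≤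
          Real.log (f ((1/2 : ℝ) • p.1 + (1/2 : ℝ) • p.2)) := by
    intro p h1 h2
    have h3 := hlc.concaveOn_log.2 h1 h2 (by norm_num : (0:ℝ) ≤ 1/2) (by norm_num : (0:ℝ) ≤ 1/2)
      (by norm_num)
    have h4 : 0 < f ((1/2 : ℝ) • p.1 + (1/2 : ℝ) • p.2) := hlc.convex_support h1 h2
      (by norm_num : (0:ℝ) ≤ 1/2) (by norm_num : (0:ℝ) ≤ 1/2) (by norm_num)
    refine ⟨h4, ?_, ?_⟩
    · rw [hmid, Real.log_mul (by positivity) h4.ne', Real.log_pow, Real.log_inv,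
        Real.log_sqrt (by norm_num)]
      ring
    · simp only [smul_eq_mul] at h3
      linarith
  have hpos : ∀ᵐ u ∂(selfConvolution μ), 0 < h u := by
    rw [selfConvolution, ae_map_iff (by fun_prop) (measurableSet_lt measurable_const hm)]
    filter_upwards [hp1, hp2] with p h1 h2
    rw [hmid]
    have := (hlog p h1 h2).1
    positivity
  have j1 := hi.comp_fst μ
  have j2 := hi.comp_snd μ
  have j3 : Integrable (fun p : EuclideanSpace ℝ (Fin d) × EuclideanSpace ℝ (Fin d) =>
      (1 / 2) * (Real.log (f p.1) + Real.log (f p.2)) - d / 2 * Real.log 2) (μ.prod μ) :=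
    ((j1.add j2).const_mul (1/2)).sub (integrable_const _)
  have j4 : Integrable (fun p : EuclideanSpace ℝ (Fin d) × EuclideanSpace ℝ (Fin d) =>
      (1 / 2) * (Real.log (f p.1) + Real.log (f p.2))) (μ.prod μ) := (j1.add j2).const_mul (1/2)
  have hb : Integrable (fun p : EuclideanSpace ℝ (Fin d) × EuclideanSpace ℝ (Fin d) =>
      Real.log (h ((√2 : ℝ)⁻¹ • (p.1 + p.2)))) (μ.prod μ) := by
    refine (j3.norm.add (integrable_const |Real.log M - d / 2 * Real.log 2|)).mono'
      (Measurable.aestronglyMeasurable (by fun_prop)) ?_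
    filter_upwards [hp1, hp2] with p h1 h2
    obtain ⟨a1, a2, a3⟩ := hlog p h1 h2
    have a4 := Real.log_le_log a1 (hM _)
    simp only [Pi.add_apply]
    rw [a2, Real.norm_eq_abs, Real.norm_eq_abs, abs_le]
    have b1 := neg_abs_le ((1 / 2) * (Real.log (f p.1) + Real.log (f p.2)) - d / 2 * Real.log 2)
    have b2 := le_abs_self (Real.log M - d / 2 * Real.log 2)
    have b3 := abs_nonneg ((1 / 2) * (Real.log (f p.1) + Real.log (f p.2)) - d / 2 * Real.log 2)
    have b4 := abs_nonneg (Real.log M - d / 2 * Real.log 2)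
    constructor <;> linarith
  have hhi : Integrable (fun u => Real.log (h u)) (selfConvolution μ) := by
    rw [integrable_selfConvolution_iff μ (F := fun u => Real.log (h u)) (by fun_prop)]
    exact hb
  refine le_trans ?_ ((hf.selfConvolution hM).integral_log_le hi' hm
    (hf.lintegral_comp_smul (inv_pos.2 hs)).le hpos hhi)
  rw [integral_selfConvolution μ (F := fun u => Real.log (h u)) (by fun_prop)]
  calc _ = ∫ p : EuclideanSpace ℝ (Fin d) × EuclideanSpace ℝ (Fin d),
      ((1 / 2) * (Real.log (f p.1) + Real.log (f p.2)) - d / 2 * Real.log 2) ∂(μ.prod μ) := by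
        rw [integral_sub j4 (integrable_const _), integral_const_mul,
          integral_add j1 j2, integral_prod _ j1, integral_prod _ j2]
        simp
        ring
    _ ≤ _ := by
      refine integral_mono_ae j3 hb ?_
      filter_upwards [hp1, hp2] with p h1 h2
      obtain ⟨-, a2, a3⟩ := hlog p h1 h2
      rw [a2]
      linarith

lemma IsIsotropicLogConcave.integrable_log (h : IsIsotropicLogConcave μ f) : Integrable (fun x => Real.log (f x)) μ := by
  obtain ⟨M, -, hM⟩ := h.logConcave.exists_le h.isDensityOf
  exact h.isDensityOf.integrable_log hM h.isIsotropic.integrable_norm_sq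

lemma IsIsotropicLogConcave.selfConvolution (h : IsIsotropicLogConcave μ f) :
    IsIsotropicLogConcave (selfConvolution μ) (selfConvolutionDensity f) := by
  obtain ⟨M, -, hM⟩ := h.logConcave.exists_le h.isDensityOf
  exact ⟨h.isDensityOf.selfConvolution hM, h.logConcave.selfConvolutionDensity h.isDensityOf hM,
    h.isIsotropic.selfConvolution⟩

lemma IsIsotropicLogConcave.hasFiniteEntropy (h : IsIsotropicLogConcave μ f) : HasFiniteEntropy μ :=
  h.isDensityOf.hasFiniteEntropy_iff.2 h.integrable_log

lemma IsIsotropicLogConcave.entropy_le (h : IsIsotropicLogConcave μ f) (h0 : 0 < f 0) : entropy μ ≤ d - Real.log (f 0) := by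
  rw [h.isDensityOf.entropy_eq]
  linarith [h.logConcave.log_le_integral_log h.isDensityOf h.integrable_log h0]

lemma IsIsotropicLogConcave.entropy_selfConvolution_le (h : IsIsotropicLogConcave μ f) :
    entropy (_root_.selfConvolution μ) ≤ entropy μ + d / 2 * Real.log 2 := by
  obtain ⟨M, -, hM⟩ := h.logConcave.exists_le h.isDensityOf
  rw [h.isDensityOf.entropy_eq, h.selfConvolution.isDensityOf.entropy_eq]
  linarith [h.logConcave.integral_log_selfConvolution_ge h.isDensityOf hM h.integrable_log
    h.selfConvolution.integrable_log]

/-- The jump is at most (d/2) log 2, while Ent(G) ≥ d and Ent(X) ≤ d - log f(0) make the Gaussian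
gap at least log f(0). The exponent (log 2)/(2κ) would already do. -/
theorem IsIsotropicLogConcave.isotropicConstant_le (h : IsIsotropicLogConcave μ f) (hd : 1 ≤ d) {κ : ℝ} (hκ : 0 < κ)
    (hjump : κ * (entropy (stdGaussian (EuclideanSpace ℝ (Fin d))) - entropy μ) ≤
      entropy (_root_.selfConvolution μ) - entropy μ) :
    isotropicConstant f ≤ Real.exp (2 / κ) := by
  have hd0 : (0 : ℝ) < d := by exact_mod_cast hd
  rcases (h.isDensityOf.nonneg 0).eq_or_lt with h0 | h0
  · rw [isotropicConstant, ← h0, Real.zero_rpow (by positivity)]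
    positivity
  have h1 := h.entropy_le h0
  have h2 := h.entropy_selfConvolution_le
  rw [entropy_stdGaussian] at hjump
  -- This is what yields Ent(G) ≥ d.
  have h3 : 1 ≤ Real.log (2 * Real.pi) := by
    rw [Real.le_log_iff_exp_le (by positivity)]
    linarith [Real.exp_one_lt_d9, Real.pi_gt_three]
  have h4 : Real.log 2 ≤ 1 := by linarith [Real.log_two_lt_d9]
  have h5 : κ * Real.log (f 0) ≤ 2 * d := by
    have e1 : κ * (d / 2 * Real.log (2 * Real.pi) + d / 2 - entropy μ) ≥ κ * Real.log (f 0) := by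
      gcongr
      nlinarith
    nlinarith
  rw [isotropicConstant, Real.rpow_def_of_pos h0, Real.exp_le_exp, mul_one_div,
    div_le_div_iff₀ hd0 hκ]
  linarith

end EntropyBounds

/-! ### Conditional mean and covariance given the output of the channel. -/

section ConditionalCovariance

variable {d : ℕ}

/-- The coordinates of the conditional expectation of `X`, of law `μ`, given `r X + G = w`. -/
noncomputable def condMean (μ : Measure (EuclideanSpace ℝ (Fin d))) (r : ℝ) (i : Fin d)
    (w : EuclideanSpace ℝ (Fin d)) : ℝ :=
  postMean μ r (fun x => x i) w

/-- The entries of the conditional covariance matrix of `X`, of law `μ`, given `r X + G = w`. -/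
noncomputable def condCov (μ : Measure (EuclideanSpace ℝ (Fin d))) (r : ℝ) (i j : Fin d)
    (w : EuclideanSpace ℝ (Fin d)) : ℝ :=
  postMean μ r (fun x => x i * x j) w - condMean μ r i w * condMean μ r j w

variable {μ : Measure (EuclideanSpace ℝ (Fin d))} [IsProbabilityMeasure μ] {r : ℝ}

lemma condCov_eq (h2 : Integrable (fun x => ‖x‖ ^ 2) μ) (i j : Fin d)
    (w : EuclideanSpace ℝ (Fin d)) :
    condCov μ r i j w = ∫ x, (x i - condMean μ r i w) * (x j - condMean μ r j w)
      ∂(μ.tilted (tiltExponent r w)) := by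
  have i1 := (integrable_coord h2 i).posterior r w
  have i2 := (integrable_coord h2 j).posterior r w
  have i3 := (integrable_coord_mul_coord h2 i j).posterior r w
  have e : ∀ x : EuclideanSpace ℝ (Fin d),
      (x i - condMean μ r i w) * (x j - condMean μ r j w) = x i * x j -
        ((condMean μ r j w * x i + condMean μ r i w * x j) -
          condMean μ r i w * condMean μ r j w) := fun x => by ring
  simp_rw [e]
  have i4 : Integrable (fun x : EuclideanSpace ℝ (Fin d) => condMean μ r j w * x i +
      condMean μ r i w * x j) (μ.tilted (tiltExponent r w)) :=
    (i1.const_mul _).add (i2.const_mul _)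
  have i5 : Integrable (fun x : EuclideanSpace ℝ (Fin d) => (condMean μ r j w * x i +
      condMean μ r i w * x j) - condMean μ r i w * condMean μ r j w)
        (μ.tilted (tiltExponent r w)) := i4.sub (integrable_const _)
  rw [integral_sub i3 i5, integral_sub i4 (integrable_const _),
    integral_add (i1.const_mul _) (i2.const_mul _), integral_const_mul, integral_const_mul]
  simp only [integral_const, probReal_univ, one_smul]
  rw [condCov, condMean, condMean, postMean, postMean, postMean]
  ring

/-- The inequality of means under the posterior law; it reduces bounds on all entries to bounds on
the diagonal. -/
lemma abs_condCov_le_add (h2 : Integrable (fun x => ‖x‖ ^ 2) μ) (i j : Fin d)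
    (w : EuclideanSpace ℝ (Fin d)) :
    |condCov μ r i j w| ≤ (condCov μ r i i w + condCov μ r j j w) / 2 := by
  rw [condCov_eq h2, condCov_eq h2, condCov_eq h2]
  have key : ∀ k : Fin d, Integrable (fun x : EuclideanSpace ℝ (Fin d) =>
      (x k - condMean μ r k w) * (x k - condMean μ r k w)) (μ.tilted (tiltExponent r w)) := by
    intro k
    have e : ∀ x : EuclideanSpace ℝ (Fin d),
        (x k - condMean μ r k w) * (x k - condMean μ r k w) = x k * x k +
          ((-2 * condMean μ r k w) * x k + condMean μ r k w * condMean μ r k w) :=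
      fun x => by ring
    simp_rw [e]
    exact ((integrable_coord_mul_coord h2 k k).posterior r w).add
      ((((integrable_coord h2 k).posterior r w).const_mul _).add (integrable_const _))
  rw [← integral_add (key i) (key j), ← integral_div]
  refine abs_integral_le_integral_abs.trans (integral_mono_of_nonneg
    (.of_forall fun x => abs_nonneg _) (((key i).add (key j)).div_const 2)
    (.of_forall fun x => ?_))
  simp only
  rw [abs_le]
  constructor <;>
  nlinarith [sq_nonneg ((x i - condMean μ r i w) + (x j - condMean μ r j w)),
    sq_nonneg ((x i - condMean μ r i w) - (x j - condMean μ r j w))]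

lemma inner_eq_sum_coord (x v : EuclideanSpace ℝ (Fin d)) : inner ℝ x v = ∑ i, v i * x i := by
  rw [PiLp.inner_apply]; rfl

lemma fderiv_condMean_apply (h2 : Integrable (fun x => ‖x‖ ^ 2) μ) (hr : 0 < r) (i : Fin d)
    (w v : EuclideanSpace ℝ (Fin d)) :
    fderiv ℝ (condMean μ r i) w v = r * ∑ j, condCov μ r i j w * v j := by
  have h := fderiv_postMean_apply hr (integrable_coord h2 i) w v
  have e1 : postMean μ r (fun x => inner ℝ x v) w = ∑ j, v j * condMean μ r j w := by
    simp_rw [postMean, inner_eq_sum_coord]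
    rw [integral_finsetSum _ fun j _ =>
      ((integrable_coord h2 j).posterior r w).const_mul _]
    simp_rw [integral_const_mul]
    rfl
  have e2 : postMean μ r (fun x => x i * inner ℝ x v) w =
      ∑ j, v j * postMean μ r (fun x => x i * x j) w := by
    simp_rw [postMean, inner_eq_sum_coord, Finset.mul_sum]
    rw [integral_finsetSum]
    · refine Finset.sum_congr rfl fun j _ => ?_
      rw [← integral_const_mul]
      exact integral_congr_ae (.of_forall fun x => by simp only; ring)
    · intro j _
      have := ((integrable_coord_mul_coord h2 i j).posterior r w).const_mul (v j)
      exact this.congr (.of_forall fun x => by simp only; ring)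
  change fderiv ℝ (postMean μ r fun x => x i) w v = _
  rw [h, e1, e2, Finset.mul_sum, ← Finset.sum_sub_distrib]
  congr 1
  refine Finset.sum_congr rfl fun j _ => ?_
  rw [condCov, condMean, condMean]
  ring

lemma fderiv_log_partitionFn_apply' (h2 : Integrable (fun x => ‖x‖ ^ 2) μ) (hr : 0 < r)
    (w v : EuclideanSpace ℝ (Fin d)) :
    fderiv ℝ (fun w => Real.log (partitionFn μ r w)) w v = r * ∑ j, v j * condMean μ r j w := by
  rw [fderiv_log_partitionFn_apply hr]
  simp_rw [postMean, inner_eq_sum_coord]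
  rw [integral_finsetSum _ fun j _ => ((integrable_coord h2 j).posterior r w).const_mul _]
  simp_rw [integral_const_mul]
  rfl

lemma continuous_condMean (h2 : Integrable (fun x => ‖x‖ ^ 2) μ) (i : Fin d) :
    Continuous fun p : ℝ × EuclideanSpace ℝ (Fin d) => condMean μ p.1 i p.2 :=
  continuous_postMean (integrable_coord h2 i)

lemma continuous_condCov (h2 : Integrable (fun x => ‖x‖ ^ 2) μ) (i j : Fin d) :
    Continuous fun p : ℝ × EuclideanSpace ℝ (Fin d) => condCov μ p.1 i j p.2 :=
  (continuous_postMean (integrable_coord_mul_coord h2 i j)).sub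
    ((continuous_condMean h2 i).mul (continuous_condMean h2 j))

lemma contDiff_condMean (h2 : Integrable (fun x => ‖x‖ ^ 2) μ) (hr : 0 < r) (i : Fin d) :
    ContDiff ℝ ∞ (condMean μ r i) := contDiff_postMean hr (integrable_coord h2 i)

lemma condMean_sq_le (h2 : Integrable (fun x => ‖x‖ ^ 2) μ) (h0 : ∀ v, ∫ x, inner ℝ x v ∂μ = 0)
    (hr : 0 < r) (i : Fin d) (w : EuclideanSpace ℝ (Fin d)) :
    condMean μ r i w ^ 2 ≤ 4 * ‖w‖ ^ 2 / r ^ 2 + 2 * ∫ x, ‖x‖ ^ 2 ∂μ := by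
  have hi : Integrable (fun x : EuclideanSpace ℝ (Fin d) => x i ^ 2) μ := by
    simp_rw [sq]; exact integrable_coord_mul_coord h2 i i
  refine (postMean_sq_le (integrable_coord h2 i) hi r w).trans
    (le_trans ?_ (postMean_norm_sq_le hr h2 h0 w))
  refine integral_mono (hi.posterior r w) (h2.posterior r w) fun x => ?_
  simp only
  rw [EuclideanSpace.real_norm_sq_eq]
  exact Finset.single_le_sum (f := fun i => x i ^ 2) (fun j _ => sq_nonneg _) (Finset.mem_univ i)

/-- The derivative of `log p_r` along a line, where `p_r` is the density of `r X + G`. -/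
lemma hasDerivAt_log_obsDensity (h2 : Integrable (fun x => ‖x‖ ^ 2) μ) (hr : 0 < r)
    (w v : EuclideanSpace ℝ (Fin d)) (s : ℝ) :
    HasDerivAt (fun s : ℝ => Real.log (partitionFn μ r (w + s • v) * gaussianDensity (w + s • v)))
      (r * ∑ j, v j * condMean μ r j (w + s • v) - inner ℝ w v - s * ‖v‖ ^ 2) s := by
  have hl : HasDerivAt (fun s : ℝ => w + s • v) v s := by
    simpa using ((hasDerivAt_id s).smul_const v).const_add w
  have h1 : HasDerivAt (fun s : ℝ => Real.log (partitionFn μ r (w + s • v)))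
      (r * ∑ j, v j * condMean μ r j (w + s • v)) s := by
    rw [← fderiv_log_partitionFn_apply' h2 hr]
    have : DifferentiableAt ℝ (fun w => Real.log (partitionFn μ r w)) (w + s • v) :=
      ((contDiff_partitionFn hr).differentiable (by simp) _).log (partitionFn_pos _ _).ne'
    exact this.hasFDerivAt.comp_hasDerivAt s hl
  have e : ∀ s : ℝ, Real.log (partitionFn μ r (w + s • v) * gaussianDensity (w + s • v)) =
      Real.log (partitionFn μ r (w + s • v)) + (-(d / 2 * Real.log (2 * Real.pi)) -
        (‖w‖ ^ 2 + 2 * (s * inner ℝ w v) + s ^ 2 * ‖v‖ ^ 2) / 2) := by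
    intro s
    rw [Real.log_mul (partitionFn_pos _ _).ne' (gaussianDensity_pos _).ne', log_gaussianDensity,
      norm_add_sq_real, inner_smul_right, norm_smul, mul_pow, Real.norm_eq_abs, sq_abs]
  simp_rw [e]
  have h3 : HasDerivAt (fun s : ℝ => -(d / 2 * Real.log (2 * Real.pi)) -
        (‖w‖ ^ 2 + 2 * (s * inner ℝ w v) + s ^ 2 * ‖v‖ ^ 2) / 2)
      (-((2 * (1 * inner ℝ w v) + (2 * s) * ‖v‖ ^ 2) / 2)) s := by
    refine (((((hasDerivAt_id s).mul_const (inner ℝ w v)).const_mul 2).const_add (‖w‖ ^ 2)).add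
      ((hasDerivAt_pow 2 s).mul_const (‖v‖ ^ 2))).div_const 2 |>.const_sub _ |>.congr_deriv ?_
    simp
  refine (h1.add h3).congr_deriv ?_
  ring

variable {f : EuclideanSpace ℝ (Fin d) → ℝ}

/-- Along any line through `w` the logarithm of the output density is concave, and its second
derivative at `w` is the quadratic form of r²C - I. -/
lemma IsIsotropicLogConcave.sum_condCov_le (h : IsIsotropicLogConcave μ f) (hr : 0 < r)
    (w v : EuclideanSpace ℝ (Fin d)) :
    r ^ 2 * ∑ i, ∑ j, condCov μ r i j w * v i * v j ≤ ‖v‖ ^ 2 := by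
  have h2 := h.isIsotropic.integrable_norm_sq
  have hd := hasDerivAt_log_obsDensity h2 hr w v
  have hlc := h.logConcave.partitionFn_mul_gaussianDensity h.isDensityOf r
  have hconc : ConcaveOn ℝ Set.univ (fun s : ℝ =>
      Real.log (partitionFn μ r (w + s • v) * gaussianDensity (w + s • v))) := by
    refine ⟨convex_univ, fun s _ s' _ a b ha hb hab => ?_⟩
    have hp : ∀ u, u ∈ {x | 0 < partitionFn μ r x * gaussianDensity x} := fun u =>
      mul_pos (partitionFn_pos _ _) (gaussianDensity_pos _)
    have := hlc.concaveOn_log.2 (hp (w + s • v)) (hp (w + s' • v)) ha hb hab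
    have e : a • (w + s • v) + b • (w + s' • v) = w + (a • s + b • s') • v := by
      obtain rfl : b = 1 - a := by linarith
      simp only [smul_eq_mul]
      module
    rwa [e] at this
  -- The first derivative along the line is explicit and antitone; differentiating it once more at 0
  -- gives the sign.
  have hanti := hconc.antitoneOn_deriv fun x _ => (hd x).differentiableAt
  have hd' : deriv (fun s : ℝ =>
      Real.log (partitionFn μ r (w + s • v) * gaussianDensity (w + s • v))) = fun s =>
      r * ∑ j, v j * condMean μ r j (w + s • v) - inner ℝ w v - s * ‖v‖ ^ 2 :=
    funext fun s => (hd s).deriv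
  rw [hd', antitoneOn_univ] at hanti
  have hl : HasDerivAt (fun s : ℝ => w + s • v) v 0 := by
    simpa using ((hasDerivAt_id (0:ℝ)).smul_const v).const_add w
  have h4 : HasDerivAt (fun s : ℝ =>
      r * ∑ j, v j * condMean μ r j (w + s • v) - inner ℝ w v - s * ‖v‖ ^ 2)
      (r * ∑ i, v i * (r * ∑ j, condCov μ r i j w * v j) - ‖v‖ ^ 2) 0 := by
    have h5 : ∀ i, HasDerivAt (fun s : ℝ => v i * condMean μ r i (w + s • v))
        (v i * (r * ∑ j, condCov μ r i j w * v j)) 0 := by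
      intro i
      rw [← fderiv_condMean_apply h2 hr]
      have : DifferentiableAt ℝ (condMean μ r i) (w + (0:ℝ) • v) :=
        (contDiff_condMean h2 hr i).differentiable (by simp) _
      have h6 := (this.hasFDerivAt.comp_hasDerivAt (0:ℝ) hl).const_mul (v i)
      simpa using h6
    have h6 := (((HasDerivAt.fun_sum fun i (_ : i ∈ Finset.univ) => h5 i).const_mul r).sub_const
      (inner ℝ w v)).fun_sub ((hasDerivAt_id (0:ℝ)).mul_const (‖v‖ ^ 2))
    exact h6.congr_deriv (by simp)
  have h7 := hanti.deriv_nonpos (x := 0)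
  rw [h4.deriv] at h7
  have e : r * ∑ i, v i * (r * ∑ j, condCov μ r i j w * v j) =
      r ^ 2 * ∑ i, ∑ j, condCov μ r i j w * v i * v j := by
    simp_rw [Finset.mul_sum]
    exact Finset.sum_congr rfl fun i _ => Finset.sum_congr rfl fun j _ => by ring
  linarith

lemma IsIsotropicLogConcave.abs_condCov_le (h : IsIsotropicLogConcave μ f) (hr : 0 < r)
    (i j : Fin d) (w : EuclideanSpace ℝ (Fin d)) : |condCov μ r i j w| ≤ 1 / r ^ 2 := by
  have key : ∀ k, condCov μ r k k w ≤ 1 / r ^ 2 := by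
    intro k
    have := h.sum_condCov_le hr w (EuclideanSpace.single k 1)
    simp at this
    rw [le_div_iff₀ (by positivity)]
    linarith
  have := abs_condCov_le_add h.isIsotropic.integrable_norm_sq (r := r) i j w
  linarith [key i, key j]

end ConditionalCovariance

/-! ### Moments along the channel and the tower property. -/

section GaussianChannel

variable {d : ℕ}

/-- The output `r X + G` of the Gaussian channel. -/
noncomputable def obs (r : ℝ) (p : EuclideanSpace ℝ (Fin d) × EuclideanSpace ℝ (Fin d)) :
    EuclideanSpace ℝ (Fin d) := r • p.1 + p.2

/-- The joint law of the input `X`, of law `μ`, and the noise `G`. -/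
noncomputable abbrev channelLaw (μ : Measure (EuclideanSpace ℝ (Fin d))) :
    Measure (EuclideanSpace ℝ (Fin d) × EuclideanSpace ℝ (Fin d)) :=
  μ.prod (stdGaussian (EuclideanSpace ℝ (Fin d)))

@[fun_prop]
lemma continuous_obs (r : ℝ) : Continuous (obs (d := d) r) := by unfold obs; fun_prop

@[fun_prop]
lemma measurable_obs (r : ℝ) : Measurable (obs (d := d) r) := (continuous_obs r).measurable

variable {μ : Measure (EuclideanSpace ℝ (Fin d))} [IsProbabilityMeasure μ] {r : ℝ}
  {f : EuclideanSpace ℝ (Fin d) → ℝ}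

lemma norm_obs_sq_le (r : ℝ) (p : EuclideanSpace ℝ (Fin d) × EuclideanSpace ℝ (Fin d)) :
    ‖obs r p‖ ^ 2 ≤ 2 * r ^ 2 * ‖p.1‖ ^ 2 + 2 * ‖p.2‖ ^ 2 := by
  have := norm_add_le (r • p.1) p.2
  rw [norm_smul] at this
  rw [← sq_abs r, ← Real.norm_eq_abs]
  change ‖r • p.1 + p.2‖ ^ 2 ≤ _
  nlinarith [sq_nonneg (‖r‖ * ‖p.1‖ - ‖p.2‖), norm_nonneg (r • p.1 + p.2)]

lemma measurable_condMean (h2 : Integrable (fun x => ‖x‖ ^ 2) μ) (i : Fin d) :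
    Measurable (condMean μ r i) :=
  ((continuous_condMean h2 i).comp (Continuous.prodMk_right r)).measurable

lemma measurable_condCov (h2 : Integrable (fun x => ‖x‖ ^ 2) μ) (i j : Fin d) :
    Measurable (condCov μ r i j) :=
  ((continuous_condCov h2 i j).comp (Continuous.prodMk_right r)).measurable

lemma integrable_norm_sq_fst (h2 : Integrable (fun x => ‖x‖ ^ 2) μ) :
    Integrable (fun p => ‖p.1‖ ^ 2) (channelLaw μ) := h2.comp_fst _

lemma integrable_norm_sq_snd : Integrable (fun p => ‖p.2‖ ^ 2) (channelLaw μ) :=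
  integrable_norm_sq_stdGaussian.comp_snd _

lemma MeasureTheory.MemLp.integrable_fun_mul {Ω : Type*} [MeasurableSpace Ω] {P : Measure Ω}
    {F g : Ω → ℝ} (hF : MemLp F 2 P) (hg : MemLp g 2 P) : Integrable (fun p => F p * g p) P :=
  hF.integrable_mul hg

lemma memLp_two_of_sq_le {Ω : Type*} [MeasurableSpace Ω] {P : Measure Ω} {F g : Ω → ℝ}
    (hF : AEStronglyMeasurable F P) (hg : Integrable g P) (hle : ∀ p, F p ^ 2 ≤ g p) :
    MemLp F 2 P := by
  rw [memLp_two_iff_integrable_sq hF]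
  exact hg.mono' (hF.pow 2) (.of_forall fun p => by
    rw [Real.norm_of_nonneg (sq_nonneg _)]; exact hle p)

lemma coord_sq_le (x : EuclideanSpace ℝ (Fin d)) (i : Fin d) : x i ^ 2 ≤ ‖x‖ ^ 2 := by
  rw [EuclideanSpace.real_norm_sq_eq]
  exact Finset.single_le_sum (f := fun i => x i ^ 2) (fun j _ => sq_nonneg _) (Finset.mem_univ i)

lemma memLp_fst_coord (h2 : Integrable (fun x => ‖x‖ ^ 2) μ) (i : Fin d) :
    MemLp (fun p : EuclideanSpace ℝ (Fin d) × EuclideanSpace ℝ (Fin d) => p.1 i) 2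
      (channelLaw μ) :=
  memLp_two_of_sq_le (by fun_prop) (integrable_norm_sq_fst h2) fun p => coord_sq_le _ _

lemma memLp_snd_coord (i : Fin d) :
    MemLp (fun p : EuclideanSpace ℝ (Fin d) × EuclideanSpace ℝ (Fin d) => p.2 i) 2
      (channelLaw μ) :=
  memLp_two_of_sq_le (by fun_prop) integrable_norm_sq_snd fun p => coord_sq_le _ _

lemma memLp_obs_coord (h2 : Integrable (fun x => ‖x‖ ^ 2) μ) (r : ℝ) (i : Fin d) :
    MemLp (fun p => obs r p i) 2 (channelLaw μ) :=
  ((memLp_fst_coord h2 i).const_mul r).add (memLp_snd_coord i)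

lemma integrable_norm_sq_obs (h2 : Integrable (fun x => ‖x‖ ^ 2) μ) (r : ℝ) :
    Integrable (fun p => ‖obs r p‖ ^ 2) (channelLaw μ) :=
  (((integrable_norm_sq_fst h2).const_mul (2 * r ^ 2)).add
    (integrable_norm_sq_snd.const_mul 2)).mono'
      (Continuous.aestronglyMeasurable (by fun_prop)) (.of_forall fun p => by
        rw [Real.norm_of_nonneg (by positivity)]; exact norm_obs_sq_le r p)

lemma IsIsotropic.condMean_sq_le (h : IsIsotropic μ) (hr : 0 < r) (i : Fin d)
    (w : EuclideanSpace ℝ (Fin d)) : condMean μ r i w ^ 2 ≤ 4 * ‖w‖ ^ 2 / r ^ 2 + 2 * d := by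
  have := _root_.condMean_sq_le h.integrable_norm_sq h.integral_inner hr i w
  rwa [h.integral_norm_sq] at this

/-- Two strengths are kept apart: ρ in the estimator and `r` in the observation. The envelope
argument compares mismatched pairs. -/
lemma IsIsotropic.memLp_condMean (h : IsIsotropic μ) {ρ : ℝ} (hρ : 0 < ρ) (r : ℝ) (i : Fin d) :
    MemLp (fun p => condMean μ ρ i (obs r p)) 2 (channelLaw μ) := by
  have h2 := h.integrable_norm_sq
  have hm := measurable_condMean (r := ρ) h2 i
  refine memLp_two_of_sq_le (g := fun p => 4 / ρ ^ 2 * ‖obs r p‖ ^ 2 + 2 * d)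
    (Measurable.aestronglyMeasurable (by fun_prop))
    (((integrable_norm_sq_obs h2 r).const_mul _).add (integrable_const _)) fun p => ?_
  rw [div_mul_eq_mul_div]
  exact h.condMean_sq_le hρ i _

/-- Conditioning on the output of the channel, for square integrable functions. -/
lemma IsIsotropic.integral_mul_fst (h : IsIsotropic μ) (hr : 0 < r)
    {F : EuclideanSpace ℝ (Fin d) → ℝ} (hF : Measurable F)
    (hF2 : MemLp (fun p => F (obs r p)) 2 (channelLaw μ)) (i : Fin d) :
    ∫ p, F (obs r p) * p.1 i ∂(channelLaw μ) =
      ∫ p, F (obs r p) * condMean μ r i (obs r p) ∂(channelLaw μ) :=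
  integral_mul_postMean (μ := μ) (r := r) (P := fun x => x i) hF (by fun_prop)
    (integrable_coord h.integrable_norm_sq i)
    (hF2.integrable_fun_mul (memLp_fst_coord h.integrable_norm_sq i))
    (hF2.integrable_fun_mul (h.memLp_condMean hr r i))

lemma integrable_mul_of_abs_le {Ω : Type*} [MeasurableSpace Ω] {P : Measure Ω} {F g : Ω → ℝ}
    {B : ℝ} (hg : Integrable g P) (hF : AEStronglyMeasurable F P) (hB : ∀ p, |F p| ≤ B) :
    Integrable (fun p => F p * g p) P :=
  hg.bdd_mul hF (.of_forall hB)

lemma IsIsotropicLogConcave.integrable_condCov (h : IsIsotropicLogConcave μ f) {ρ : ℝ}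
    (hρ : 0 < ρ) (r : ℝ) (i j : Fin d) :
    Integrable (fun p => condCov μ ρ i j (obs r p)) (channelLaw μ) := by
  have hm := measurable_condCov (r := ρ) h.isIsotropic.integrable_norm_sq i j
  refine (integrable_const (1 / ρ ^ 2)).mono' (Measurable.aestronglyMeasurable (by fun_prop))
    (.of_forall fun p => h.abs_condCov_le hρ i j _)

lemma IsIsotropicLogConcave.memLp_condCov (h : IsIsotropicLogConcave μ f) {ρ : ℝ}
    (hρ : 0 < ρ) (r : ℝ) (i j : Fin d) :
    MemLp (fun p => condCov μ ρ i j (obs r p)) 2 (channelLaw μ) := by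
  have hm := measurable_condCov (r := ρ) h.isIsotropic.integrable_norm_sq i j
  refine memLp_two_of_sq_le (g := fun _ => (1 / ρ ^ 2) ^ 2)
    (Measurable.aestronglyMeasurable (by fun_prop)) (integrable_const _) fun p => ?_
  rw [← sq_abs]
  exact pow_le_pow_left₀ (abs_nonneg _) (h.abs_condCov_le hρ i j _) 2

/-- Products of two coordinates are only known to be integrable, hence a bounded test function here
instead of a square integrable one. -/
lemma IsIsotropicLogConcave.integral_mul_fst_mul_fst (h : IsIsotropicLogConcave μ f) (hr : 0 < r)
    {F : EuclideanSpace ℝ (Fin d) → ℝ} (hF : Measurable F) {B : ℝ} (hB : ∀ w, |F w| ≤ B)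
    (i j : Fin d) :
    ∫ p, F (obs r p) * (p.1 i * p.1 j) ∂(channelLaw μ) =
      ∫ p, F (obs r p) * (condCov μ r i j (obs r p) +
        condMean μ r i (obs r p) * condMean μ r j (obs r p)) ∂(channelLaw μ) := by
  have h2 := h.isIsotropic.integrable_norm_sq
  have hm : AEStronglyMeasurable (fun p => F (obs r p)) (channelLaw μ) :=
    Measurable.aestronglyMeasurable (by fun_prop)
  have e : ∀ w, condCov μ r i j w + condMean μ r i w * condMean μ r j w =
      postMean μ r (fun x => x i * x j) w := fun w => by rw [condCov]; ring
  simp_rw [e]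
  refine integral_mul_postMean (μ := μ) (r := r) (P := fun x => x i * x j) hF (by fun_prop)
    (integrable_coord_mul_coord h2 i j)
    (integrable_mul_of_abs_le ((memLp_fst_coord h2 i).integrable_fun_mul (memLp_fst_coord h2 j)) hm
      fun p => hB _)
    (integrable_mul_of_abs_le (((h.integrable_condCov hr r i j).add
      ((h.isIsotropic.memLp_condMean hr r i).integrable_fun_mul
        (h.isIsotropic.memLp_condMean hr r j))).congr (.of_forall fun p => ?_)) hm fun p => hB _)
  simp only [← e]; rfl

/-- The entries of the mean conditional covariance matrix. -/
noncomputable def meanCov (μ : Measure (EuclideanSpace ℝ (Fin d))) (r : ℝ) (i j : Fin d) : ℝ :=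
  ∫ p, condCov μ r i j (obs r p) ∂(channelLaw μ)

/-- The mean squared norm of the conditional expectation. -/
noncomputable def estEnergy (μ : Measure (EuclideanSpace ℝ (Fin d))) (r : ℝ) : ℝ :=
  ∫ p, ∑ i, condMean μ r i (obs r p) ^ 2 ∂(channelLaw μ)

/-- The mean squared Hilbert-Schmidt norm of the conditional covariance matrix. -/
noncomputable def covEnergy (μ : Measure (EuclideanSpace ℝ (Fin d))) (r : ℝ) : ℝ :=
  ∫ p, ∑ i, ∑ j, condCov μ r i j (obs r p) ^ 2 ∂(channelLaw μ)

/-- The mean logarithm of the likelihood ratio between `r X + G` and `G`. -/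
noncomputable def logPartition (μ : Measure (EuclideanSpace ℝ (Fin d))) (r : ℝ) : ℝ :=
  ∫ p, Real.log (partitionFn μ r (obs r p)) ∂(channelLaw μ)

/-- The law of total covariance, with total covariance the identity. -/
lemma IsIsotropicLogConcave.integral_condMean_mul (h : IsIsotropicLogConcave μ f) (hr : 0 < r)
    (i j : Fin d) : ∫ p, condMean μ r i (obs r p) * condMean μ r j (obs r p) ∂(channelLaw μ) =
      (if i = j then 1 else 0) - meanCov μ r i j := by
  have h2 := h.isIsotropic.integrable_norm_sq
  have e := h.integral_mul_fst_mul_fst hr (F := fun _ => 1) measurable_const (B := 1) (by simp) i j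
  simp only [one_mul] at e
  rw [integral_add (h.integrable_condCov hr r i j) ((h.isIsotropic.memLp_condMean hr r
    i).integrable_fun_mul (h.isIsotropic.memLp_condMean hr r j)),
    integral_prod _ ((memLp_fst_coord h2 i).integrable_fun_mul (memLp_fst_coord h2 j))] at e
  simp only [integral_const, probReal_univ, one_smul, h.isIsotropic.covariance] at e
  rw [e, meanCov]
  ring

lemma IsIsotropic.integral_fst_mul_obs (h : IsIsotropic μ) (r : ℝ) (i j : Fin d) :
    ∫ p, p.1 i * obs r p j ∂(channelLaw μ) = r * (if i = j then 1 else 0) := by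
  have h2 := h.integrable_norm_sq
  have e : ∀ p : EuclideanSpace ℝ (Fin d) × EuclideanSpace ℝ (Fin d),
      p.1 i * obs r p j = r * (p.1 i * p.1 j) + p.1 i * p.2 j := fun p => by
    simp only [obs, PiLp.add_apply, PiLp.smul_apply, smul_eq_mul]; ring
  have i1 := (memLp_fst_coord h2 i).integrable_fun_mul (memLp_fst_coord h2 j)
  have i2 := (memLp_fst_coord h2 i).integrable_fun_mul (memLp_snd_coord (μ := μ) j)
  have i1' : Integrable (fun p : EuclideanSpace ℝ (Fin d) × EuclideanSpace ℝ (Fin d) =>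
    r * (p.1 i * p.1 j)) (channelLaw μ) := i1.const_mul r
  simp_rw [e]
  rw [integral_add i1' i2, integral_const_mul, integral_prod _ i1,
    integral_prod_mul (fun x : EuclideanSpace ℝ (Fin d) => x i)
      (fun x : EuclideanSpace ℝ (Fin d) => x j)]
  simp [h.covariance, h.integral_coord]

lemma IsIsotropic.integral_obs_mul_obs (h : IsIsotropic μ) (r : ℝ) (i j : Fin d) :
    ∫ p, obs r p i * obs r p j ∂(channelLaw μ) = (1 + r ^ 2) * (if i = j then 1 else 0) := by
  have h2 := h.integrable_norm_sq
  have e : ∀ p : EuclideanSpace ℝ (Fin d) × EuclideanSpace ℝ (Fin d),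
      obs r p i * obs r p j = r * (p.1 i * obs r p j) + (r * (p.1 j * p.2 i) + p.2 i * p.2 j) :=
    fun p => by
      simp only [obs, PiLp.add_apply, PiLp.smul_apply, smul_eq_mul]; ring
  have i1 := (memLp_fst_coord h2 i).integrable_fun_mul (memLp_obs_coord h2 r j)
  have i2 := (memLp_fst_coord h2 j).integrable_fun_mul (memLp_snd_coord (μ := μ) i)
  have i3 := (memLp_snd_coord (μ := μ) i).integrable_fun_mul (memLp_snd_coord (μ := μ) j)
  have i1' : Integrable (fun p : EuclideanSpace ℝ (Fin d) × EuclideanSpace ℝ (Fin d) =>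
    r * (p.1 i * obs r p j)) (channelLaw μ) := i1.const_mul r
  have i2' : Integrable (fun p : EuclideanSpace ℝ (Fin d) × EuclideanSpace ℝ (Fin d) =>
    r * (p.1 j * p.2 i)) (channelLaw μ) := i2.const_mul r
  have i4 : Integrable (fun p : EuclideanSpace ℝ (Fin d) × EuclideanSpace ℝ (Fin d) =>
    r * (p.1 j * p.2 i) + p.2 i * p.2 j) (channelLaw μ) := i2'.add i3
  simp_rw [e]
  rw [integral_add i1' i4, integral_add i2' i3, integral_const_mul, integral_const_mul,
    h.integral_fst_mul_obs, integral_prod_mul (fun x : EuclideanSpace ℝ (Fin d) => x j)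
      (fun x : EuclideanSpace ℝ (Fin d) => x i), integral_prod _ i3]
  simp [h.integral_coord, integral_coord_mul_coord_stdGaussian]
  split_ifs <;> ring

lemma IsIsotropic.integral_condMean_mul_obs (h : IsIsotropic μ) (hr : 0 < r) (i j : Fin d) :
    ∫ p, condMean μ r i (obs r p) * obs r p j ∂(channelLaw μ) = r * (if i = j then 1 else 0) := by
  rw [← h.integral_fst_mul_obs r i j]
  have := h.integral_mul_fst hr (F := fun w => w j) (by fun_prop)
    (memLp_obs_coord h.integrable_norm_sq r j) i
  simp_rw [mul_comm (_ : ℝ) (obs r _ j)]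
  exact this.symm

lemma IsIsotropicLogConcave.estEnergy_eq (h : IsIsotropicLogConcave μ f) (hr : 0 < r) :
    estEnergy μ r = d - ∑ i, meanCov μ r i i := by
  rw [estEnergy, integral_finsetSum]
  · have := fun i => h.integral_condMean_mul hr i i
    simp_rw [← sq] at this
    simp [this]
  · intro i _
    exact (h.isIsotropic.memLp_condMean hr r i).integrable_sq

lemma IsIsotropicLogConcave.covEnergy_eq (h : IsIsotropicLogConcave μ f) (hr : 0 < r) :
    covEnergy μ r = ∑ i, ∑ j, ∫ p, condCov μ r i j (obs r p) ^ 2 ∂(channelLaw μ) := by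
  rw [covEnergy, integral_finsetSum]
  · refine Finset.sum_congr rfl fun i _ => integral_finsetSum _ fun j _ => ?_
    exact (h.memLp_condCov hr r i j).integrable_sq
  · exact fun i _ => integrable_finsetSum _ fun j _ => (h.memLp_condCov hr r i j).integrable_sq

end GaussianChannel

/-! ### The envelope theorem. -/

section Envelope

/-- If `Q ρ r` is maximal over `ρ` at `ρ = r`, the derivative of `Q r r` is the partial derivative
of `Q` in its second variable. -/
lemma hasDerivAt_diag_of_le {Q Q' : ℝ → ℝ → ℝ} {r₀ : ℝ} {I : Set ℝ} (hI : I ∈ nhds r₀)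
    (hconv : Convex ℝ I) (hmax : ∀ ρ ∈ I, ∀ r ∈ I, Q ρ r ≤ Q r r)
    (hd : ∀ ρ ∈ I, ∀ r ∈ I, HasDerivAt (Q ρ) (Q' ρ r) r)
    (hc : ContinuousAt (fun p : ℝ × ℝ => Q' p.1 p.2) (r₀, r₀)) :
    HasDerivAt (fun r => Q r r) (Q' r₀ r₀) r₀ := by
  have h0 : r₀ ∈ I := mem_of_mem_nhds hI
  rw [hasDerivAt_iff_isLittleO, Asymptotics.isLittleO_iff]
  intro ε hε
  have hc' := Metric.continuousAt_iff.1 hc ε hε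
  obtain ⟨δ, hδ, hc'⟩ := hc'
  have hb : Metric.ball r₀ δ ∈ nhds r₀ := Metric.ball_mem_nhds _ hδ
  filter_upwards [hI, hb] with r hrI hrb
  have hQ' : ∀ ρ ∈ segment ℝ r₀ r, ∀ s ∈ segment ℝ r₀ r, |Q' ρ s - Q' r₀ r₀| ≤ ε := by
    intro ρ hρ s hs
    have hseg : segment ℝ r₀ r ⊆ Metric.ball r₀ δ :=
      (convex_ball r₀ δ).segment_subset (Metric.mem_ball_self hδ) hrb
    have := hc' (x := (ρ, s)) (by
      rw [Prod.dist_eq]; exact max_lt (hseg hρ) (hseg hs))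
    rw [Real.dist_eq] at this
    exact this.le
  have hsegI : segment ℝ r₀ r ⊆ I := hconv.segment_subset h0 hrI
  have mv : ∀ ρ ∈ segment ℝ r₀ r,
      |Q ρ r - Q ρ r₀ - (r - r₀) * Q' r₀ r₀| ≤ ε * |r - r₀| := by
    intro ρ hρ
    have := (convex_segment r₀ r).norm_image_sub_le_of_norm_hasDerivWithin_le
      (f := fun s => Q ρ s - s * Q' r₀ r₀) (f' := fun s => Q' ρ s - 1 * Q' r₀ r₀) (C := ε)
      (fun s hs => ((hd ρ (hsegI hρ) s (hsegI hs)).sub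
        ((hasDerivAt_id s).mul_const _)).hasDerivWithinAt) (fun s hs => by
          rw [one_mul, Real.norm_eq_abs]; exact hQ' ρ hρ s hs)
      (left_mem_segment ℝ r₀ r) (right_mem_segment ℝ r₀ r)
    rw [Real.norm_eq_abs, Real.norm_eq_abs] at this
    convert this using 2
    ring
  -- Maximality squeezes the increment on the diagonal: it is at least the increment of Q r₀ and at
  -- most that of Q r. Both are nearly linear by the mean value inequality, so no derivative in the
  -- first variable is needed.
  have a1 := mv r₀ (left_mem_segment ℝ r₀ r)
  have a2 := mv r (right_mem_segment ℝ r₀ r)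
  have b1 := hmax r₀ h0 r hrI
  have b2 := hmax r hrI r₀ h0
  rw [Real.norm_eq_abs, Real.norm_eq_abs, smul_eq_mul, abs_le]
  rw [abs_le] at a1 a2
  constructor <;> linarith [a1.1, a1.2, a2.1, a2.2]

/-- The envelope theorem for integrals. -/
lemma hasDerivAt_integral_diag_of_le {Ω : Type*} [MeasurableSpace Ω] {P : Measure Ω}
    {G G' : ℝ → ℝ → Ω → ℝ} {r₀ : ℝ} {I : Set ℝ} (hI : IsOpen I) (hr₀ : r₀ ∈ I)
    (hconv : Convex ℝ I) {bound : Ω → ℝ} (hbound : Integrable bound P)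
    (hG : ∀ ρ ∈ I, ∀ r ∈ I, Integrable (G ρ r) P)
    (hG' : ∀ ρ ∈ I, ∀ r ∈ I, AEStronglyMeasurable (G' ρ r) P)
    (hd : ∀ ρ ∈ I, ∀ r ∈ I, ∀ p, HasDerivAt (fun r => G ρ r p) (G' ρ r p) r)
    (hle : ∀ ρ ∈ I, ∀ r ∈ I, ∀ p, |G' ρ r p| ≤ bound p)
    (hcont : ∀ p, Continuous fun q : ℝ × ℝ => G' q.1 q.2 p)
    (hmax : ∀ ρ ∈ I, ∀ r ∈ I, ∫ p, G ρ r p ∂P ≤ ∫ p, G r r p ∂P) :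
    HasDerivAt (fun r => ∫ p, G r r p ∂P) (∫ p, G' r₀ r₀ p ∂P) r₀ := by
  refine hasDerivAt_diag_of_le (Q := fun ρ r => ∫ p, G ρ r p ∂P)
    (Q' := fun ρ r => ∫ p, G' ρ r p ∂P) (hI.mem_nhds hr₀) hconv hmax (fun ρ hρ r hr => ?_) ?_
  · exact (hasDerivAt_integral_of_dominated_loc_of_deriv_le (𝕜 := ℝ) (μ := P) (F := G ρ)
      (F' := G' ρ) (bound := bound) (hI.mem_nhds hr)
      (by filter_upwards [hI.mem_nhds hr] with s hs using (hG ρ hρ s hs).1) (hG ρ hρ r hr)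
      (hG' ρ hρ r hr) (.of_forall fun p s hs => hle ρ hρ s hs p) hbound
      (.of_forall fun p s hs => hd ρ hρ s hs p)).2
  · have hn : ∀ᶠ q : ℝ × ℝ in nhds (r₀, r₀), q.1 ∈ I ∧ q.2 ∈ I :=
      (hI.prod hI).mem_nhds ⟨hr₀, hr₀⟩
    refine continuousAt_of_dominated (bound := bound) ?_ ?_ hbound
      (.of_forall fun p => (hcont p).continuousAt)
    · filter_upwards [hn] with q hq using hG' _ hq.1 _ hq.2
    · filter_upwards [hn] with q hq using .of_forall fun p => hle _ hq.1 _ hq.2 p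

end Envelope

/-! ### Differentiating the estimation energy in the signal strength. -/

section Flow

variable {d : ℕ} {μ : Measure (EuclideanSpace ℝ (Fin d))} [IsProbabilityMeasure μ] {r : ℝ}
  {f : EuclideanSpace ℝ (Fin d) → ℝ}

lemma hasDerivAt_obs (r : ℝ) (p : EuclideanSpace ℝ (Fin d) × EuclideanSpace ℝ (Fin d)) :
    HasDerivAt (fun r => obs r p) p.1 r := by
  simpa [obs] using ((hasDerivAt_id r).smul_const p.1).add_const p.2

lemma hasDerivAt_condMean_obs (h2 : Integrable (fun x => ‖x‖ ^ 2) μ) {ρ : ℝ} (hρ : 0 < ρ) (r : ℝ)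
    (i : Fin d) (p : EuclideanSpace ℝ (Fin d) × EuclideanSpace ℝ (Fin d)) :
    HasDerivAt (fun r => condMean μ ρ i (obs r p))
      (ρ * ∑ j, condCov μ ρ i j (obs r p) * p.1 j) r := by
  rw [← fderiv_condMean_apply h2 hρ]
  have : DifferentiableAt ℝ (condMean μ ρ i) (obs r p) :=
    (contDiff_condMean h2 hρ i).differentiable (by simp) _
  exact this.hasFDerivAt.comp_hasDerivAt r (hasDerivAt_obs r p)

lemma hasDerivAt_log_partitionFn_obs (h2 : Integrable (fun x => ‖x‖ ^ 2) μ) {ρ : ℝ} (hρ : 0 < ρ)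
    (r : ℝ) (p : EuclideanSpace ℝ (Fin d) × EuclideanSpace ℝ (Fin d)) :
    HasDerivAt (fun r => Real.log (partitionFn μ ρ (obs r p)))
      (ρ * ∑ j, p.1 j * condMean μ ρ j (obs r p)) r := by
  rw [← fderiv_log_partitionFn_apply' h2 hρ]
  have : DifferentiableAt ℝ (fun w => Real.log (partitionFn μ ρ w)) (obs r p) :=
    ((contDiff_partitionFn hρ).differentiable (by simp) _).log (partitionFn_pos _ _).ne'
  exact this.hasFDerivAt.comp_hasDerivAt r (hasDerivAt_obs r p)

@[fun_prop]
lemma continuous_obs_left (p : EuclideanSpace ℝ (Fin d) × EuclideanSpace ℝ (Fin d)) :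
    Continuous fun r : ℝ => obs r p := by unfold obs; fun_prop

/-- An integrable function dominating the derivatives along the channel for parameters in
`(r₀ / 2, 2 r₀)`. -/
noncomputable def channelBound (r₀ : ℝ)
    (p : EuclideanSpace ℝ (Fin d) × EuclideanSpace ℝ (Fin d)) : ℝ :=
  (128 + 1) * ‖p.1‖ ^ 2 + 32 / r₀ ^ 2 * ‖p.2‖ ^ 2 + 2 * d

lemma integrable_channelBound (h2 : Integrable (fun x => ‖x‖ ^ 2) μ) (r₀ : ℝ) :
    Integrable (channelBound r₀) (channelLaw μ) :=
  (((integrable_norm_sq_fst h2).const_mul _).add (integrable_norm_sq_snd.const_mul _)).add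
    (integrable_const _)

lemma IsIsotropic.condMean_obs_sq_le (h : IsIsotropic μ) {r₀ ρ r : ℝ} (hr₀ : 0 < r₀)
    (hρ : ρ ∈ Set.Ioo (r₀ / 2) (2 * r₀)) (hr : r ∈ Set.Ioo (r₀ / 2) (2 * r₀)) (i : Fin d)
    (p : EuclideanSpace ℝ (Fin d) × EuclideanSpace ℝ (Fin d)) :
    condMean μ ρ i (obs r p) ^ 2 + ‖p.1‖ ^ 2 ≤ channelBound r₀ p := by
  have hρ0 : 0 < ρ := by linarith [hρ.1]
  have hr0 : 0 < r := by linarith [hr.1]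
  have h1 := h.condMean_sq_le hρ0 i (obs r p)
  have h2 := norm_obs_sq_le r p
  have h3 : 4 * ‖obs r p‖ ^ 2 / ρ ^ 2 ≤ 16 / r₀ ^ 2 * ‖obs r p‖ ^ 2 := by
    rw [div_mul_eq_mul_div, div_le_div_iff₀ (by positivity) (by positivity)]
    have : r₀ ^ 2 ≤ (2 * ρ) ^ 2 := pow_le_pow_left₀ hr₀.le (by linarith [hρ.1]) 2
    nlinarith [mul_le_mul_of_nonneg_left this (sq_nonneg ‖obs r p‖)]
  have h4 : r ^ 2 ≤ (2 * r₀) ^ 2 := pow_le_pow_left₀ hr0.le hr.2.le 2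
  have h5 : 16 / r₀ ^ 2 * ‖obs r p‖ ^ 2 ≤
      16 / r₀ ^ 2 * (2 * (2 * r₀) ^ 2 * ‖p.1‖ ^ 2 + 2 * ‖p.2‖ ^ 2) := by
    refine mul_le_mul_of_nonneg_left (h2.trans ?_) (by positivity)
    gcongr
  have h6 : 16 / r₀ ^ 2 * (2 * (2 * r₀) ^ 2 * ‖p.1‖ ^ 2 + 2 * ‖p.2‖ ^ 2) =
      128 * ‖p.1‖ ^ 2 + 32 / r₀ ^ 2 * ‖p.2‖ ^ 2 := by field_simp; ring
  rw [channelBound]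
  linarith

/-- After conditioning, the integrand is a sum of 2ab - a² with a the mismatched and b the correct
estimate. It is at most b², with equality for ρ = r, which is the maximality that the envelope
theorem asks for. -/
lemma IsIsotropicLogConcave.integral_sum_mul_sub (h : IsIsotropicLogConcave μ f) {ρ : ℝ}
    (hρ : 0 < ρ) (hr : 0 < r) :
    ∫ p, ∑ i, (2 * (condMean μ ρ i (obs r p) * p.1 i) - condMean μ ρ i (obs r p) ^ 2)
        ∂(channelLaw μ) =
      ∫ p, ∑ i, (2 * (condMean μ ρ i (obs r p) * condMean μ r i (obs r p)) -
        condMean μ ρ i (obs r p) ^ 2) ∂(channelLaw μ) := by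
  have h2 := h.isIsotropic.integrable_norm_sq
  have m1 := fun i => h.isIsotropic.memLp_condMean hρ r i
  have m2 := fun i => h.isIsotropic.memLp_condMean hr r i
  have i1 := fun i => ((m1 i).integrable_fun_mul (memLp_fst_coord h2 i)).const_mul 2
  have i2 := fun i => ((m1 i).integrable_fun_mul (m2 i)).const_mul 2
  have i3 := fun i => (m1 i).integrable_sq
  have i4 : ∀ i, Integrable (fun p => 2 * (condMean μ ρ i (obs r p) * p.1 i) -
    condMean μ ρ i (obs r p) ^ 2) (channelLaw μ) := fun i => (i1 i).sub (i3 i)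
  have i5 : ∀ i, Integrable (fun p => 2 * (condMean μ ρ i (obs r p) * condMean μ r i (obs r p)) -
    condMean μ ρ i (obs r p) ^ 2) (channelLaw μ) := fun i => (i2 i).sub (i3 i)
  rw [integral_finsetSum _ fun i _ => i4 i, integral_finsetSum _ fun i _ => i5 i]
  refine Finset.sum_congr rfl fun i _ => ?_
  rw [integral_sub (i1 i) (i3 i), integral_sub (i2 i) (i3 i), integral_const_mul,
    integral_const_mul, h.isIsotropic.integral_mul_fst hr (measurable_condMean h2 i) (m1 i)]

/-- Given the output, (X_i - M_i)X_j has mean C_ij, so each summand becomes 2r C_ij². -/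
lemma IsIsotropicLogConcave.integral_deriv_energy (h : IsIsotropicLogConcave μ f) (hr : 0 < r) :
    ∫ p, ∑ i, ∑ j, 2 * r * (condCov μ r i j (obs r p) *
      ((p.1 i - condMean μ r i (obs r p)) * p.1 j)) ∂(channelLaw μ) = 2 * r * covEnergy μ r := by
  have h2 := h.isIsotropic.integrable_norm_sq
  have m1 := fun i => h.isIsotropic.memLp_condMean hr r i
  have mx := fun i => memLp_fst_coord h2 i
  have hm := fun i j => measurable_condCov (r := r) h2 i j
  have hm' := fun i => measurable_condMean (r := r) h2 i
  have hme : ∀ i j, AEStronglyMeasurable (fun p => condCov μ r i j (obs r p)) (channelLaw μ) :=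
    fun i j => Measurable.aestronglyMeasurable (by have := hm i j; fun_prop)
  have i0 : ∀ i j, Integrable (fun p => condCov μ r i j (obs r p) *
      ((p.1 i - condMean μ r i (obs r p)) * p.1 j)) (channelLaw μ) := fun i j =>
    integrable_mul_of_abs_le (((mx i).sub (m1 i)).integrable_fun_mul (mx j)) (hme i j)
      fun p => h.abs_condCov_le hr i j _
  have i1 : ∀ i j, Integrable (fun p => condCov μ r i j (obs r p) * (p.1 i * p.1 j))
      (channelLaw μ) := fun i j =>
    integrable_mul_of_abs_le ((mx i).integrable_fun_mul (mx j)) (hme i j)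
      fun p => h.abs_condCov_le hr i j _
  have mF : ∀ i j, MemLp (fun p => condCov μ r i j (obs r p) * condMean μ r i (obs r p)) 2
      (channelLaw μ) := by
    intro i j
    refine memLp_two_of_sq_le ((hme i j).mul (m1 i).1)
      ((m1 i).integrable_sq.const_mul ((1 / r ^ 2) ^ 2)) fun p => ?_
    rw [mul_pow]
    refine mul_le_mul_of_nonneg_right ?_ (sq_nonneg _)
    rw [← sq_abs]
    exact pow_le_pow_left₀ (abs_nonneg _) (h.abs_condCov_le hr i j _) 2
  rw [integral_finsetSum _ fun i _ => integrable_finsetSum _ fun j _ => (i0 i j).const_mul _,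
    h.covEnergy_eq hr, Finset.mul_sum]
  refine Finset.sum_congr rfl fun i _ => ?_
  rw [integral_finsetSum _ fun j _ => (i0 i j).const_mul _, Finset.mul_sum]
  refine Finset.sum_congr rfl fun j _ => ?_
  rw [integral_const_mul]
  congr 1
  have e1 : ∀ p : EuclideanSpace ℝ (Fin d) × EuclideanSpace ℝ (Fin d), condCov μ r i j (obs r p) *
      ((p.1 i - condMean μ r i (obs r p)) * p.1 j) =
      condCov μ r i j (obs r p) * (p.1 i * p.1 j) -
        condCov μ r i j (obs r p) * condMean μ r i (obs r p) * p.1 j := fun p => by ring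
  simp_rw [e1]
  rw [integral_sub (i1 i j) ((mF i j).integrable_fun_mul (mx j)),
    h.integral_mul_fst_mul_fst hr (hm i j) (h.abs_condCov_le hr i j) i j,
    h.isIsotropic.integral_mul_fst hr (F := fun w => condCov μ r i j w * condMean μ r i w)
      (by have := hm i j; have := hm' i; fun_prop) (mF i j) j, ← integral_sub]
  · refine integral_congr_ae (.of_forall fun p => ?_)
    ring
  · exact integrable_mul_of_abs_le ((h.integrable_condCov hr r i j).add
      ((m1 i).integrable_fun_mul (m1 j))) (hme i j) fun p => h.abs_condCov_le hr i j _
  · exact (mF i j).integrable_fun_mul (m1 j)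

/-- Since the conditional mean is the best least squares estimator, the energy is the diagonal of a
functional maximal in its first variable. Only the dependence of the observation on `r` has to be
differentiated, and there the derivative of M is r C. -/
theorem IsIsotropicLogConcave.hasDerivAt_estEnergy (h : IsIsotropicLogConcave μ f) (hr : 0 < r) :
    HasDerivAt (estEnergy μ) (2 * r * covEnergy μ r) r := by
  have h2 := h.isIsotropic.integrable_norm_sq
  have hcM := fun i => continuous_condMean h2 i
  have hcC := fun i j => continuous_condCov h2 i j
  have hm := fun (ρ : ℝ) i j => measurable_condCov (r := ρ) h2 i j
  have hm' := fun (ρ : ℝ) i => measurable_condMean (r := ρ) h2 i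
  have key := hasDerivAt_integral_diag_of_le (P := channelLaw μ) (r₀ := r)
    (I := Set.Ioo (r / 2) (2 * r)) (bound := fun p => d * d * (8 / r * channelBound r p))
    (G := fun ρ s p => ∑ i, (2 * (condMean μ ρ i (obs s p) * p.1 i) -
      condMean μ ρ i (obs s p) ^ 2))
    (G' := fun ρ s p => ∑ i, ∑ j, 2 * ρ * (condCov μ ρ i j (obs s p) *
      ((p.1 i - condMean μ ρ i (obs s p)) * p.1 j)))
    isOpen_Ioo ⟨by linarith, by linarith⟩ (convex_Ioo _ _)
    (((integrable_channelBound h2 r).const_mul _).const_mul _) ?_ ?_ ?_ ?_ ?_ ?_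
  · rw [h.integral_deriv_energy hr] at key
    refine key.congr_of_eventuallyEq ?_
    filter_upwards [lt_mem_nhds hr] with s hs
    rw [h.integral_sum_mul_sub hs hs, estEnergy]
    refine integral_congr_ae (.of_forall fun p => Finset.sum_congr rfl fun i _ => ?_)
    ring
  · intro ρ hρ s hs
    have hρ0 : 0 < ρ := by linarith [hρ.1]
    exact integrable_finsetSum _ fun i _ =>
      (((h.isIsotropic.memLp_condMean hρ0 s i).integrable_fun_mul
        (memLp_fst_coord h2 i)).const_mul 2).sub
          (h.isIsotropic.memLp_condMean hρ0 s i).integrable_sq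
  · intro ρ hρ s hs
    refine Measurable.aestronglyMeasurable (Finset.measurable_sum _ fun i _ =>
      Finset.measurable_sum _ fun j _ => ?_)
    have := hm ρ i j
    have := hm' ρ i
    fun_prop
  · intro ρ hρ s hs p
    have hρ0 : 0 < ρ := by linarith [hρ.1]
    refine HasDerivAt.fun_sum fun i _ => ?_
    have h1 := hasDerivAt_condMean_obs h2 hρ0 s i p
    refine (((h1.mul_const (p.1 i)).const_mul 2).fun_sub (h1.fun_pow 2)).congr_deriv ?_
    rw [Finset.mul_sum, Finset.sum_mul, Finset.mul_sum, Finset.mul_sum,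
      ← Finset.sum_sub_distrib]
    refine Finset.sum_congr rfl fun j _ => ?_
    norm_num
    ring
  · intro ρ hρ s hs p
    have hρ0 : 0 < ρ := by linarith [hρ.1]
    have hB : 0 ≤ channelBound r p := by unfold channelBound; positivity
    have key : ∀ i j : Fin d, |2 * ρ * (condCov μ ρ i j (obs s p) *
        ((p.1 i - condMean μ ρ i (obs s p)) * p.1 j))| ≤ 8 / r * channelBound r p := by
      intro i j
      have b1 := h.abs_condCov_le hρ0 i j (obs s p)
      have b2 := h.isIsotropic.condMean_obs_sq_le hr hρ hs i p
      have b3 := coord_sq_le p.1 i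
      have b4 := coord_sq_le p.1 j
      -- The covariance entries are at most 1/ρ² by log-concavity, so a quadratic bound on the
      -- remaining factor is enough; ρ > r/2 then gives the constant 8/r.
      have b5 : |(p.1 i - condMean μ ρ i (obs s p)) * p.1 j| ≤ 2 * channelBound r p := by
        rw [abs_le]
        constructor <;>
        nlinarith [sq_nonneg (p.1 i - condMean μ ρ i (obs s p) + p.1 j),
          sq_nonneg (p.1 i - condMean μ ρ i (obs s p) - p.1 j),
          sq_nonneg (p.1 i + condMean μ ρ i (obs s p)), sq_nonneg ‖p.1‖]
      rw [abs_mul, abs_of_pos (by positivity : 0 < 2 * ρ), abs_mul]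
      calc _ ≤ 2 * ρ * (1 / ρ ^ 2 * (2 * channelBound r p)) := by gcongr
        _ = 4 / ρ * channelBound r p := by field_simp; ring
        _ ≤ _ := by
          refine mul_le_mul_of_nonneg_right ?_ hB
          rw [div_le_div_iff₀ hρ0 hr]
          linarith [hρ.1]
    refine (Finset.abs_sum_le_sum_abs _ _).trans ?_
    calc _ ≤ ∑ i : Fin d, ∑ j : Fin d, 8 / r * channelBound r p :=
          Finset.sum_le_sum fun i _ => (Finset.abs_sum_le_sum_abs _ _).trans
            (Finset.sum_le_sum fun j _ => key i j)
      _ = _ := by simp; ring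
  · intro p
    refine continuous_finsetSum _ fun i _ => continuous_finsetSum _ fun j _ => ?_
    have c0 : Continuous fun q : ℝ × ℝ => (q.1, obs q.2 p) := by fun_prop
    have c1 := (hcC i j).comp c0
    have c2 := (hcM i).comp c0
    simp only [Function.comp_def] at c1 c2
    fun_prop
  · intro ρ hρ s hs
    have hρ0 : 0 < ρ := by linarith [hρ.1]
    have hs0 : 0 < s := by linarith [hs.1]
    rw [h.integral_sum_mul_sub hρ0 hs0, h.integral_sum_mul_sub hs0 hs0]
    have m1 := fun i => h.isIsotropic.memLp_condMean hρ0 s i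
    have m2 := fun i => h.isIsotropic.memLp_condMean hs0 s i
    refine integral_mono (integrable_finsetSum _ fun i _ =>
      (((m1 i).integrable_fun_mul (m2 i)).const_mul 2).sub (m1 i).integrable_sq)
      (integrable_finsetSum _ fun i _ =>
      (((m2 i).integrable_fun_mul (m2 i)).const_mul 2).sub (m2 i).integrable_sq) fun p => ?_
    refine Finset.sum_le_sum fun i _ => ?_
    nlinarith [sq_nonneg (condMean μ ρ i (obs s p) - condMean μ s i (obs s p))]

end Flow

/-! ### Relative entropy of the output and its derivative. -/

section LogPartition

variable {d : ℕ} {μ : Measure (EuclideanSpace ℝ (Fin d))} [IsProbabilityMeasure μ] {r : ℝ}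
  {f : EuclideanSpace ℝ (Fin d) → ℝ}

lemma log_partitionFn_le (r : ℝ) (w : EuclideanSpace ℝ (Fin d)) :
    Real.log (partitionFn μ r w) ≤ ‖w‖ ^ 2 / 2 := by
  rw [Real.log_le_iff_le_exp (partitionFn_pos r w)]
  calc _ ≤ ∫ _, Real.exp (‖w‖ ^ 2 / 2) ∂μ :=
        integral_mono (integrable_exp_tiltExponent r w) (integrable_const _) fun x =>
          Real.exp_le_exp.2 (tiltExponent_le r w x)
    _ = _ := by simp

lemma integrable_tiltExponent (h2 : Integrable (fun x => ‖x‖ ^ 2) μ) (r : ℝ)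
    (w : EuclideanSpace ℝ (Fin d)) : Integrable (tiltExponent r w) μ := by
  have h1 : Integrable (fun x => inner ℝ w x) μ := by
    simpa only [real_inner_comm] using integrable_inner h2 w
  exact (h1.const_mul r).sub ((h2.const_mul (r ^ 2)).div_const 2)

lemma IsIsotropic.integral_tiltExponent (h : IsIsotropic μ) (r : ℝ)
    (w : EuclideanSpace ℝ (Fin d)) : ∫ x, tiltExponent r w x ∂μ = -(r ^ 2 * d / 2) := by
  have h2 := h.integrable_norm_sq
  have h1 : Integrable (fun x => inner ℝ w x) μ := by
    simpa only [real_inner_comm] using integrable_inner h2 w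
  have h3 : ∫ x, inner ℝ w x ∂μ = 0 := by
    simpa only [real_inner_comm] using h.integral_inner w
  unfold tiltExponent
  rw [integral_sub (h1.const_mul r) ((h2.const_mul (r ^ 2)).div_const 2), integral_const_mul,
    integral_div, integral_const_mul, h3, h.integral_norm_sq]
  ring

/-- Jensen's inequality, written with the tangent line of exp at the mean of the exponent; by
centering that mean does not depend on `w`. -/
lemma IsIsotropic.le_log_partitionFn (h : IsIsotropic μ) (r : ℝ) (w : EuclideanSpace ℝ (Fin d)) :
    -(r ^ 2 * d / 2) ≤ Real.log (partitionFn μ r w) := by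
  have h2 := h.integrable_norm_sq
  have hi := integrable_tiltExponent h2 r w
  have hI := h.integral_tiltExponent r w
  set c := -(r ^ 2 * d / 2) with hc
  rw [Real.le_log_iff_exp_le (partitionFn_pos r w)]
  have i1 : Integrable (fun x => Real.exp c * (tiltExponent r w x + (1 - c))) μ :=
    (hi.add (integrable_const _)).const_mul _
  calc Real.exp c = ∫ x, Real.exp c * (tiltExponent r w x + (1 - c)) ∂μ := by
        rw [integral_const_mul, integral_add hi (integrable_const _), hI]
        simp
    _ ≤ _ := by
      refine integral_mono i1 (integrable_exp_tiltExponent r w) fun x => ?_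
      have := Real.add_one_le_exp (tiltExponent r w x - c)
      have h3 : Real.exp (tiltExponent r w x) = Real.exp c * Real.exp (tiltExponent r w x - c) := by
        rw [← Real.exp_add]; congr 1; ring
      simp only
      rw [h3]
      refine mul_le_mul_of_nonneg_left (by linarith) (Real.exp_pos _).le

/-- Jensen under the posterior law, where Z exp(-exponent) has mean one: log Z is at most the
posterior mean of the exponent. Unlike the cruder ‖w‖²/2, this upper bound vanishes on average as r
→ 0. -/
lemma log_partitionFn_le_sum (h2 : Integrable (fun x => ‖x‖ ^ 2) μ) (r : ℝ)
    (w : EuclideanSpace ℝ (Fin d)) :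
    Real.log (partitionFn μ r w) ≤ r * ∑ i, condMean μ r i w * w i := by
  set ν := μ.tilted (tiltExponent r w) with hν
  have hZ := partitionFn_pos (μ := μ) r w
  have i1 := fun i => ((integrable_coord h2 i).posterior r w)
  have i2 : Integrable (fun x : EuclideanSpace ℝ (Fin d) => r * ∑ i, x i * w i) ν :=
    (integrable_finsetSum _ fun i _ => (i1 i).mul_const _).const_mul r
  have hid : ∀ x : EuclideanSpace ℝ (Fin d), Real.exp (tiltExponent r w x) *
      (partitionFn μ r w * Real.exp (-tiltExponent r w x)) = partitionFn μ r w := by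
    intro x
    rw [mul_left_comm, ← Real.exp_add, add_neg_cancel, Real.exp_zero, mul_one]
  have i3 : Integrable (fun x => partitionFn μ r w * Real.exp (-tiltExponent r w x)) ν := by
    rw [hν, integrable_tilted_iff (integrable_exp_tiltExponent r w)]
    simp only [smul_eq_mul, hid]
    exact integrable_const _
  have e3 : ∫ x, partitionFn μ r w * Real.exp (-tiltExponent r w x) ∂ν = 1 := by
    change postMean μ r (fun x => partitionFn μ r w * Real.exp (-tiltExponent r w x)) w = 1
    rw [postMean_eq, tiltMoment]
    simp only [smul_eq_mul, hid]
    simp [hZ.ne']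
  have e2 : ∫ x, r * ∑ i, x i * w i ∂ν = r * ∑ i, condMean μ r i w * w i := by
    rw [integral_const_mul, integral_finsetSum _ fun i _ => (i1 i).mul_const _]
    simp_rw [integral_mul_const]
    rfl
  rw [← e2]
  have i4 : Integrable (fun x : EuclideanSpace ℝ (Fin d) => r * ∑ i, x i * w i +
    (partitionFn μ r w * Real.exp (-tiltExponent r w x) - 1)) ν :=
    i2.add (i3.sub (integrable_const _))
  have i5 : Integrable (fun x : EuclideanSpace ℝ (Fin d) =>
    (partitionFn μ r w * Real.exp (-tiltExponent r w x) - 1)) ν := i3.sub (integrable_const _)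
  have : ∫ _, Real.log (partitionFn μ r w) ∂ν ≤ ∫ x, (r * ∑ i, x i * w i +
    (partitionFn μ r w * Real.exp (-tiltExponent r w x) - 1)) ∂ν := by
    refine integral_mono (integrable_const _) i4 fun x => ?_
    have h1 := Real.add_one_le_exp (Real.log (partitionFn μ r w) - tiltExponent r w x)
    have h3 : Real.exp (Real.log (partitionFn μ r w) - tiltExponent r w x) =
        partitionFn μ r w * Real.exp (-tiltExponent r w x) := by
      rw [sub_eq_add_neg, Real.exp_add, Real.exp_log hZ]
    have h4 : tiltExponent r w x ≤ r * ∑ i, x i * w i := by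
      have : inner ℝ w x = ∑ i, x i * w i := inner_eq_sum_coord w x
      rw [tiltExponent, this]
      have : 0 ≤ r ^ 2 * ‖x‖ ^ 2 / 2 := by positivity
      linarith
    simp only
    linarith
  rw [integral_add i2 i5, integral_sub i3 (integrable_const _), e3] at this
  simpa using this

lemma measurable_partitionFn (r : ℝ) : Measurable (partitionFn μ r) :=
  (continuous_partitionFn.comp (Continuous.prodMk_right r)).measurable

lemma IsIsotropic.abs_log_partitionFn_le (h : IsIsotropic μ) (r : ℝ)
    (w : EuclideanSpace ℝ (Fin d)) :
    |Real.log (partitionFn μ r w)| ≤ r ^ 2 * d / 2 + ‖w‖ ^ 2 / 2 := by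
  rw [abs_le]
  have h1 := h.le_log_partitionFn r w
  have h2 := log_partitionFn_le (μ := μ) r w
  have h3 : 0 ≤ ‖w‖ ^ 2 / 2 := by positivity
  have h4 : 0 ≤ r ^ 2 * d / 2 := by positivity
  constructor <;> linarith

lemma IsIsotropic.integrable_log_partitionFn_obs (h : IsIsotropic μ) (ρ r : ℝ) :
    Integrable (fun p => Real.log (partitionFn μ ρ (obs r p))) (channelLaw μ) := by
  have := measurable_partitionFn (μ := μ) ρ
  exact ((integrable_const (ρ ^ 2 * d / 2)).add
    ((integrable_norm_sq_obs h.integrable_norm_sq r).div_const 2)).mono'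
    (Measurable.aestronglyMeasurable (by fun_prop))
    (.of_forall fun p => h.abs_log_partitionFn_le ρ _)

lemma integrable_obs_iff {F : EuclideanSpace ℝ (Fin d) → ℝ} (hF : Measurable F) (r : ℝ) :
    Integrable (fun p => F (obs r p)) (channelLaw μ) ↔
      Integrable (fun w => F w * partitionFn μ r w) (stdGaussian (EuclideanSpace ℝ (Fin d))) := by
  have hc : Continuous fun p : EuclideanSpace ℝ (Fin d) × EuclideanSpace ℝ (Fin d) =>
    tiltExponent r p.2 p.1 := by fun_prop
  have h1 := integrable_shear_iff (μ := μ) (r := r)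
    (G := fun p : EuclideanSpace ℝ (Fin d) × EuclideanSpace ℝ (Fin d) => F p.2) (by fun_prop)
  change Integrable (fun p : EuclideanSpace ℝ (Fin d) × EuclideanSpace ℝ (Fin d) =>
    F (r • p.1 + p.2)) (channelLaw μ) ↔ _
  rw [h1, integrable_prod_iff' (Measurable.aestronglyMeasurable (by fun_prop))]
  have e : ∀ w, ∫ x, ‖Real.exp (tiltExponent r w x) * F w‖ ∂μ = ‖F w * partitionFn μ r w‖ := by
    intro w
    simp_rw [norm_mul, Real.norm_of_nonneg (Real.exp_pos _).le]
    rw [integral_mul_const, Real.norm_of_nonneg (partitionFn_pos r w).le, mul_comm]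
    rfl
  simp only [e]
  have hm := measurable_partitionFn (μ := μ) r
  rw [integrable_norm_iff (Measurable.aestronglyMeasurable (by fun_prop))]
  exact and_iff_right (.of_forall fun w => (integrable_exp_tiltExponent r w).mul_const _)

lemma integrable_partitionFn (r : ℝ) :
    Integrable (partitionFn μ r) (stdGaussian (EuclideanSpace ℝ (Fin d))) := by
  have := (integrable_obs_iff (μ := μ) (F := fun _ => 1) measurable_const r).1 (integrable_const 1)
  simpa using this

lemma integral_partitionFn (r : ℝ) :
    ∫ w, partitionFn μ r w ∂(stdGaussian (EuclideanSpace ℝ (Fin d))) = 1 := by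
  have := integral_comp_eq_integral_partitionFn (μ := μ) (r := r) (F := fun _ => 1)
    measurable_const (integrable_const 1)
  simpa using this.symm

/-- Gibbs' inequality for the outputs of two channels. -/
lemma IsIsotropic.integral_log_partitionFn_obs_le (h : IsIsotropic μ) (ρ r : ℝ) :
    ∫ p, Real.log (partitionFn μ ρ (obs r p)) ∂(channelLaw μ) ≤
      ∫ p, Real.log (partitionFn μ r (obs r p)) ∂(channelLaw μ) := by
  have m1 := measurable_partitionFn (μ := μ) ρ
  have m2 := measurable_partitionFn (μ := μ) r
  have hF : Measurable fun w => partitionFn μ ρ w / partitionFn μ r w := by fun_prop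
  have e : ∀ w, partitionFn μ ρ w / partitionFn μ r w * partitionFn μ r w = partitionFn μ ρ w :=
    fun w => div_mul_cancel₀ _ (partitionFn_pos r w).ne'
  have hi : Integrable (fun p => partitionFn μ ρ (obs r p) / partitionFn μ r (obs r p))
      (channelLaw μ) := by
    rw [integrable_obs_iff (μ := μ) hF r]
    simp only [e]
    exact integrable_partitionFn ρ
  have hI : ∫ p, partitionFn μ ρ (obs r p) / partitionFn μ r (obs r p) ∂(channelLaw μ) = 1 := by
    have := integral_comp_eq_integral_partitionFn (μ := μ) (r := r) hF hi
    simp only [e] at this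
    rw [integral_partitionFn] at this
    exact this
  have i1 := h.integrable_log_partitionFn_obs ρ r
  have i2 := h.integrable_log_partitionFn_obs r r
  have : ∫ p, (Real.log (partitionFn μ ρ (obs r p)) - Real.log (partitionFn μ r (obs r p)))
      ∂(channelLaw μ) ≤ ∫ p, (partitionFn μ ρ (obs r p) / partitionFn μ r (obs r p) - 1)
        ∂(channelLaw μ) := by
    refine integral_mono (i1.sub i2) (hi.sub (integrable_const _)) fun p => ?_
    simp only
    rw [← Real.log_div (partitionFn_pos _ _).ne' (partitionFn_pos _ _).ne']
    exact Real.log_le_sub_one_of_pos (div_pos (partitionFn_pos _ _) (partitionFn_pos _ _))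
  rw [integral_sub i1 i2, integral_sub hi (integrable_const _), hI] at this
  simp at this
  linarith

lemma IsIsotropic.le_logPartition (h : IsIsotropic μ) (r : ℝ) :
    -(r ^ 2 * d / 2) ≤ logPartition μ r := by
  have := integral_mono (μ := channelLaw μ) (integrable_const (-(r ^ 2 * d / 2)))
    (h.integrable_log_partitionFn_obs r r) fun p => h.le_log_partitionFn r (obs r p)
  rw [integral_const, probReal_univ, one_smul] at this
  exact this

lemma IsIsotropic.logPartition_le (h : IsIsotropic μ) (hr : 0 < r) :
    logPartition μ r ≤ r ^ 2 * d := by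
  have h2 := h.integrable_norm_sq
  have hi : ∀ i, Integrable (fun p => condMean μ r i (obs r p) * obs r p i) (channelLaw μ) :=
    fun i => (h.memLp_condMean hr r i).integrable_fun_mul (memLp_obs_coord h2 r i)
  calc _ ≤ ∫ p, r * ∑ i, condMean μ r i (obs r p) * obs r p i ∂(channelLaw μ) :=
        integral_mono (h.integrable_log_partitionFn_obs r r)
          ((integrable_finsetSum _ fun i _ => hi i).const_mul r) fun p =>
          log_partitionFn_le_sum h2 r _
    _ = _ := by
      rw [integral_const_mul, integral_finsetSum _ fun i _ => hi i]
      simp_rw [h.integral_condMean_mul_obs hr]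
      simp
      ring

/-- By Gibbs' inequality the likelihood of the true strength is the largest on average, so the
envelope theorem applies. With ρ frozen the derivative is ρ E⟨X, M⟩, which the tower property turns
into r E|M|². -/
theorem IsIsotropic.hasDerivAt_logPartition (h : IsIsotropic μ) (hr : 0 < r) :
    HasDerivAt (logPartition μ) (r * estEnergy μ r) r := by
  have h2 := h.integrable_norm_sq
  have hcM := fun i => continuous_condMean h2 i
  have hm' := fun (ρ : ℝ) i => measurable_condMean (r := ρ) h2 i
  have key := hasDerivAt_integral_diag_of_le (P := channelLaw μ) (r₀ := r)
    (I := Set.Ioo (r / 2) (2 * r)) (bound := fun p => d * (2 * r * channelBound r p))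
    (G := fun ρ s p => Real.log (partitionFn μ ρ (obs s p)))
    (G' := fun ρ s p => ρ * ∑ i, p.1 i * condMean μ ρ i (obs s p))
    isOpen_Ioo ⟨by linarith, by linarith⟩ (convex_Ioo _ _)
    (((integrable_channelBound h2 r).const_mul _).const_mul _) ?_ ?_ ?_ ?_ ?_ ?_
  · refine key.congr_deriv ?_
    have mx := fun i => memLp_fst_coord h2 i
    have m1 := fun i => h.memLp_condMean hr r i
    rw [integral_const_mul, integral_finsetSum _ fun i _ => (mx i).integrable_fun_mul (m1 i),
      estEnergy, integral_finsetSum _ fun i _ => (m1 i).integrable_sq]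
    congr 1
    refine Finset.sum_congr rfl fun i _ => ?_
    have := h.integral_mul_fst hr (hm' r i) (m1 i) i
    simp_rw [mul_comm (_ : ℝ) (condMean μ r i _), sq]
    exact this
  · exact fun ρ hρ s hs => h.integrable_log_partitionFn_obs ρ s
  · intro ρ hρ s hs
    refine Measurable.aestronglyMeasurable (Measurable.const_mul (Finset.measurable_sum _
      fun i _ => ?_) _)
    have := hm' ρ i
    fun_prop
  · intro ρ hρ s hs p
    exact hasDerivAt_log_partitionFn_obs h2 (by linarith [hρ.1]) s p
  · intro ρ hρ s hs p
    have hρ0 : 0 < ρ := by linarith [hρ.1]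
    have hB : 0 ≤ channelBound r p := by unfold channelBound; positivity
    have key : ∀ i : Fin d, |p.1 i * condMean μ ρ i (obs s p)| ≤ channelBound r p := by
      intro i
      have b2 := h.condMean_obs_sq_le hr hρ hs i p
      have b3 := coord_sq_le p.1 i
      rw [abs_le]
      constructor <;>
      nlinarith [sq_nonneg (p.1 i - condMean μ ρ i (obs s p)),
        sq_nonneg (p.1 i + condMean μ ρ i (obs s p))]
    rw [abs_mul, abs_of_pos hρ0]
    calc _ ≤ (2 * r) * ∑ i : Fin d, channelBound r p :=
          mul_le_mul hρ.2.le ((Finset.abs_sum_le_sum_abs _ _).trans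
            (Finset.sum_le_sum fun i _ => key i)) (abs_nonneg _) (by positivity)
      _ = _ := by simp; ring
  · intro p
    refine continuous_fst.mul (continuous_finsetSum _ fun i _ => ?_)
    have c0 : Continuous fun q : ℝ × ℝ => (q.1, obs q.2 p) := by fun_prop
    have c2 := (hcM i).comp c0
    simp only [Function.comp_def] at c2
    fun_prop
  · exact fun ρ hρ s hs => h.integral_log_partitionFn_obs_le ρ s

end LogPartition

/-! ### The Efron-Stein inequality. -/

section EfronStein

variable {X Y : Type*} [MeasurableSpace X] [MeasurableSpace Y] {P : Measure X} {Q : Measure Y}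
  [IsProbabilityMeasure P] [IsProbabilityMeasure Q]

lemma sq_integral_le_integral_sq {s : X → ℝ} (hs : MemLp s 2 P) :
    (∫ x, s x ∂P) ^ 2 ≤ ∫ x, s x ^ 2 ∂P := by
  have h1 := variance_eq_sub hs
  have h2 := variance_nonneg s P
  simp only [Pi.pow_apply] at h1
  linarith

lemma ae_memLp_of_memLp_prod {F : X × Y → ℝ} (hF : MemLp F 2 (P.prod Q)) :
    ∀ᵐ x ∂P, MemLp (fun y => F (x, y)) 2 Q := by
  filter_upwards [hF.integrable_sq.prod_right_ae, hF.1.prodMk_left] with x hx hx'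
  exact (memLp_two_iff_integrable_sq hx').2 hx

lemma memLp_integral_prod {F : X × Y → ℝ} (hF : MemLp F 2 (P.prod Q)) :
    MemLp (fun x => ∫ y, F (x, y) ∂Q) 2 P := by
  have hm : AEStronglyMeasurable (fun x => ∫ y, F (x, y) ∂Q) P := hF.1.integral_prod_right'
  rw [memLp_two_iff_integrable_sq hm]
  refine hF.integrable_sq.integral_prod_left.mono' (hm.pow 2) ?_
  filter_upwards [ae_memLp_of_memLp_prod hF] with x hx
  rw [Real.norm_of_nonneg (sq_nonneg _)]
  exact sq_integral_le_integral_sq hx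

lemma integral_sq_integral_le {F : X × Y → ℝ} (hF : MemLp F 2 (P.prod Q)) :
    ∫ x, (∫ y, F (x, y) ∂Q) ^ 2 ∂P ≤ ∫ p, F p ^ 2 ∂(P.prod Q) := by
  rw [integral_prod _ hF.integrable_sq]
  refine integral_mono_ae (memLp_integral_prod hF).integrable_sq
    hF.integrable_sq.integral_prod_left ?_
  filter_upwards [ae_memLp_of_memLp_prod hF] with x hx
  exact sq_integral_le_integral_sq hx

lemma integral_sub_const_sq {s : X → ℝ} (hs : MemLp s 2 P) :
    ∫ x, (s x - ∫ y, s y ∂P) ^ 2 ∂P = ∫ x, s x ^ 2 ∂P - (∫ x, s x ∂P) ^ 2 := by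
  rw [← variance_eq_integral hs.1.aemeasurable, variance_eq_sub hs]
  rfl

/-- The Efron-Stein inequality for two variables. -/
lemma efronStein {F : X × Y → ℝ} (hF : MemLp F 2 (P.prod Q)) :
    ∫ x, (∫ y, F (x, y) ∂Q) ^ 2 ∂P + ∫ y, (∫ x, F (x, y) ∂P) ^ 2 ∂Q ≤
      ∫ p, F p ^ 2 ∂(P.prod Q) + (∫ p, F p ∂(P.prod Q)) ^ 2 := by
  have hFi := hF.integrable one_le_two
  have hFs : MemLp (fun p : Y × X => F p.swap) 2 (Q.prod P) :=
    hF.comp_measurePreserving Measure.measurePreserving_swap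
  set B : X → ℝ := fun x => ∫ y, F (x, y) ∂Q with hB
  have hBm : MemLp B 2 P := memLp_integral_prod hF
  have hBp : MemLp (fun p : X × Y => B p.1) 2 (P.prod Q) :=
    hBm.comp_measurePreserving measurePreserving_fst
  set H : X × Y → ℝ := fun p => F p - B p.1 with hH
  have hHm : MemLp H 2 (P.prod Q) := hF.sub hBp
  have hHs : MemLp (fun p : Y × X => H p.swap) 2 (Q.prod P) :=
    hHm.comp_measurePreserving Measure.measurePreserving_swap
  have i1 := hF.integrable_sq
  have i2 := hF.integrable_fun_mul hBp
  have i3 := hBp.integrable_sq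
  have e1 : ∫ p, H p ^ 2 ∂(P.prod Q) = ∫ p, F p ^ 2 ∂(P.prod Q) - ∫ x, B x ^ 2 ∂P := by
    have e : ∀ p, H p ^ 2 = F p ^ 2 - (2 * (F p * B p.1) - B p.1 ^ 2) := fun p => by
      simp only [hH]; ring
    simp_rw [e]
    have i4 : Integrable (fun p : X × Y => 2 * (F p * B p.1) - B p.1 ^ 2) (P.prod Q) :=
      (i2.const_mul 2).sub i3
    rw [integral_sub i1 i4, integral_sub (i2.const_mul 2) i3, integral_const_mul,
      integral_prod _ i2, integral_prod _ i3]
    simp_rw [integral_mul_const]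
    simp only [integral_const, probReal_univ, one_smul, hB, ← sq]
    ring
  -- Subtract from F its mean over the second variable, then apply Jensen to the integral of the
  -- difference over the first variable.
  have h2 := integral_sq_integral_le hHs
  have e3 : ∫ p : Y × X, H p.swap ^ 2 ∂(Q.prod P) = ∫ p, H p ^ 2 ∂(P.prod Q) :=
    integral_prod_swap (fun p => H p ^ 2)
  rw [e3, e1] at h2
  have hA : MemLp (fun y => ∫ x, F (x, y) ∂P) 2 Q := memLp_integral_prod hFs
  have e4 : ∫ y, ∫ x, F (x, y) ∂P ∂Q = ∫ p, F p ∂(P.prod Q) := (integral_prod_symm _ hFi).symm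
  have e5 : ∫ x, B x ∂P = ∫ p, F p ∂(P.prod Q) := (integral_prod _ hFi).symm
  have e6 : ∫ y, (∫ x, H (y, x).swap ∂P) ^ 2 ∂Q =
      ∫ y, ((∫ x, F (x, y) ∂P) - ∫ y, ∫ x, F (x, y) ∂P ∂Q) ^ 2 ∂Q := by
    refine integral_congr_ae ?_
    filter_upwards [ae_memLp_of_memLp_prod hFs] with y hy
    have i6 : Integrable (fun x => F (x, y)) P := hy.integrable one_le_two
    simp only [hH, Prod.swap_prod_mk]
    rw [integral_sub i6 (hBm.integrable one_le_two), e4, e5]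
  rw [e6, integral_sub_const_sq hA, e4] at h2
  linarith

end EfronStein

/-! ### The spectral gap of the output and its consequence for conditional means. -/

section ChannelPoincare

variable {d : ℕ} {μ : Measure (EuclideanSpace ℝ (Fin d))} [IsProbabilityMeasure μ] {r c : ℝ}
  {f : EuclideanSpace ℝ (Fin d) → ℝ}

lemma SatisfiesPoincare.mul_variance_le (hP : SatisfiesPoincare μ c) (hc : 0 ≤ c)
    {s : EuclideanSpace ℝ (Fin d) → ℝ} (hs : ContDiff ℝ ∞ s) (hs2 : MemLp s 2 μ)
    (hg : Integrable (fun x => ‖fderiv ℝ s x‖ ^ 2) μ) :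
    c * (∫ x, s x ^ 2 ∂μ - (∫ x, s x ∂μ) ^ 2) ≤ ∫ x, ‖fderiv ℝ s x‖ ^ 2 ∂μ := by
  have hsi := hs2.integrable one_le_two
  set a := ∫ x, s x ∂μ with ha
  have hm : MemLp (fun x => s x - a) 2 μ := hs2.sub (memLp_const a)
  have key := hP (fun x => s x - a) (hs.sub contDiff_const) (hsi.sub (integrable_const a)) (by
    rw [integral_sub hsi (integrable_const a)]; simp [ha])
  have e1 : ∀ x, ‖∇ (fun x => s x - a) x‖ₑ ^ 2 = ENNReal.ofReal (‖fderiv ℝ s x‖ ^ 2) := by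
    intro x
    rw [gradient, ENNReal.ofReal_pow (norm_nonneg _), ofReal_norm]
    rw [← ofReal_norm, LinearIsometryEquiv.norm_map, fderiv_sub_const,
      ofReal_norm]
  have e2 : ∀ x, ‖s x - a‖ₑ ^ 2 = ENNReal.ofReal ((s x - a) ^ 2) := by
    intro x
    rw [← sq_abs, ENNReal.ofReal_pow (abs_nonneg _), ← Real.norm_eq_abs, ofReal_norm]
  simp_rw [e1, e2] at key
  rw [← ofReal_integral_eq_lintegral_ofReal hm.integrable_sq (.of_forall fun x => sq_nonneg _),
    ← ofReal_integral_eq_lintegral_ofReal hg (.of_forall fun x => sq_nonneg _),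
    ← ENNReal.ofReal_mul hc, ENNReal.ofReal_le_ofReal_iff (integral_nonneg fun x => sq_nonneg _),
    integral_sub_const_sq hs2] at key
  exact key

/-- Test on a coordinate function, which has variance 1 and gradient of norm 1; a coordinate exists
because d ≥ 1. -/
lemma SatisfiesPoincare.le_one (hP : SatisfiesPoincare μ c) (hc : 0 ≤ c) (h : IsIsotropic μ)
    (hd : 1 ≤ d) : c ≤ 1 := by
  have h2 := h.integrable_norm_sq
  let i : Fin d := ⟨0, hd⟩
  have hm : MemLp (fun x : EuclideanSpace ℝ (Fin d) => x i) 2 μ :=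
    memLp_two_of_sq_le (by fun_prop) h2 fun x => coord_sq_le x i
  have hD : ∀ x, ‖fderiv ℝ (fun x : EuclideanSpace ℝ (Fin d) => x i) x‖ = 1 := by
    intro x
    have e : (fun x : EuclideanSpace ℝ (Fin d) => x i) =
        innerSL ℝ (EuclideanSpace.single i (1:ℝ)) := by
      ext x; simp [EuclideanSpace.inner_single_left]
    rw [e, ContinuousLinearMap.fderiv, innerSL_apply_norm]
    simp
  have key := hP.mul_variance_le hc (s := fun x => x i) (by fun_prop) hm (by
    simp_rw [hD]; exact integrable_const _)
  simp_rw [hD, h.integral_coord, sq (_ : ℝ), h.covariance] at key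
  simpa using key

lemma memLp_comp_obs_of_fderiv_le (h2 : Integrable (fun x => ‖x‖ ^ 2) μ)
    {g : EuclideanSpace ℝ (Fin d) → ℝ} (hg : ContDiff ℝ 1 g) {M : ℝ}
    (hM : ∀ w, ‖fderiv ℝ g w‖ ≤ M) (r : ℝ) :
    MemLp (fun p => g (obs r p)) 2 (channelLaw μ) := by
  have hgc := hg.continuous
  refine memLp_two_of_sq_le (g := fun p => 2 * |g 0| ^ 2 + 2 * M ^ 2 * ‖obs r p‖ ^ 2)
    (Continuous.aestronglyMeasurable (by fun_prop))
    ((integrable_const _).add ((integrable_norm_sq_obs h2 r).const_mul _)) fun p => ?_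
  have h1 := abs_le_of_fderiv_le (hg.differentiable one_ne_zero) hM (obs r p)
  rw [← sq_abs]
  calc _ ≤ (|g 0| + M * ‖obs r p‖) ^ 2 := pow_le_pow_left₀ (abs_nonneg _) h1 2
    _ ≤ _ := by nlinarith [sq_nonneg (|g 0| - M * ‖obs r p‖)]

/-- The Poincaré inequality for the output of the Gaussian channel. -/
lemma SatisfiesPoincare.variance_obs_le (hP : SatisfiesPoincare μ c) (hc : 0 < c)
    (h2 : Integrable (fun x => ‖x‖ ^ 2) μ) {g : EuclideanSpace ℝ (Fin d) → ℝ}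
    (hg : ContDiff ℝ ∞ g) {M : ℝ} (hM : ∀ w, ‖fderiv ℝ g w‖ ≤ M) (r : ℝ) :
    c * (∫ p, g (obs r p) ^ 2 ∂(channelLaw μ) - (∫ p, g (obs r p) ∂(channelLaw μ)) ^ 2) ≤
      (c + r ^ 2) * ∫ p, ‖fderiv ℝ g (obs r p)‖ ^ 2 ∂(channelLaw μ) := by
  have hg1 : ContDiff ℝ 1 g := hg.of_le (by exact_mod_cast le_top)
  have hgd : Differentiable ℝ g := hg1.differentiable (by simp)
  have hM0 : 0 ≤ M := (norm_nonneg _).trans (hM 0)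
  have hF := memLp_comp_obs_of_fderiv_le h2 hg1 hM r
  have hfc : Continuous (fderiv ℝ g) := hg1.continuous_fderiv (by simp)
  have hD : Integrable (fun p => ‖fderiv ℝ g (obs r p)‖ ^ 2) (channelLaw μ) := by
    refine (integrable_const (M ^ 2)).mono' (Continuous.aestronglyMeasurable (by fun_prop))
      (.of_forall fun p => ?_)
    rw [Real.norm_of_nonneg (sq_nonneg _)]
    exact pow_le_pow_left₀ (norm_nonneg _) (hM _) 2
  have hFs : MemLp (fun p : EuclideanSpace ℝ (Fin d) × EuclideanSpace ℝ (Fin d) =>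
      g (obs r p.swap)) 2 ((stdGaussian _).prod μ) :=
    hF.comp_measurePreserving Measure.measurePreserving_swap
  -- The variance is at most the sum of the mean variances in the noise and in the signal. The
  -- Gaussian inequality handles the first, the assumed one the second, where the gradient in `x`
  -- carries a factor `r`.
  have es := efronStein hF
  have hsqi := hF.integrable_sq
  -- the variance in the noise
  have v1 : ∫ p, g (obs r p) ^ 2 ∂(channelLaw μ) -
      ∫ x, (∫ z, g (obs r (x, z)) ∂(stdGaussian _)) ^ 2 ∂μ ≤
        ∫ p, ‖fderiv ℝ g (obs r p)‖ ^ 2 ∂(channelLaw μ) := by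
    rw [integral_prod _ hsqi, integral_prod _ hD,
      ← integral_sub hsqi.integral_prod_left (memLp_integral_prod hF).integrable_sq]
    refine integral_mono (hsqi.integral_prod_left.sub (memLp_integral_prod hF).integrable_sq)
      hD.integral_prod_left fun x => ?_
    have e : ∀ z, fderiv ℝ (fun z => g (obs r (x, z))) z = fderiv ℝ g (obs r (x, z)) := by
      intro z
      simp only [obs]
      rw [fderiv_comp_add_left]
    have := stdGaussian_poincare (g := fun z => g (obs r (x, z))) (M := M)
      (by unfold obs; fun_prop) (fun z => by rw [e]; exact hM _)
    simp only [e] at this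
    exact this
  -- the variance in the signal
  have v2 : c * (∫ p, g (obs r p) ^ 2 ∂(channelLaw μ) -
      ∫ z, (∫ x, g (obs r (x, z)) ∂μ) ^ 2 ∂(stdGaussian _)) ≤
        r ^ 2 * ∫ p, ‖fderiv ℝ g (obs r p)‖ ^ 2 ∂(channelLaw μ) := by
    have j1 := memLp_integral_prod hFs
    simp only [Prod.swap_prod_mk] at j1
    have j2 : Integrable (fun z => ∫ x, g (obs r (x, z)) ^ 2 ∂μ) (stdGaussian _) :=
      hsqi.integral_prod_right
    have j3 : Integrable (fun z => ∫ x, ‖fderiv ℝ g (obs r (x, z))‖ ^ 2 ∂μ) (stdGaussian _) :=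
      hD.integral_prod_right
    rw [integral_prod_symm _ hsqi, integral_prod_symm _ hD,
      ← integral_sub j2 j1.integrable_sq, ← integral_const_mul, ← integral_const_mul]
    refine integral_mono_ae ((j2.sub j1.integrable_sq).const_mul c) (j3.const_mul _) ?_
    filter_upwards [ae_memLp_of_memLp_prod hFs] with z hz
    have e : ∀ x, fderiv ℝ (fun x => g (obs r (x, z))) x = r • fderiv ℝ g (obs r (x, z)) := by
      intro x
      have h1 : HasFDerivAt (fun x => obs r (x, z))
          (r • ContinuousLinearMap.id ℝ (EuclideanSpace ℝ (Fin d))) x := by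
        simp only [obs]
        exact ((hasFDerivAt_id x).const_smul r).add_const z
      have h3 : HasFDerivAt (fun x => g (obs r (x, z))) _ x := (hgd _).hasFDerivAt.comp x h1
      rw [h3.fderiv]
      ext v
      simp
    have e' : ∀ x, ‖fderiv ℝ (fun x => g (obs r (x, z))) x‖ ^ 2 =
        r ^ 2 * ‖fderiv ℝ g (obs r (x, z))‖ ^ 2 := by
      intro x
      rw [e, norm_smul, mul_pow, Real.norm_eq_abs, sq_abs]
    have := hP.mul_variance_le hc.le (s := fun x => g (obs r (x, z))) (by unfold obs; fun_prop) hz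
      (by
        simp_rw [e']
        refine (integrable_const (r ^ 2 * M ^ 2)).mono'
          (Continuous.aestronglyMeasurable (by unfold obs; fun_prop)) (.of_forall fun x => ?_)
        rw [Real.norm_of_nonneg (by positivity)]
        exact mul_le_mul_of_nonneg_left (pow_le_pow_left₀ (norm_nonneg _) (hM _) 2) (sq_nonneg r))
    simp_rw [e'] at this
    rw [integral_const_mul] at this
    exact this
  have v1' := mul_le_mul_of_nonneg_left v1 hc.le
  have es' := mul_le_mul_of_nonneg_left es hc.le
  linarith

lemma IsIsotropic.integral_condMean (h : IsIsotropic μ) (hr : 0 < r) (i : Fin d) :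
    ∫ p, condMean μ r i (obs r p) ∂(channelLaw μ) = 0 := by
  have h2 := h.integrable_norm_sq
  have := h.integral_mul_fst hr (F := fun _ => 1) measurable_const (memLp_const 1) i
  simp only [one_mul] at this
  rw [← this, integral_prod _ ((memLp_fst_coord h2 i).integrable one_le_two)]
  simp [h.integral_coord]

lemma IsIsotropic.integral_obs (h : IsIsotropic μ) (r : ℝ) (i : Fin d) :
    ∫ p, obs r p i ∂(channelLaw μ) = 0 := by
  have h2 := h.integrable_norm_sq
  rw [integral_prod _ ((memLp_obs_coord h2 r i).integrable one_le_two)]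
  have e : ∀ x : EuclideanSpace ℝ (Fin d),
      ∫ z, obs r (x, z) i ∂(stdGaussian (EuclideanSpace ℝ (Fin d))) = r * x i := by
    intro x
    simp only [obs, PiLp.add_apply, PiLp.smul_apply, smul_eq_mul]
    rw [integral_add (integrable_const _) (integrable_coord integrable_norm_sq_stdGaussian i),
      integral_coord_stdGaussian]
    simp
  simp_rw [e]
  rw [integral_const_mul, h.integral_coord, mul_zero]

/-- The sum of the squares of the entries of the mean conditional covariance matrix. -/
noncomputable def meanCovEnergy (μ : Measure (EuclideanSpace ℝ (Fin d))) (r : ℝ) : ℝ :=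
  ∑ i, ∑ j, meanCov μ r i j ^ 2

lemma IsIsotropicLogConcave.integral_sub_meanCov_sq (h : IsIsotropicLogConcave μ f) (hr : 0 < r)
    (i j : Fin d) : ∫ p, (condCov μ r i j (obs r p) - meanCov μ r i j) ^ 2 ∂(channelLaw μ) =
      ∫ p, condCov μ r i j (obs r p) ^ 2 ∂(channelLaw μ) - meanCov μ r i j ^ 2 :=
  integral_sub_const_sq (h.memLp_condCov hr r i j)

/-- The consequence of the Poincaré inequality for the conditional expectation. -/
theorem IsIsotropicLogConcave.mul_le_of_poincare (h : IsIsotropicLogConcave μ f)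
    (hP : SatisfiesPoincare μ c) (hc : 0 < c) (hr : 0 < r) :
    c * (d - (1 + 2 * r ^ 2) * ∑ i, meanCov μ r i i + r ^ 2 * (1 + r ^ 2) * meanCovEnergy μ r) ≤
      (c + r ^ 2) * (r ^ 2 * (covEnergy μ r - meanCovEnergy μ r)) := by
  have h2 := h.isIsotropic.integrable_norm_sq
  set N := meanCov μ r with hN
  have mO := fun j => memLp_obs_coord h2 r j
  have mC := fun i => h.isIsotropic.memLp_condMean hr r i
  have key : ∀ k : Fin d, c * ((1 - N k k) - 2 * r ^ 2 * N k k +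
      r ^ 2 * (1 + r ^ 2) * ∑ j, N k j ^ 2) ≤
        (c + r ^ 2) * (r ^ 2 * ∑ j, (∫ p, condCov μ r k j (obs r p) ^ 2 ∂(channelLaw μ) -
          N k j ^ 2)) := by
    intro k
    -- The subtracted linear function has the mean gradient of the conditional mean, so the gradient
    -- of `g` is centred and its energy is r² times the variance of row k of C.
    set g : EuclideanSpace ℝ (Fin d) → ℝ := fun w => condMean μ r k w - r * ∑ j, N k j * w j
      with hg
    have hgs : ContDiff ℝ ∞ g := by
      have := contDiff_condMean h2 hr k
      fun_prop
    have hD : ∀ w, ‖fderiv ℝ g w‖ ^ 2 = r ^ 2 * ∑ j, (condCov μ r k j w - N k j) ^ 2 := by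
      intro w
      have e : fderiv ℝ g w = innerSL ℝ (WithLp.toLp 2 fun j => r * (condCov μ r k j w - N k j)) := by
        ext v
        have hd1 : DifferentiableAt ℝ (condMean μ r k) w :=
          (contDiff_condMean h2 hr k).differentiable (by simp) w
        have hl : HasFDerivAt (fun w : EuclideanSpace ℝ (Fin d) => r * ∑ j, N k j * w j)
            (innerSL ℝ (WithLp.toLp 2 fun j => r * N k j)) w := by
          have e2 : (fun w : EuclideanSpace ℝ (Fin d) => r * ∑ j, N k j * w j) =
              innerSL ℝ (WithLp.toLp 2 fun j => r * N k j) := by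
            ext w
            rw [innerSL_apply_apply, real_inner_comm, inner_eq_sum_coord, Finset.mul_sum]
            exact Finset.sum_congr rfl fun j _ => by simp only; ring
          rw [e2]
          exact (innerSL ℝ (WithLp.toLp 2 fun j => r * N k j)).hasFDerivAt
        rw [(show HasFDerivAt g _ w from hd1.hasFDerivAt.sub hl).fderiv, _root_.sub_apply, fderiv_condMean_apply h2 hr,
          innerSL_apply_apply, innerSL_apply_apply, real_inner_comm, inner_eq_sum_coord,
          real_inner_comm, inner_eq_sum_coord, Finset.mul_sum, ← Finset.sum_sub_distrib]
        exact Finset.sum_congr rfl fun j _ => by simp only; ring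
      rw [e, innerSL_apply_norm, EuclideanSpace.real_norm_sq_eq, Finset.mul_sum]
      exact Finset.sum_congr rfl fun j _ => by simp only; ring
    have hb : ∀ w, ‖fderiv ℝ g w‖ ≤
        √(r ^ 2 * ∑ j, (1 / r ^ 2 + |N k j|) ^ 2) := by
      intro w
      rw [← Real.sqrt_sq (norm_nonneg (fderiv ℝ g w)), hD]
      refine Real.sqrt_le_sqrt (mul_le_mul_of_nonneg_left (Finset.sum_le_sum fun j _ => ?_)
        (sq_nonneg r))
      rw [← sq_abs]
      refine pow_le_pow_left₀ (abs_nonneg _) ((abs_sub _ _).trans ?_) 2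
      have := h.abs_condCov_le hr k j w
      linarith
    have hv := hP.variance_obs_le hc h2 hgs hb r
    have mS : MemLp (fun p => ∑ j, N k j * obs r p j) 2 (channelLaw μ) :=
      memLp_finsetSum _ fun j _ => (mO j).const_mul (N k j)
    have e0 : ∫ p, g (obs r p) ∂(channelLaw μ) = 0 := by
      simp only [hg]
      rw [integral_sub ((mC k).integrable one_le_two) ((mS.integrable one_le_two).const_mul r),
        h.isIsotropic.integral_condMean hr, integral_const_mul,
        integral_finsetSum _ fun j _ => ((mO j).integrable one_le_two).const_mul (N k j)]
      simp_rw [integral_const_mul, h.isIsotropic.integral_obs]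
      simp
    have e1 : ∫ p, condMean μ r k (obs r p) ^ 2 ∂(channelLaw μ) = 1 - N k k := by
      simp_rw [sq]
      rw [h.integral_condMean_mul hr]
      simp [hN]
    have e2 : ∫ p, condMean μ r k (obs r p) * ∑ j, N k j * obs r p j ∂(channelLaw μ) =
        r * N k k := by
      simp_rw [Finset.mul_sum, mul_left_comm]
      rw [integral_finsetSum _ fun j _ => ((mC k).integrable_fun_mul (mO j)).const_mul (N k j)]
      simp_rw [integral_const_mul, h.isIsotropic.integral_condMean_mul_obs hr]
      simp
      ring
    have e3 : ∫ p, (∑ j, N k j * obs r p j) ^ 2 ∂(channelLaw μ) =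
        (1 + r ^ 2) * ∑ j, N k j ^ 2 := by
      simp_rw [sq (∑ j, N k j * obs r _ j), Finset.sum_mul_sum]
      have i1 : ∀ i j, Integrable (fun p => N k i * obs r p i * (N k j * obs r p j))
        (channelLaw μ) := fun i j => ((mO i).const_mul _).integrable_fun_mul ((mO j).const_mul _)
      rw [integral_finsetSum _ fun i _ => integrable_finsetSum _ fun j _ => i1 i j, Finset.mul_sum]
      refine Finset.sum_congr rfl fun i _ => ?_
      rw [integral_finsetSum _ fun j _ => i1 i j]
      have e4 : ∀ j, ∫ p, N k i * obs r p i * (N k j * obs r p j) ∂(channelLaw μ) =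
          N k i * N k j * ((1 + r ^ 2) * if i = j then 1 else 0) := by
        intro j
        rw [← h.isIsotropic.integral_obs_mul_obs, ← integral_const_mul]
        exact integral_congr_ae (.of_forall fun p => by simp only; ring)
      simp_rw [e4]
      simp
      ring
    have e5 : ∫ p, g (obs r p) ^ 2 ∂(channelLaw μ) = (1 - N k k) - 2 * r ^ 2 * N k k +
        r ^ 2 * (1 + r ^ 2) * ∑ j, N k j ^ 2 := by
      have e : ∀ p, g (obs r p) ^ 2 = condMean μ r k (obs r p) ^ 2 -
          (2 * r * (condMean μ r k (obs r p) * ∑ j, N k j * obs r p j) -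
            r ^ 2 * (∑ j, N k j * obs r p j) ^ 2) := fun p => by simp only [hg]; ring
      simp_rw [e]
      have j1 := (mC k).integrable_sq
      have j2 := ((mC k).integrable_fun_mul mS).const_mul (2 * r)
      have j3 := mS.integrable_sq.const_mul (r ^ 2)
      have j4 : Integrable (fun p =>
          (2 * r * (condMean μ r k (obs r p) * ∑ j, N k j * obs r p j) -
            r ^ 2 * (∑ j, N k j * obs r p j) ^ 2)) (channelLaw μ) := j2.sub j3
      rw [integral_sub j1 j4, integral_sub j2 j3, integral_const_mul, integral_const_mul, e1, e2,
        e3]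
      ring
    have e6 : ∫ p, ‖fderiv ℝ g (obs r p)‖ ^ 2 ∂(channelLaw μ) =
        r ^ 2 * ∑ j, (∫ p, condCov μ r k j (obs r p) ^ 2 ∂(channelLaw μ) - N k j ^ 2) := by
      simp_rw [hD]
      rw [integral_const_mul, integral_finsetSum]
      · simp_rw [hN, h.integral_sub_meanCov_sq hr]
      · intro j _
        exact ((h.memLp_condCov hr r k j).sub (memLp_const _)).integrable_sq
    rw [e0, e5, e6] at hv
    simpa using hv
  -- Summing over the rows gives the trace and the Hilbert-Schmidt norm of the mean covariance.
  have hsum := Finset.sum_le_sum fun k (_ : k ∈ Finset.univ) => key k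
  rw [← Finset.mul_sum, ← Finset.mul_sum, ← Finset.mul_sum, Finset.sum_add_distrib,
    Finset.sum_sub_distrib, Finset.sum_sub_distrib, ← Finset.mul_sum, ← Finset.mul_sum] at hsum
  simp_rw [Finset.sum_sub_distrib] at hsum
  rw [h.covEnergy_eq hr, meanCovEnergy]
  simp only [Finset.sum_const, Finset.card_univ, Fintype.card_fin, nsmul_eq_mul, mul_one] at hsum
  refine le_trans (le_of_eq ?_) hsum
  rw [← hN]
  ring

end ChannelPoincare

/-! ### Two independent copies of the channel. -/

section TwoChannels

variable {d : ℕ}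

/-- Pairs of an input and a noise of the Gaussian channel. -/
abbrev ChannelSpace (d : ℕ) : Type := EuclideanSpace ℝ (Fin d) × EuclideanSpace ℝ (Fin d)

/-- The normalized sum of two copies of the channel. -/
noncomputable def channelMid (p : ChannelSpace d × ChannelSpace d) : ChannelSpace d :=
  ((√2 : ℝ)⁻¹ • (p.1.1 + p.2.1), (√2 : ℝ)⁻¹ • (p.1.2 + p.2.2))

@[fun_prop]
lemma continuous_channelMid : Continuous (channelMid (d := d)) := by unfold channelMid; fun_prop

lemma obs_channelMid (r : ℝ) (p : ChannelSpace d × ChannelSpace d) :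
    obs r (channelMid p) = (√2 : ℝ)⁻¹ • (obs r p.1 + obs r p.2) := by
  simp only [obs, channelMid]
  module

/-- The normalized sum is the first component of the rotation by π/4. -/
lemma selfConvolution_stdGaussian :
    selfConvolution (stdGaussian (EuclideanSpace ℝ (Fin d))) = stdGaussian _ := by
  have h := measurePreserving_fst.comp
    (map_rotation_stdGaussian (E := EuclideanSpace ℝ (Fin d)) (Real.pi / 4))
  refine Eq.trans ?_ h.map_eq
  rw [selfConvolution]
  congr 1
  ext p : 1
  have e : (√2 : ℝ)⁻¹ = √2 / 2 := by
    rw [inv_eq_one_div, div_eq_div_iff (by positivity) (by positivity)]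
    rw [Real.mul_self_sqrt (by norm_num)]; norm_num
  simp [ContinuousLinearMap.rotation_apply, Real.cos_pi_div_four, Real.sin_pi_div_four, e]

variable {μ : Measure (EuclideanSpace ℝ (Fin d))} [IsProbabilityMeasure μ] {r : ℝ}
  {f : EuclideanSpace ℝ (Fin d) → ℝ}

/-- The normalized sum of two standard noises is again a standard noise, independent of the inputs.
So averaging two channels produces one channel of the same strength whose input is (X + Y)/√2. -/
lemma measurePreserving_channelMid :
    MeasurePreserving channelMid ((channelLaw μ).prod (channelLaw μ))
      (channelLaw (selfConvolution μ)) := by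
  refine ⟨by fun_prop, Measure.ext_of_lintegral _ fun F hF => ?_⟩
  have hm := (continuous_channelMid (d := d)).measurable
  have hm' : Measurable fun p : ChannelSpace d × ChannelSpace d => F (channelMid p) := by fun_prop
  rw [lintegral_map hF hm, lintegral_prod _ hm'.aemeasurable,
    lintegral_prod _ hm'.lintegral_prod_right'.aemeasurable]
  have hm2 : Measurable fun p : ChannelSpace d =>
      ∫⁻ s, F ((√2 : ℝ)⁻¹ • (p.1 + p.2), s) ∂(stdGaussian (EuclideanSpace ℝ (Fin d))) :=
    hF.lintegral_prod_right'.comp (f := fun p : ChannelSpace d => (√2 : ℝ)⁻¹ • (p.1 + p.2))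
      (by fun_prop)
  have h1 : ∀ x z, ∫⁻ q, F (channelMid ((x, z), q)) ∂(channelLaw μ) =
      ∫⁻ y, ∫⁻ z', F ((√2 : ℝ)⁻¹ • (x + y), (√2 : ℝ)⁻¹ • (z + z'))
        ∂(stdGaussian (EuclideanSpace ℝ (Fin d))) ∂μ := fun x z =>
    lintegral_prod _ (by fun_prop)
  have h2 : ∀ x, ∫⁻ z, ∫⁻ q, F (channelMid ((x, z), q)) ∂(channelLaw μ) ∂(stdGaussian _) =
      ∫⁻ y, ∫⁻ s, F ((√2 : ℝ)⁻¹ • (x + y), s) ∂(stdGaussian _) ∂μ := by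
    intro x
    simp_rw [h1]
    rw [lintegral_lintegral_swap]
    · refine lintegral_congr fun y => ?_
      conv_rhs => rw [← selfConvolution_stdGaussian]
      rw [lintegral_selfConvolution _ (by fun_prop), lintegral_prod _ (by fun_prop)]
    · exact (Measurable.lintegral_prod_right' (f := fun q : ChannelSpace d × _ =>
        F ((√2 : ℝ)⁻¹ • (x + q.1.2), (√2 : ℝ)⁻¹ • (q.1.1 + q.2))) (by fun_prop)).aemeasurable
  simp_rw [h2]
  rw [lintegral_prod _ hF.aemeasurable, lintegral_selfConvolution _ hF.lintegral_prod_right',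
    lintegral_prod _ hm2.aemeasurable]

lemma memLp_fst_channel {F : ChannelSpace d → ℝ} (hF : MemLp F 2 (channelLaw μ)) :
    MemLp (fun p : ChannelSpace d × ChannelSpace d => F p.1) 2
      ((channelLaw μ).prod (channelLaw μ)) :=
  MemLp.comp_measurePreserving hF measurePreserving_fst

lemma memLp_snd_channel {F : ChannelSpace d → ℝ} (hF : MemLp F 2 (channelLaw μ)) :
    MemLp (fun p : ChannelSpace d × ChannelSpace d => F p.2) 2
      ((channelLaw μ).prod (channelLaw μ)) :=
  MemLp.comp_measurePreserving hF measurePreserving_snd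

lemma memLp_swap_channel {F : ChannelSpace d × ChannelSpace d → ℝ}
    (hF : MemLp F 2 ((channelLaw μ).prod (channelLaw μ))) :
    MemLp (fun p : ChannelSpace d × ChannelSpace d => F p.swap) 2
      ((channelLaw μ).prod (channelLaw μ)) :=
  MemLp.comp_measurePreserving hF Measure.measurePreserving_swap

/-- Conditioning in the first channel with the second one frozen; the test function may depend on
everything in the second channel. -/
lemma IsIsotropic.integral_mul_fst_left (h : IsIsotropic μ) (hr : 0 < r)
    {F : EuclideanSpace ℝ (Fin d) × ChannelSpace d → ℝ} (hF : Measurable F)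
    (hF2 : MemLp (fun p : ChannelSpace d × ChannelSpace d => F (obs r p.1, p.2)) 2
      ((channelLaw μ).prod (channelLaw μ))) (i : Fin d) :
    ∫ p : ChannelSpace d × ChannelSpace d, F (obs r p.1, p.2) * p.1.1 i
        ∂((channelLaw μ).prod (channelLaw μ)) =
      ∫ p : ChannelSpace d × ChannelSpace d, F (obs r p.1, p.2) * condMean μ r i (obs r p.1)
        ∂((channelLaw μ).prod (channelLaw μ)) := by
  have h2 := h.integrable_norm_sq
  have m1 : MemLp (fun p : ChannelSpace d × ChannelSpace d => p.1.1 i) 2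
      ((channelLaw μ).prod (channelLaw μ)) :=
    memLp_fst_channel (memLp_fst_coord h2 i)
  have m2 : MemLp (fun p : ChannelSpace d × ChannelSpace d => condMean μ r i (obs r p.1)) 2
      ((channelLaw μ).prod (channelLaw μ)) :=
    memLp_fst_channel (h.memLp_condMean hr r i)
  have hFs : MemLp (fun p : ChannelSpace d × ChannelSpace d => F (obs r p.2, p.1)) 2
      ((channelLaw μ).prod (channelLaw μ)) :=
    memLp_swap_channel hF2
  rw [integral_prod_symm _ (hF2.integrable_fun_mul m1),
    integral_prod_symm _ (hF2.integrable_fun_mul m2)]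
  refine integral_congr_ae ?_
  filter_upwards [ae_memLp_of_memLp_prod hFs] with q hq
  exact h.integral_mul_fst hr (F := fun w => F (w, q)) (by fun_prop) hq i

lemma IsIsotropicLogConcave.integral_mul_fst_mul_fst_left (h : IsIsotropicLogConcave μ f)
    (hr : 0 < r) {F : EuclideanSpace ℝ (Fin d) × ChannelSpace d → ℝ} (hF : Measurable F) {B : ℝ}
    (hB : ∀ p, |F p| ≤ B) (i j : Fin d) :
    ∫ p : ChannelSpace d × ChannelSpace d, F (obs r p.1, p.2) * (p.1.1 i * p.1.1 j)
        ∂((channelLaw μ).prod (channelLaw μ)) =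
      ∫ p : ChannelSpace d × ChannelSpace d, F (obs r p.1, p.2) * (condCov μ r i j (obs r p.1) +
        condMean μ r i (obs r p.1) * condMean μ r j (obs r p.1))
        ∂((channelLaw μ).prod (channelLaw μ)) := by
  have h2 := h.isIsotropic.integrable_norm_sq
  have i1 : Integrable (fun p : ChannelSpace d × ChannelSpace d => p.1.1 i * p.1.1 j)
      ((channelLaw μ).prod (channelLaw μ)) :=
    ((memLp_fst_coord h2 i).integrable_fun_mul (memLp_fst_coord h2 j)).comp_fst _
  have i2 : Integrable (fun p : ChannelSpace d × ChannelSpace d => condCov μ r i j (obs r p.1) +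
      condMean μ r i (obs r p.1) * condMean μ r j (obs r p.1))
      ((channelLaw μ).prod (channelLaw μ)) :=
    Integrable.comp_fst (f := fun p => condCov μ r i j (obs r p) +
      condMean μ r i (obs r p) * condMean μ r j (obs r p)) ((h.integrable_condCov hr r i j).add
      ((h.isIsotropic.memLp_condMean hr r i).integrable_fun_mul
        (h.isIsotropic.memLp_condMean hr r j))) _
  have hm : AEStronglyMeasurable (fun p : ChannelSpace d × ChannelSpace d => F (obs r p.1, p.2))
      ((channelLaw μ).prod (channelLaw μ)) := Measurable.aestronglyMeasurable (by fun_prop)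
  rw [integral_prod_symm _ (integrable_mul_of_abs_le i1 hm fun p => hB _),
    integral_prod_symm _ (integrable_mul_of_abs_le i2 hm fun p => hB _)]
  refine integral_congr_ae (.of_forall fun q => ?_)
  exact h.integral_mul_fst_mul_fst hr (F := fun w => F (w, q)) (by fun_prop) (fun w => hB _) i j

/-- The conditional expectation of the normalized sum of the inputs given both outputs. -/
noncomputable def pairMean (μ : Measure (EuclideanSpace ℝ (Fin d))) (r : ℝ) (i : Fin d)
    (p : ChannelSpace d × ChannelSpace d) : ℝ :=
  (√2)⁻¹ * (condMean μ r i (obs r p.1) + condMean μ r i (obs r p.2))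

/-- The conditional covariance of the normalized sum of the inputs given both outputs. -/
noncomputable def pairCov (μ : Measure (EuclideanSpace ℝ (Fin d))) (r : ℝ) (i j : Fin d)
    (p : ChannelSpace d × ChannelSpace d) : ℝ :=
  1 / 2 * (condCov μ r i j (obs r p.1) + condCov μ r i j (obs r p.2))

lemma IsIsotropic.memLp_pairMean (h : IsIsotropic μ) (hr : 0 < r) (i : Fin d) :
    MemLp (pairMean μ r i) 2 ((channelLaw μ).prod (channelLaw μ)) :=
  ((memLp_fst_channel (h.memLp_condMean hr r i)).add
    (memLp_snd_channel (h.memLp_condMean hr r i))).const_mul _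

lemma IsIsotropicLogConcave.memLp_pairCov (h : IsIsotropicLogConcave μ f) (hr : 0 < r)
    (i j : Fin d) : MemLp (pairCov μ r i j) 2 ((channelLaw μ).prod (channelLaw μ)) :=
  ((memLp_fst_channel (h.memLp_condCov hr r i j)).add
    (memLp_snd_channel (h.memLp_condCov hr r i j))).const_mul _

end TwoChannels

/-! ### Conditioning the normalized sum on both outputs. -/

section PairConditioning

variable {d : ℕ} {μ : Measure (EuclideanSpace ℝ (Fin d))} [IsProbabilityMeasure μ] {r : ℝ}
  {f : EuclideanSpace ℝ (Fin d) → ℝ}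

lemma integral_swap_channel (F : ChannelSpace d × ChannelSpace d → ℝ) :
    ∫ p, F p.swap ∂((channelLaw μ).prod (channelLaw μ)) =
      ∫ p, F p ∂((channelLaw μ).prod (channelLaw μ)) := integral_prod_swap F

lemma IsIsotropic.integral_mul_fst_right (h : IsIsotropic μ) (hr : 0 < r)
    {F : EuclideanSpace ℝ (Fin d) × ChannelSpace d → ℝ} (hF : Measurable F)
    (hF2 : MemLp (fun p : ChannelSpace d × ChannelSpace d => F (obs r p.2, p.1)) 2
      ((channelLaw μ).prod (channelLaw μ))) (i : Fin d) :
    ∫ p : ChannelSpace d × ChannelSpace d, F (obs r p.2, p.1) * p.2.1 i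
        ∂((channelLaw μ).prod (channelLaw μ)) =
      ∫ p : ChannelSpace d × ChannelSpace d, F (obs r p.2, p.1) * condMean μ r i (obs r p.2)
        ∂((channelLaw μ).prod (channelLaw μ)) := by
  rw [← integral_swap_channel, ← integral_swap_channel (F := fun p =>
    F (obs r p.2, p.1) * condMean μ r i (obs r p.2))]
  exact h.integral_mul_fst_left hr hF (memLp_swap_channel hF2) i

lemma IsIsotropicLogConcave.integral_mul_fst_mul_fst_right (h : IsIsotropicLogConcave μ f)
    (hr : 0 < r) {F : EuclideanSpace ℝ (Fin d) × ChannelSpace d → ℝ} (hF : Measurable F) {B : ℝ}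
    (hB : ∀ p, |F p| ≤ B) (i j : Fin d) :
    ∫ p : ChannelSpace d × ChannelSpace d, F (obs r p.2, p.1) * (p.2.1 i * p.2.1 j)
        ∂((channelLaw μ).prod (channelLaw μ)) =
      ∫ p : ChannelSpace d × ChannelSpace d, F (obs r p.2, p.1) * (condCov μ r i j (obs r p.2) +
        condMean μ r i (obs r p.2) * condMean μ r j (obs r p.2))
        ∂((channelLaw μ).prod (channelLaw μ)) := by
  rw [← integral_swap_channel, ← integral_swap_channel (F := fun p =>
    F (obs r p.2, p.1) * (condCov μ r i j (obs r p.2) +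
        condMean μ r i (obs r p.2) * condMean μ r j (obs r p.2)))]
  exact h.integral_mul_fst_mul_fst_left hr hF hB i j

lemma channelMid_fst_apply (p : ChannelSpace d × ChannelSpace d) (i : Fin d) :
    (channelMid p).1 i = (√2)⁻¹ * (p.1.1 i + p.2.1 i) := by
  simp [channelMid, mul_add]

lemma obs_channelMid_swap (r : ℝ) (p : ChannelSpace d × ChannelSpace d) :
    obs r (channelMid p) = (√2 : ℝ)⁻¹ • (obs r p.2 + obs r p.1) := by
  rw [obs_channelMid, add_comm]

lemma inv_sqrt_two_mul_self : (√2 : ℝ)⁻¹ * (√2)⁻¹ = 1 / 2 := by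
  rw [← mul_inv, Real.mul_self_sqrt (by norm_num)]; norm_num

/-- Conditioning the normalized sum of the inputs on both outputs. -/
lemma IsIsotropic.integral_mul_channelMid (h : IsIsotropic μ) (hr : 0 < r)
    {G : EuclideanSpace ℝ (Fin d) → ℝ} (hG : Measurable G)
    (hG2 : MemLp (fun p => G (obs r (channelMid p))) 2 ((channelLaw μ).prod (channelLaw μ)))
    (i : Fin d) :
    ∫ p, G (obs r (channelMid p)) * (channelMid p).1 i ∂((channelLaw μ).prod (channelLaw μ)) =
      ∫ p, G (obs r (channelMid p)) * pairMean μ r i p ∂((channelLaw μ).prod (channelLaw μ)) := by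
  have h2 := h.integrable_norm_sq
  have m1 := memLp_fst_channel (memLp_fst_coord h2 i)
  have m2 := memLp_snd_channel (memLp_fst_coord h2 i)
  have m3 := memLp_fst_channel (h.memLp_condMean hr r i)
  have m4 := memLp_snd_channel (h.memLp_condMean hr r i)
  have a1 := h.integral_mul_fst_left hr
    (F := fun q => G ((√2 : ℝ)⁻¹ • (q.1 + obs r q.2))) (by fun_prop)
    (by simpa only [obs_channelMid] using hG2) i
  have a2 := h.integral_mul_fst_right hr
    (F := fun q => G ((√2 : ℝ)⁻¹ • (q.1 + obs r q.2))) (by fun_prop)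
    (by simpa only [obs_channelMid_swap] using hG2) i
  simp only [← obs_channelMid] at a1
  simp only [← obs_channelMid_swap] at a2
  have e1 : ∀ p : ChannelSpace d × ChannelSpace d,
      G (obs r (channelMid p)) * (channelMid p).1 i = (√2)⁻¹ *
        (G (obs r (channelMid p)) * p.1.1 i + G (obs r (channelMid p)) * p.2.1 i) := fun p => by
    rw [channelMid_fst_apply]; ring
  have e2 : ∀ p : ChannelSpace d × ChannelSpace d,
      G (obs r (channelMid p)) * pairMean μ r i p = (√2)⁻¹ *
        (G (obs r (channelMid p)) * condMean μ r i (obs r p.1) +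
          G (obs r (channelMid p)) * condMean μ r i (obs r p.2)) := fun p => by
    rw [pairMean]; ring
  simp_rw [e1, e2]
  rw [integral_const_mul, integral_const_mul,
    integral_add (hG2.integrable_fun_mul m1) (hG2.integrable_fun_mul m2),
    integral_add (hG2.integrable_fun_mul m3) (hG2.integrable_fun_mul m4), a1, a2]

lemma memLp_mul_of_abs_le {Ω : Type*} [MeasurableSpace Ω] {P : Measure Ω} {F g : Ω → ℝ}
    {B : ℝ} (hg : MemLp g 2 P) (hF : AEStronglyMeasurable F P) (hB : ∀ p, |F p| ≤ B) :
    MemLp (fun p => F p * g p) 2 P := by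
  refine memLp_two_of_sq_le (hF.mul hg.1) (hg.integrable_sq.const_mul (B ^ 2)) fun p => ?_
  rw [mul_pow, ← sq_abs (F p)]
  exact mul_le_mul_of_nonneg_right (pow_le_pow_left₀ (abs_nonneg _) (hB p) 2) (sq_nonneg _)

/-- Condition in one channel after the other. Conditionally on the two outputs the inputs are
independent, so the mixed second moments factor. -/
lemma IsIsotropic.integral_mul_fst_mul_snd (h : IsIsotropic μ) (hr : 0 < r)
    {G : EuclideanSpace ℝ (Fin d) → ℝ} (hG : Measurable G) {B : ℝ} (hB : ∀ w, |G w| ≤ B)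
    (i j : Fin d) :
    ∫ p : ChannelSpace d × ChannelSpace d, G (obs r (channelMid p)) * (p.1.1 i * p.2.1 j)
        ∂((channelLaw μ).prod (channelLaw μ)) =
      ∫ p : ChannelSpace d × ChannelSpace d, G (obs r (channelMid p)) *
        (condMean μ r i (obs r p.1) * condMean μ r j (obs r p.2))
        ∂((channelLaw μ).prod (channelLaw μ)) := by
  have h2 := h.integrable_norm_sq
  have hm := measurable_condMean (r := r) h2 i
  have hGm : AEStronglyMeasurable (fun p : ChannelSpace d × ChannelSpace d =>
      G (obs r (channelMid p))) ((channelLaw μ).prod (channelLaw μ)) :=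
    Measurable.aestronglyMeasurable (by fun_prop)
  have n1 := memLp_mul_of_abs_le (memLp_snd_channel (memLp_fst_coord h2 j)) hGm fun p => hB _
  have n2 := memLp_mul_of_abs_le (memLp_fst_channel (h.memLp_condMean hr r i)) hGm fun p => hB _
  have a1 := h.integral_mul_fst_left hr
    (F := fun q => G ((√2 : ℝ)⁻¹ • (q.1 + obs r q.2)) * q.2.1 j) (by fun_prop)
    (by simpa only [obs_channelMid] using n1) i
  have a2 := h.integral_mul_fst_right hr
    (F := fun q => G ((√2 : ℝ)⁻¹ • (q.1 + obs r q.2)) * condMean μ r i (obs r q.2)) (by fun_prop)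
    (by simpa only [obs_channelMid_swap] using n2) j
  simp only [← obs_channelMid] at a1
  simp only [← obs_channelMid_swap] at a2
  have e1 : ∀ p : ChannelSpace d × ChannelSpace d, G (obs r (channelMid p)) *
      (p.1.1 i * p.2.1 j) = G (obs r (channelMid p)) * p.2.1 j * p.1.1 i := fun p => by ring
  have e2 : ∀ p : ChannelSpace d × ChannelSpace d, G (obs r (channelMid p)) * p.2.1 j *
      condMean μ r i (obs r p.1) = G (obs r (channelMid p)) * condMean μ r i (obs r p.1) *
        p.2.1 j := fun p => by ring
  simp_rw [e1]
  rw [a1]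
  simp_rw [e2]
  rw [a2]
  simp_rw [mul_assoc]

/-- The product is expanded into two diagonal and two mixed terms. Only the diagonal ones contribute
covariance, whence `pairCov` is the plain half-sum. -/
lemma IsIsotropicLogConcave.integral_mul_channelMid_mul (h : IsIsotropicLogConcave μ f)
    (hr : 0 < r) {G : EuclideanSpace ℝ (Fin d) → ℝ} (hG : Measurable G) {B : ℝ}
    (hB : ∀ w, |G w| ≤ B) (i j : Fin d) :
    ∫ p, G (obs r (channelMid p)) * ((channelMid p).1 i * (channelMid p).1 j)
        ∂((channelLaw μ).prod (channelLaw μ)) =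
      ∫ p, G (obs r (channelMid p)) * (pairCov μ r i j p + pairMean μ r i p * pairMean μ r j p)
        ∂((channelLaw μ).prod (channelLaw μ)) := by
  have h2 := h.isIsotropic.integrable_norm_sq
  have hGm : AEStronglyMeasurable (fun p : ChannelSpace d × ChannelSpace d =>
      G (obs r (channelMid p))) ((channelLaw μ).prod (channelLaw μ)) :=
    Measurable.aestronglyMeasurable (by fun_prop)
  have a1 := h.integral_mul_fst_mul_fst_left hr
    (F := fun q => G ((√2 : ℝ)⁻¹ • (q.1 + obs r q.2))) (by fun_prop) (fun q => hB _) i j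
  have a2 := h.integral_mul_fst_mul_fst_right hr
    (F := fun q => G ((√2 : ℝ)⁻¹ • (q.1 + obs r q.2))) (by fun_prop) (fun q => hB _) i j
  simp only [← obs_channelMid] at a1
  simp only [← obs_channelMid_swap] at a2
  have a3 := h.isIsotropic.integral_mul_fst_mul_snd hr hG hB i j
  have a4 := h.isIsotropic.integral_mul_fst_mul_snd hr hG hB j i
  have x1 := fun k => memLp_fst_channel (memLp_fst_coord h2 k)
  have x2 := fun k => memLp_snd_channel (memLp_fst_coord h2 k)
  have y1 := fun k => memLp_fst_channel (h.isIsotropic.memLp_condMean hr r k)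
  have y2 := fun k => memLp_snd_channel (h.isIsotropic.memLp_condMean hr r k)
  have c1 := (memLp_fst_channel (h.memLp_condCov hr r i j)).integrable one_le_two
  have c2 := (memLp_snd_channel (h.memLp_condCov hr r i j)).integrable one_le_two
  have bd : ∀ {F : ChannelSpace d × ChannelSpace d → ℝ},
      Integrable F ((channelLaw μ).prod (channelLaw μ)) →
      Integrable (fun p => G (obs r (channelMid p)) * F p)
        ((channelLaw μ).prod (channelLaw μ)) :=
    fun hF => integrable_mul_of_abs_le hF hGm fun p => hB _
  have j1 := bd ((x1 i).integrable_fun_mul (x1 j))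
  have j2 := bd ((x2 i).integrable_fun_mul (x2 j))
  have j3 := bd ((x1 i).integrable_fun_mul (x2 j))
  have j4 := bd ((x1 j).integrable_fun_mul (x2 i))
  have k1 := bd (c1.add ((y1 i).integrable_fun_mul (y1 j)))
  have k2 := bd (c2.add ((y2 i).integrable_fun_mul (y2 j)))
  have k3 := bd ((y1 i).integrable_fun_mul (y2 j))
  have k4 := bd ((y1 j).integrable_fun_mul (y2 i))
  simp only [Pi.add_apply] at k1 k2
  have add4 : ∀ {F₁ F₂ F₃ F₄ : ChannelSpace d × ChannelSpace d → ℝ},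
      Integrable F₁ ((channelLaw μ).prod (channelLaw μ)) →
      Integrable F₂ ((channelLaw μ).prod (channelLaw μ)) →
      Integrable F₃ ((channelLaw μ).prod (channelLaw μ)) →
      Integrable F₄ ((channelLaw μ).prod (channelLaw μ)) →
      ∫ p, 1 / 2 * ((F₁ p + F₂ p) + (F₃ p + F₄ p)) ∂((channelLaw μ).prod (channelLaw μ)) =
        1 / 2 * ((∫ p, F₁ p ∂((channelLaw μ).prod (channelLaw μ)) +
          ∫ p, F₂ p ∂((channelLaw μ).prod (channelLaw μ))) +
          (∫ p, F₃ p ∂((channelLaw μ).prod (channelLaw μ)) +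
          ∫ p, F₄ p ∂((channelLaw μ).prod (channelLaw μ)))) := by
    intro F₁ F₂ F₃ F₄ f1 f2 f3 f4
    have g1 : Integrable (fun p => F₁ p + F₂ p) ((channelLaw μ).prod (channelLaw μ)) := f1.add f2
    have g2 : Integrable (fun p => F₃ p + F₄ p) ((channelLaw μ).prod (channelLaw μ)) := f3.add f4
    rw [integral_const_mul, integral_add g1 g2, integral_add f1 f2, integral_add f3 f4]
  have b1 := add4 j1 j2 j3 j4
  have b2 := add4 k1 k2 k3 k4
  rw [a1, a2, a3, a4, ← b2] at b1
  convert b1 using 3 with p p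
  · rw [channelMid_fst_apply, channelMid_fst_apply]
    linear_combination (G (obs r (channelMid p)) * (p.1.1 i + p.2.1 i) * (p.1.1 j + p.2.1 j)) *
      inv_sqrt_two_mul_self
  · rw [pairMean, pairMean, pairCov]
    linear_combination (G (obs r (channelMid p)) *
      (condMean μ r i (obs r p.1) + condMean μ r i (obs r p.2)) *
      (condMean μ r j (obs r p.1) + condMean μ r j (obs r p.2))) * inv_sqrt_two_mul_self

end PairConditioning

/-! ### Comparison of estimation in one and in two channels. -/

section FisherJump

variable {d : ℕ} {μ : Measure (EuclideanSpace ℝ (Fin d))} [IsProbabilityMeasure μ] {r : ℝ}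
  {f : EuclideanSpace ℝ (Fin d) → ℝ}

lemma integral_comp_channelMid {F : ChannelSpace d → ℝ} (hF : Measurable F) :
    ∫ p, F (channelMid p) ∂((channelLaw μ).prod (channelLaw μ)) =
      ∫ p, F p ∂(channelLaw (selfConvolution μ)) := by
  rw [← (measurePreserving_channelMid (μ := μ)).map_eq,
    integral_map continuous_channelMid.measurable.aemeasurable hF.aestronglyMeasurable]

lemma memLp_comp_channelMid {F : ChannelSpace d → ℝ}
    (hF : MemLp F 2 (channelLaw (selfConvolution μ))) :
    MemLp (fun p => F (channelMid p)) 2 ((channelLaw μ).prod (channelLaw μ)) :=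
  hF.comp_measurePreserving measurePreserving_channelMid

lemma integral_comp_fst_channel {F : ChannelSpace d → ℝ} (hF : Integrable F (channelLaw μ)) :
    ∫ p : ChannelSpace d × ChannelSpace d, F p.1 ∂((channelLaw μ).prod (channelLaw μ)) =
      ∫ p, F p ∂(channelLaw μ) := by
  rw [integral_prod _ (hF.comp_fst _)]; simp

lemma integral_comp_snd_channel {F : ChannelSpace d → ℝ} (hF : Integrable F (channelLaw μ)) :
    ∫ p : ChannelSpace d × ChannelSpace d, F p.2 ∂((channelLaw μ).prod (channelLaw μ)) =
      ∫ p, F p ∂(channelLaw μ) := by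
  rw [integral_prod _ (hF.comp_snd _)]; simp

lemma IsIsotropicLogConcave.integral_pairCov (h : IsIsotropicLogConcave μ f) (hr : 0 < r)
    (i j : Fin d) : ∫ p, pairCov μ r i j p ∂((channelLaw μ).prod (channelLaw μ)) =
      meanCov μ r i j := by
  have i1 := h.integrable_condCov hr r i j
  simp only [pairCov]
  rw [integral_const_mul, integral_add (i1.comp_fst _) (i1.comp_snd _),
    integral_comp_fst_channel i1, integral_comp_snd_channel i1, meanCov]
  ring

/-- Independence of the two outputs turns the cross term into a squared mean. This averaging of
second moments is the source of the gain K - n. -/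
lemma IsIsotropicLogConcave.integral_pairCov_sq (h : IsIsotropicLogConcave μ f) (hr : 0 < r)
    (i j : Fin d) : ∫ p, pairCov μ r i j p ^ 2 ∂((channelLaw μ).prod (channelLaw μ)) =
      1 / 2 * ∫ p, condCov μ r i j (obs r p) ^ 2 ∂(channelLaw μ) +
        1 / 2 * meanCov μ r i j ^ 2 := by
  have m := h.memLp_condCov hr r i j
  have i1 := m.integrable_sq
  have e : ∀ p : ChannelSpace d × ChannelSpace d, pairCov μ r i j p ^ 2 = 1 / 4 *
      ((condCov μ r i j (obs r p.1) ^ 2 + condCov μ r i j (obs r p.2) ^ 2) +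
        2 * (condCov μ r i j (obs r p.1) * condCov μ r i j (obs r p.2))) := fun p => by
    rw [pairCov]; ring
  simp_rw [e]
  have j1 : Integrable (fun p : ChannelSpace d × ChannelSpace d =>
      condCov μ r i j (obs r p.1) ^ 2) ((channelLaw μ).prod (channelLaw μ)) :=
    (memLp_fst_channel m).integrable_sq
  have j2 : Integrable (fun p : ChannelSpace d × ChannelSpace d =>
      condCov μ r i j (obs r p.2) ^ 2) ((channelLaw μ).prod (channelLaw μ)) :=
    (memLp_snd_channel m).integrable_sq
  have j3 := (memLp_fst_channel m).integrable_fun_mul (memLp_snd_channel m)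
  have j4 : Integrable (fun p : ChannelSpace d × ChannelSpace d =>
      condCov μ r i j (obs r p.1) ^ 2 + condCov μ r i j (obs r p.2) ^ 2)
      ((channelLaw μ).prod (channelLaw μ)) := j1.add j2
  rw [integral_const_mul, integral_add j4 (j3.const_mul 2), integral_add j1 j2,
    integral_const_mul, integral_comp_fst_channel i1, integral_comp_snd_channel i1,
    integral_prod_mul (fun p : ChannelSpace d => condCov μ r i j (obs r p))
      (fun p : ChannelSpace d => condCov μ r i j (obs r p)), meanCov]
  ring

/-- The identity behind the comparison of Fisher informations: conditional covariance of the
normalized sum, given the normalized sum of the outputs, in terms of both outputs. -/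
lemma IsIsotropicLogConcave.integral_mul_pairMean_sub (h : IsIsotropicLogConcave μ f) (hr : 0 < r)
    {H : EuclideanSpace ℝ (Fin d) → ℝ} (hH : Measurable H) {B : ℝ} (hB : ∀ w, |H w| ≤ B)
    (i j : Fin d) :
    ∫ p, H (obs r (channelMid p)) *
        ((pairMean μ r i p - condMean (_root_.selfConvolution μ) r i (obs r (channelMid p))) *
          (pairMean μ r j p - condMean (_root_.selfConvolution μ) r j (obs r (channelMid p))))
        ∂((channelLaw μ).prod (channelLaw μ)) =
      ∫ p, H (obs r (channelMid p)) * condCov (_root_.selfConvolution μ) r i j (obs r (channelMid p))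
        ∂((channelLaw μ).prod (channelLaw μ)) -
      ∫ p, H (obs r (channelMid p)) * pairCov μ r i j p ∂((channelLaw μ).prod (channelLaw μ)) := by
  have hU := h.selfConvolution
  have h2 := hU.isIsotropic.integrable_norm_sq
  have hme := fun k => measurable_condMean (μ := _root_.selfConvolution μ) (r := r) h2 k
  have hmc := measurable_condCov (μ := _root_.selfConvolution μ) (r := r) h2 i j
  have hHm : AEStronglyMeasurable (fun p : ChannelSpace d × ChannelSpace d =>
      H (obs r (channelMid p))) ((channelLaw μ).prod (channelLaw μ)) :=
    Measurable.aestronglyMeasurable (by fun_prop)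
  have bd : ∀ {F : ChannelSpace d × ChannelSpace d → ℝ},
      Integrable F ((channelLaw μ).prod (channelLaw μ)) →
      Integrable (fun p => H (obs r (channelMid p)) * F p)
        ((channelLaw μ).prod (channelLaw μ)) :=
    fun hF => integrable_mul_of_abs_le hF hHm fun p => hB _
  have mE := fun k => h.isIsotropic.memLp_pairMean hr k
  have mU := fun k => memLp_comp_channelMid (hU.isIsotropic.memLp_condMean hr r k)
  have mCU := memLp_comp_channelMid (hU.memLp_condCov hr r i j)
  have mC := h.memLp_pairCov hr i j
  have I1 := bd ((mE i).integrable_fun_mul (mE j))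
  have I4 := bd ((mU i).integrable_fun_mul (mU j))
  have I5 := bd (mCU.integrable one_le_two)
  have I6 := bd (mC.integrable one_le_two)
  have I2 := bd ((mE i).integrable_fun_mul (mU j))
  have I3 := bd ((mU i).integrable_fun_mul (mE j))
  -- the second moments
  have s1 := h.integral_mul_channelMid_mul hr hH hB i j
  have s2 := hU.integral_mul_fst_mul_fst hr hH hB i j
  rw [← integral_comp_channelMid (F := fun p => H (obs r p) * (p.1 i * p.1 j)) (by fun_prop),
    ← integral_comp_channelMid (F := fun p => H (obs r p) * (condCov (_root_.selfConvolution μ) r i j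
      (obs r p) + condMean (_root_.selfConvolution μ) r i (obs r p) *
        condMean (_root_.selfConvolution μ) r j (obs r p)))
      (by have := hme i; have := hme j; fun_prop), s1] at s2
  simp only [mul_add] at s2
  rw [integral_add I6 I1, integral_add I5 I4] at s2
  -- the first moments
  have fm : ∀ a b : Fin d,
      ∫ p, H (obs r (channelMid p)) * (condMean (_root_.selfConvolution μ) r a (obs r (channelMid p)) *
        pairMean μ r b p) ∂((channelLaw μ).prod (channelLaw μ)) =
      ∫ p, H (obs r (channelMid p)) * (condMean (_root_.selfConvolution μ) r a (obs r (channelMid p)) *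
        condMean (_root_.selfConvolution μ) r b (obs r (channelMid p)))
        ∂((channelLaw μ).prod (channelLaw μ)) := by
    intro a b
    have hma := hme a
    have hmb := hme b
    have hG : Measurable fun w => H w * condMean (_root_.selfConvolution μ) r a w := by fun_prop
    have hHU : AEStronglyMeasurable (fun p : ChannelSpace d => H (obs r p))
      (channelLaw (_root_.selfConvolution μ)) := Measurable.aestronglyMeasurable (by fun_prop)
    have mG := memLp_mul_of_abs_le (hU.isIsotropic.memLp_condMean hr r a) hHU fun p => hB _
    have t1 := h.isIsotropic.integral_mul_channelMid hr hG (memLp_comp_channelMid mG) b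
    have t2 := hU.isIsotropic.integral_mul_fst hr hG mG b
    rw [← integral_comp_channelMid (F := fun p => H (obs r p) *
        condMean (_root_.selfConvolution μ) r a (obs r p) * p.1 b) (by fun_prop),
      ← integral_comp_channelMid (F := fun p => H (obs r p) *
        condMean (_root_.selfConvolution μ) r a (obs r p) * condMean (_root_.selfConvolution μ) r b (obs r p))
        (by fun_prop), t1] at t2
    simpa only [mul_assoc] using t2
  have f1 := fm j i
  have f2 := fm i j
  have e : ∀ p : ChannelSpace d × ChannelSpace d, H (obs r (channelMid p)) *
        ((pairMean μ r i p - condMean (_root_.selfConvolution μ) r i (obs r (channelMid p))) *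
          (pairMean μ r j p - condMean (_root_.selfConvolution μ) r j (obs r (channelMid p)))) =
      (H (obs r (channelMid p)) * (pairMean μ r i p * pairMean μ r j p) -
        H (obs r (channelMid p)) * (pairMean μ r i p *
          condMean (_root_.selfConvolution μ) r j (obs r (channelMid p)))) -
      (H (obs r (channelMid p)) * (condMean (_root_.selfConvolution μ) r i (obs r (channelMid p)) *
          pairMean μ r j p) -
        H (obs r (channelMid p)) * (condMean (_root_.selfConvolution μ) r i (obs r (channelMid p)) *
          condMean (_root_.selfConvolution μ) r j (obs r (channelMid p)))) := fun p => by ring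
  have J1 : Integrable (fun p : ChannelSpace d × ChannelSpace d =>
      (H (obs r (channelMid p)) * (pairMean μ r i p * pairMean μ r j p) -
        H (obs r (channelMid p)) * (pairMean μ r i p *
          condMean (_root_.selfConvolution μ) r j (obs r (channelMid p)))))
      ((channelLaw μ).prod (channelLaw μ)) := I1.sub I2
  have J2 : Integrable (fun p : ChannelSpace d × ChannelSpace d =>
      (H (obs r (channelMid p)) * (condMean (_root_.selfConvolution μ) r i (obs r (channelMid p)) *
          pairMean μ r j p) -
        H (obs r (channelMid p)) * (condMean (_root_.selfConvolution μ) r i (obs r (channelMid p)) *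
          condMean (_root_.selfConvolution μ) r j (obs r (channelMid p)))))
      ((channelLaw μ).prod (channelLaw μ)) := I3.sub I4
  simp_rw [e]
  rw [integral_sub J1 J2, integral_sub I1 I2, integral_sub I3 I4, f2]
  have f1' : ∫ p, H (obs r (channelMid p)) * (pairMean μ r i p *
      condMean (_root_.selfConvolution μ) r j (obs r (channelMid p)))
        ∂((channelLaw μ).prod (channelLaw μ)) =
      ∫ p, H (obs r (channelMid p)) * (condMean (_root_.selfConvolution μ) r i (obs r (channelMid p)) *
          condMean (_root_.selfConvolution μ) r j (obs r (channelMid p)))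
          ∂((channelLaw μ).prod (channelLaw μ)) := by
    simpa only [mul_comm] using f1
  rw [f1']
  linarith

/-- Let v be the estimate of the normalized input from both outputs minus the estimate from their
normalized sum. Its conditional second moment is C_U minus the conditional mean of the pair
covariance. Tested against I - r²C_U ≥ 0, the identity part gives the difference of traces q - q_U,
and the part with r²C_U is estimated by squares. -/
theorem IsIsotropicLogConcave.fisher_jump (h : IsIsotropicLogConcave μ f) (hr : 0 < r) :
    r ^ 2 / 2 * (covEnergy μ r - meanCovEnergy μ r) ≤
      2 * (estEnergy μ r - estEnergy (_root_.selfConvolution μ) r) +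
        r ^ 2 * (covEnergy μ r - covEnergy (_root_.selfConvolution μ) r) := by
  have hU := h.selfConvolution
  have h2 := hU.isIsotropic.integrable_norm_sq
  set H : Fin d → Fin d → EuclideanSpace ℝ (Fin d) → ℝ := fun i j w =>
    (if i = j then 1 else 0) - r ^ 2 * condCov (_root_.selfConvolution μ) r i j w with hH
  have hHm : ∀ i j, Measurable (H i j) := fun i j => by
    have := measurable_condCov (μ := _root_.selfConvolution μ) (r := r) h2 i j
    fun_prop
  have hB : ∀ i j w, |H i j w| ≤ 2 := by
    intro i j w
    have h1 := hU.abs_condCov_le hr i j w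
    rw [le_div_iff₀ (by positivity)] at h1
    refine (abs_sub _ _).trans ?_
    rw [abs_mul, abs_of_nonneg (sq_nonneg r)]
    have : |(if i = j then (1:ℝ) else 0)| ≤ 1 := by split_ifs <;> simp
    linarith
  set v : Fin d → ChannelSpace d × ChannelSpace d → ℝ := fun i p =>
    pairMean μ r i p - condMean (_root_.selfConvolution μ) r i (obs r (channelMid p)) with hv
  have mv : ∀ i, MemLp (v i) 2 ((channelLaw μ).prod (channelLaw μ)) := fun i =>
    (h.isIsotropic.memLp_pairMean hr i).sub
      (memLp_comp_channelMid (hU.isIsotropic.memLp_condMean hr r i))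
  have iv : ∀ i j, Integrable (fun p => H i j (obs r (channelMid p)) * (v i p * v j p))
      ((channelLaw μ).prod (channelLaw μ)) := fun i j =>
    integrable_mul_of_abs_le ((mv i).integrable_fun_mul (mv j))
      (Measurable.aestronglyMeasurable (by have := hHm i j; fun_prop)) fun p => hB i j _
  -- Pointwise this is the quadratic form of I - r²C_U at v, nonnegative because (X + Y)/√2 is
  -- log-concave.
  have hpos : 0 ≤ ∑ i, ∑ j, ∫ p, H i j (obs r (channelMid p)) * (v i p * v j p)
      ∂((channelLaw μ).prod (channelLaw μ)) := by
    simp_rw [← integral_finsetSum _ fun j _ => iv _ j]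
    rw [← integral_finsetSum _ fun i _ => integrable_finsetSum _ fun j _ => iv i j]
    refine integral_nonneg fun p => ?_
    have h1 := hU.sum_condCov_le hr (obs r (channelMid p)) (WithLp.toLp 2 fun i => v i p)
    rw [EuclideanSpace.real_norm_sq_eq, Finset.mul_sum] at h1
    have e : ∀ i, ∑ j, H i j (obs r (channelMid p)) * (v i p * v j p) = v i p ^ 2 - r ^ 2 *
        ∑ j, condCov (_root_.selfConvolution μ) r i j (obs r (channelMid p)) * v i p * v j p := by
      intro i
      simp only [hH, sub_mul, Finset.sum_sub_distrib, Finset.mul_sum]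
      congr 1
      · simp [sq]
      · exact Finset.sum_congr rfl fun j _ => by ring
    simp only [e, Pi.zero_apply, Finset.sum_sub_distrib]
    simp only at h1
    linarith
  have key : ∀ i j, ∫ p, H i j (obs r (channelMid p)) * (v i p * v j p)
      ∂((channelLaw μ).prod (channelLaw μ)) ≤
      (if i = j then 1 else 0) * (meanCov (_root_.selfConvolution μ) r i j - meanCov μ r i j) -
        r ^ 2 / 2 * ∫ p, condCov (_root_.selfConvolution μ) r i j (obs r p) ^ 2
          ∂(channelLaw (_root_.selfConvolution μ)) +
        r ^ 2 / 4 * (∫ p, condCov μ r i j (obs r p) ^ 2 ∂(channelLaw μ) +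
          meanCov μ r i j ^ 2) := by
    intro i j
    rw [h.integral_mul_pairMean_sub hr (hHm i j) (hB i j) i j]
    have hmc := measurable_condCov (μ := _root_.selfConvolution μ) (r := r) h2 i j
    have mCU := memLp_comp_channelMid (hU.memLp_condCov hr r i j)
    have mC := h.memLp_pairCov hr i j
    have hHm' : AEStronglyMeasurable (fun p : ChannelSpace d × ChannelSpace d =>
        H i j (obs r (channelMid p))) ((channelLaw μ).prod (channelLaw μ)) :=
      Measurable.aestronglyMeasurable (by have := hHm i j; fun_prop)
    have k1 := integrable_mul_of_abs_le (mCU.integrable one_le_two) hHm' fun p => hB i j _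
    have k2 := integrable_mul_of_abs_le (mC.integrable one_le_two) hHm' fun p => hB i j _
    have q1 : ∫ p, condCov (_root_.selfConvolution μ) r i j (obs r (channelMid p))
        ∂((channelLaw μ).prod (channelLaw μ)) = meanCov (_root_.selfConvolution μ) r i j :=
      integral_comp_channelMid (F := fun p => condCov (_root_.selfConvolution μ) r i j (obs r p))
        (by fun_prop)
    have q2 : ∫ p, condCov (_root_.selfConvolution μ) r i j (obs r (channelMid p)) ^ 2
        ∂((channelLaw μ).prod (channelLaw μ)) =
        ∫ p, condCov (_root_.selfConvolution μ) r i j (obs r p) ^ 2 ∂(channelLaw (_root_.selfConvolution μ)) :=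
      integral_comp_channelMid (F := fun p => condCov (_root_.selfConvolution μ) r i j (obs r p) ^ 2)
        (by fun_prop)
    have j1 := (mCU.integrable one_le_two).sub (mC.integrable one_le_two)
    have j2 := mCU.integrable_sq.const_mul (r ^ 2 / 2)
    have j3 := mC.integrable_sq.const_mul (r ^ 2 / 2)
    have j1' : Integrable (fun p => (if i = j then (1:ℝ) else 0) *
        (condCov (_root_.selfConvolution μ) r i j (obs r (channelMid p)) - pairCov μ r i j p))
        ((channelLaw μ).prod (channelLaw μ)) := j1.const_mul _
    have j4 : Integrable (fun p => (if i = j then (1:ℝ) else 0) *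
        (condCov (_root_.selfConvolution μ) r i j (obs r (channelMid p)) - pairCov μ r i j p) -
          r ^ 2 / 2 * condCov (_root_.selfConvolution μ) r i j (obs r (channelMid p)) ^ 2)
        ((channelLaw μ).prod (channelLaw μ)) := j1'.sub j2
    rw [← integral_sub k1 k2]
    -- Here a(a - b) ≥ (a² - b²)/2, with a the entry of C_U and b that of the pair covariance; the
    -- mixed moment of a and b never has to be computed.
    calc _ ≤ ∫ p, ((if i = j then (1:ℝ) else 0) *
        (condCov (_root_.selfConvolution μ) r i j (obs r (channelMid p)) - pairCov μ r i j p) -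
          r ^ 2 / 2 * condCov (_root_.selfConvolution μ) r i j (obs r (channelMid p)) ^ 2 +
          r ^ 2 / 2 * pairCov μ r i j p ^ 2) ∂((channelLaw μ).prod (channelLaw μ)) := by
          refine integral_mono (k1.sub k2) (j4.add j3) fun p => ?_
          simp only [hH]
          nlinarith [mul_nonneg (sq_nonneg r) (sq_nonneg
            (condCov (_root_.selfConvolution μ) r i j (obs r (channelMid p)) - pairCov μ r i j p))]
      _ = _ := by
        rw [integral_add j4 j3, integral_sub j1' j2, integral_const_mul, integral_const_mul,
          integral_const_mul, integral_sub (mCU.integrable one_le_two) (mC.integrable one_le_two),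
          q1, q2, h.integral_pairCov hr, h.integral_pairCov_sq hr]
        ring
  have hsum := hpos.trans (Finset.sum_le_sum fun i (_ : i ∈ Finset.univ) =>
    Finset.sum_le_sum fun j (_ : j ∈ Finset.univ) => key i j)
  simp only [Finset.sum_add_distrib, Finset.sum_sub_distrib, ← Finset.mul_sum, ite_mul, one_mul,
    zero_mul, Finset.sum_ite_eq, Finset.mem_univ, if_true] at hsum
  rw [h.estEnergy_eq hr, hU.estEnergy_eq hr, h.covEnergy_eq hr, hU.covEnergy_eq hr, meanCovEnergy]
  linarith

end FisherJump

/-! ### Entropy of the output for large signal strength. -/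

section LargeSignal

variable {d : ℕ} {μ : Measure (EuclideanSpace ℝ (Fin d))} [IsProbabilityMeasure μ] {r : ℝ}
  {f : EuclideanSpace ℝ (Fin d) → ℝ}

/-- The entropy of the output `r X + G` of the Gaussian channel, for isotropic `X` of law `μ`. -/
noncomputable def obsEntropy (μ : Measure (EuclideanSpace ℝ (Fin d))) (r : ℝ) : ℝ :=
  d / 2 * Real.log (2 * Real.pi) + d / 2 * (1 + r ^ 2) - logPartition μ r

lemma isDensityOf_obs (μ : Measure (EuclideanSpace ℝ (Fin d))) [IsProbabilityMeasure μ] (r : ℝ) :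
    IsDensityOf (fun w => partitionFn μ r w * gaussianDensity w) ((channelLaw μ).map (obs r)) := by
  have hZ := measurable_partitionFn (μ := μ) r
  have hg := (continuous_gaussianDensity (E := EuclideanSpace ℝ (Fin d))).measurable
  have hc : Continuous fun p : EuclideanSpace ℝ (Fin d) × EuclideanSpace ℝ (Fin d) =>
    tiltExponent r p.2 p.1 := by fun_prop
  refine ⟨by fun_prop, fun w => mul_nonneg (partitionFn_pos r w).le (gaussianDensity_pos w).le, ?_⟩
  refine Measure.ext_of_lintegral _ fun F hF => ?_
  have e1 : ∫⁻ p, F (obs r p) ∂(channelLaw μ) = ∫⁻ q, F q.2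
      ∂((channelLaw μ).map fun p => (p.1, r • p.1 + p.2)) := by
    rw [lintegral_map (by fun_prop) (by fun_prop)]
    rfl
  have hm : Measurable fun q : EuclideanSpace ℝ (Fin d) × EuclideanSpace ℝ (Fin d) =>
      ENNReal.ofReal (Real.exp (tiltExponent r q.2 q.1)) := by fun_prop
  rw [lintegral_map hF (by fun_prop), e1, map_shear_prod_stdGaussian,
    lintegral_withDensity_eq_lintegral_mul _ hm (by fun_prop),
    lintegral_withDensity_eq_lintegral_mul _ (by fun_prop) hF,
    lintegral_prod_symm _ (by fun_prop), lintegral_stdGaussian]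
  · refine lintegral_congr fun w => ?_
    simp only [Pi.mul_apply]
    rw [lintegral_mul_const _ (by fun_prop), ← ofReal_integral_eq_lintegral_ofReal
      (integrable_exp_tiltExponent r w) (.of_forall fun x => (Real.exp_pos _).le), mul_comm
      (partitionFn μ r w), ENNReal.ofReal_mul (gaussianDensity_pos w).le, mul_assoc]
    rfl
  · exact Measurable.lintegral_prod_left' (by fun_prop)

lemma log_obsDensity (w : EuclideanSpace ℝ (Fin d)) :
    Real.log (partitionFn μ r w * gaussianDensity w) = Real.log (partitionFn μ r w) +
      (-(d / 2 * Real.log (2 * Real.pi)) - ‖w‖ ^ 2 / 2) := by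
  rw [Real.log_mul (partitionFn_pos r w).ne' (gaussianDensity_pos w).ne', log_gaussianDensity]

lemma IsIsotropic.integral_norm_sq_obs (h : IsIsotropic μ) (r : ℝ) :
    ∫ p, ‖obs r p‖ ^ 2 ∂(channelLaw μ) = d * (1 + r ^ 2) := by
  have h2 := h.integrable_norm_sq
  simp_rw [EuclideanSpace.real_norm_sq_eq]
  rw [integral_finsetSum _ fun i _ => (memLp_obs_coord h2 r i).integrable_sq]
  simp_rw [sq (obs r _ _), h.integral_obs_mul_obs]
  simp
  ring

lemma IsIsotropic.integrable_log_obsDensity (h : IsIsotropic μ) (r : ℝ) :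
    Integrable (fun p => Real.log (partitionFn μ r (obs r p) * gaussianDensity (obs r p)))
      (channelLaw μ) := by
  simp_rw [log_obsDensity]
  exact (h.integrable_log_partitionFn_obs r r).add ((integrable_const _).sub
    ((integrable_norm_sq_obs h.integrable_norm_sq r).div_const 2))

lemma IsIsotropic.integral_log_obsDensity (h : IsIsotropic μ) (r : ℝ) :
    ∫ p, Real.log (partitionFn μ r (obs r p) * gaussianDensity (obs r p)) ∂(channelLaw μ) =
      -obsEntropy μ r := by
  simp_rw [log_obsDensity]
  have i1 := (integrable_norm_sq_obs h.integrable_norm_sq r).div_const 2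
  have i2 : Integrable (fun p => -(d / 2 * Real.log (2 * Real.pi)) - ‖obs r p‖ ^ 2 / 2)
    (channelLaw μ) := (integrable_const _).sub i1
  rw [integral_add (h.integrable_log_partitionFn_obs r r) i2, integral_sub (integrable_const _) i1,
    integral_div, h.integral_norm_sq_obs, obsEntropy, logPartition]
  simp
  ring

/-- Noise does not lower entropy. For a fixed noise z, the output density at r x + z, multiplied by
r^d, is a density in `x`, so Gibbs' inequality applies; then average over z. -/
lemma IsIsotropic.entropy_add_le_obsEntropy (h : IsIsotropic μ) (hf : IsDensityOf f μ)
    (hi : Integrable (fun x => Real.log (f x)) μ) (hr : 0 < r) :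
    entropy μ + d * Real.log r ≤ obsEntropy μ r := by
  have hZ := measurable_partitionFn (μ := μ) r
  have hg := (continuous_gaussianDensity (E := EuclideanSpace ℝ (Fin d))).measurable
  have hD := isDensityOf_obs μ r
  have : IsProbabilityMeasure ((channelLaw μ).map (obs r)) :=
    Measure.isProbabilityMeasure_map (by fun_prop)
  have hpos := fun w => mul_pos (partitionFn_pos (μ := μ) r w) (gaussianDensity_pos w)
  have hint := h.integrable_log_obsDensity r
  have key : ∀ᵐ z ∂(stdGaussian (EuclideanSpace ℝ (Fin d))),
      ∫ x, Real.log (partitionFn μ r (obs r (x, z)) * gaussianDensity (obs r (x, z))) ∂μ ≤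
        ∫ x, Real.log (f x) ∂μ - d * Real.log r := by
    filter_upwards [hint.prod_left_ae] with z hz
    have hlog : ∀ x, Real.log (r ^ d * (partitionFn μ r (obs r (x, z)) *
        gaussianDensity (obs r (x, z)))) = d * Real.log r +
          Real.log (partitionFn μ r (obs r (x, z)) * gaussianDensity (obs r (x, z))) := by
      intro x
      rw [Real.log_mul (by positivity) (hpos _).ne', Real.log_pow]
    have hobs : Measurable fun x : EuclideanSpace ℝ (Fin d) => obs r (x, z) := by fun_prop
    have := hf.integral_log_le hi (h := fun x => r ^ d * (partitionFn μ r (obs r (x, z)) *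
      gaussianDensity (obs r (x, z)))) (by fun_prop) ?_
      (.of_forall fun x => mul_pos (by positivity) (hpos _))
      (by simp_rw [hlog]; exact (integrable_const _).add hz)
    · simp_rw [hlog] at this
      rw [integral_add (integrable_const _) hz] at this
      simp at this
      linarith
    · have h1 := lintegral_eq_lintegral_smul_sub (g := fun w => ENNReal.ofReal
        (partitionFn μ r w * gaussianDensity w)) (by fun_prop) hr (-z)
      rw [hD.lintegral_eq_one] at h1
      rw [h1, ← lintegral_const_mul _ (by fun_prop)]
      refine le_of_eq (lintegral_congr fun x => ?_)
      rw [sub_neg_eq_add, ENNReal.ofReal_mul (by positivity)]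
      rfl
  have h1 := integral_mono_ae hint.integral_prod_right (integrable_const _) key
  rw [← integral_prod_symm _ hint, h.integral_log_obsDensity] at h1
  rw [hf.entropy_eq]
  simp at h1
  linarith

/-- The boundary of a convex set is a null set. Inside the support `f` is continuous, which provides
the pointwise limit in the large signal regime. -/
lemma IsIsotropicLogConcave.ae_mem_interior (h : IsIsotropicLogConcave μ f) :
    ∀ᵐ x ∂μ, x ∈ interior {x | 0 < f x} := by
  have h1 : ∀ᵐ x ∂μ, x ∉ frontier {x | 0 < f x} :=
    h.isDensityOf.absolutelyContinuous.ae_le (measure_eq_zero_iff_ae_notMem.1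
      h.logConcave.volume_frontier_support)
  filter_upwards [h1, h.isDensityOf.ae_pos] with x hx hx0
  by_contra hc
  exact hx ⟨subset_closure hx0, hc⟩

/-- The entropy of the mixture of `f` with a Gaussian bounds the entropy of the output of the
channel from above. -/
lemma IsIsotropicLogConcave.exists_obsEntropy_le (h : IsIsotropicLogConcave μ f) {ε : ℝ}
    (hε : 0 < ε) : ∃ R : ℝ, ∀ r ≥ R, obsEntropy μ r - d * Real.log r ≤ entropy μ + ε := by
  obtain ⟨M, hM0, hM⟩ := h.logConcave.exists_le h.isDensityOf
  have hfm := h.isDensityOf.measurable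
  have hf0 := h.isDensityOf.nonneg
  have hgm := (continuous_gaussianDensity (E := EuclideanSpace ℝ (Fin d))).measurable
  have h2 := h.isIsotropic.integrable_norm_sq
  -- Chosen so that log(1 - δ) = -ε/2: passing from `f` to the mixture costs exactly half of ε.
  set δ := 1 - Real.exp (-(ε / 2)) with hδ
  have hδ0 : 0 < δ := by rw [hδ, sub_pos, Real.exp_lt_one_iff]; linarith
  have hδ1 : 1 - δ = Real.exp (-(ε / 2)) := by rw [hδ]; ring
  have hδ1' : 0 < 1 - δ := by rw [hδ1]; positivity
  -- log f may be -∞ at perturbed points. Adding a little Gaussian makes the density positive, with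
  -- logarithm of at most quadratic growth, so dominated convergence is available.
  set k : EuclideanSpace ℝ (Fin d) → ℝ := fun y => (1 - δ) * f y + δ * gaussianDensity y with hk
  have hkm : Measurable k := by fun_prop
  have hkpos : ∀ y, 0 < k y := fun y => by
    have := gaussianDensity_pos y
    have := hf0 y
    positivity
  have hk1 : ∫⁻ y, ENNReal.ofReal (k y) = 1 := by
    have e : ∀ y, ENNReal.ofReal (k y) = ENNReal.ofReal (1 - δ) * ENNReal.ofReal (f y) +
        ENNReal.ofReal δ * ENNReal.ofReal (gaussianDensity y) := by
      intro y
      rw [← ENNReal.ofReal_mul hδ1'.le, ← ENNReal.ofReal_mul hδ0.le, ← ENNReal.ofReal_add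
        (mul_nonneg hδ1'.le (hf0 y)) (mul_nonneg hδ0.le (gaussianDensity_pos y).le)]
    simp_rw [e]
    rw [lintegral_add_left (by fun_prop), lintegral_const_mul _ (by fun_prop),
      lintegral_const_mul _ (by fun_prop), h.isDensityOf.lintegral_eq_one,
      isDensityOf_stdGaussian.lintegral_eq_one, mul_one, mul_one, ← ENNReal.ofReal_add hδ1'.le
      hδ0.le]
    simp
  set M' := (1 - δ) * M + δ * gaussianDensity (0 : EuclideanSpace ℝ (Fin d)) with hM'
  set A := |Real.log M'| + |Real.log δ| + |d / 2 * Real.log (2 * Real.pi)| with hA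
  have hkle : ∀ y, |Real.log (k y)| ≤ A + ‖y‖ ^ 2 / 2 := by
    intro y
    have u1 : Real.log (k y) ≤ Real.log M' := by
      refine Real.log_le_log (hkpos y) ?_
      have := hM y
      have := gaussianDensity_le y
      simp only [hk, hM']
      gcongr
    have u2 : Real.log (δ * gaussianDensity y) ≤ Real.log (k y) := by
      refine Real.log_le_log (mul_pos hδ0 (gaussianDensity_pos y)) ?_
      have := mul_nonneg hδ1'.le (hf0 y)
      simp only [hk]
      linarith
    rw [Real.log_mul hδ0.ne' (gaussianDensity_pos y).ne', log_gaussianDensity] at u2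
    have := le_abs_self (Real.log M')
    have := neg_abs_le (Real.log δ)
    have := le_abs_self (d / 2 * Real.log (2 * Real.pi))
    have := abs_nonneg (Real.log M')
    have := abs_nonneg (Real.log δ)
    have := abs_nonneg (d / 2 * Real.log (2 * Real.pi))
    have : 0 ≤ ‖y‖ ^ 2 / 2 := by positivity
    rw [abs_le]
    constructor <;> linarith
  have hlim : Filter.Tendsto (fun r : ℝ => ∫ p, Real.log (k (p.1 + r⁻¹ • p.2)) ∂(channelLaw μ))
      Filter.atTop (nhds (∫ p, Real.log (k p.1) ∂(channelLaw μ))) := by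
    refine tendsto_integral_filter_of_dominated_convergence
      (fun p => A + (‖p.1‖ ^ 2 + ‖p.2‖ ^ 2)) ?_ ?_
      ((integrable_const _).add ((integrable_norm_sq_fst h2).add integrable_norm_sq_snd)) ?_
    · exact .of_forall fun r => Measurable.aestronglyMeasurable (by fun_prop)
    · filter_upwards [Filter.eventually_ge_atTop 1] with r hr
      refine .of_forall fun p => (hkle _).trans ?_
      have h1 := norm_add_le p.1 (r⁻¹ • p.2)
      have h3 : ‖r⁻¹ • p.2‖ ≤ ‖p.2‖ := by
        rw [norm_smul, Real.norm_of_nonneg (by positivity)]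
        exact mul_le_of_le_one_left (norm_nonneg _) (inv_le_one_of_one_le₀ hr)
      have h4 : ‖p.1 + r⁻¹ • p.2‖ ≤ ‖p.1‖ + ‖p.2‖ := by linarith
      have h5 := pow_le_pow_left₀ (norm_nonneg _) h4 2
      nlinarith [sq_nonneg (‖p.1‖ - ‖p.2‖)]
    · have hae : ∀ᵐ p ∂(channelLaw μ), p.1 ∈ interior {x | 0 < f x} :=
        Measure.quasiMeasurePreserving_fst.ae h.ae_mem_interior
      filter_upwards [hae] with p hp
      have hc : ContinuousAt k p.1 :=
        ((h.logConcave.continuousAt hp).const_mul _).add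
          (continuous_gaussianDensity.continuousAt.const_mul _)
      have h3 : Filter.Tendsto (fun r : ℝ => p.1 + r⁻¹ • p.2) Filter.atTop (nhds p.1) := by
        simpa using ((tendsto_inv_atTop_zero (𝕜 := ℝ)).smul_const p.2).const_add p.1
      exact ((hc.tendsto.comp h3).log (hkpos _).ne')
  have hfin : ∫ x, Real.log (f x) ∂μ - ε / 2 ≤ ∫ p, Real.log (k p.1) ∂(channelLaw μ) := by
    have hki : Integrable (fun x => Real.log (k x)) μ :=
      ((integrable_const A).add (h2.div_const 2)).mono' (Measurable.aestronglyMeasurable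
        (by fun_prop)) (.of_forall fun x => hkle x)
    rw [integral_prod _ (hki.comp_fst _)]
    simp only [integral_const, probReal_univ, one_smul]
    have := integral_mono_ae (h.integrable_log.sub (integrable_const (ε / 2))) hki (by
      filter_upwards [h.isDensityOf.ae_pos] with x hx
      have h1 : Real.log ((1 - δ) * f x) ≤ Real.log (k x) := by
        refine Real.log_le_log (mul_pos hδ1' hx) ?_
        have := mul_pos hδ0 (gaussianDensity_pos x)
        simp only [hk]
        linarith
      rw [Real.log_mul hδ1'.ne' hx.ne', hδ1, Real.log_exp] at h1
      simp only [Pi.sub_apply]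
      linarith)
    rw [integral_sub' h.integrable_log (integrable_const _)] at this
    simpa using this
  have hev : ∀ᶠ r : ℝ in Filter.atTop, ∫ x, Real.log (f x) ∂μ - ε <
      ∫ p, Real.log (k (p.1 + r⁻¹ • p.2)) ∂(channelLaw μ) :=
    hlim.eventually_const_lt (by linarith)
  obtain ⟨R, hR⟩ := Filter.eventually_atTop.1 (hev.and (Filter.eventually_gt_atTop 0))
  refine ⟨R, fun r hr => ?_⟩
  obtain ⟨hr1, hr0⟩ := hR r hr
  have hD := isDensityOf_obs μ r
  have : IsProbabilityMeasure ((channelLaw μ).map (obs r)) :=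
    Measure.isProbabilityMeasure_map (by fun_prop)
  have hZ := measurable_partitionFn (μ := μ) r
  have hlog : ∀ w, Real.log (r⁻¹ ^ d * k (r⁻¹ • w)) = -(d * Real.log r) +
      Real.log (k (r⁻¹ • w)) := by
    intro w
    rw [Real.log_mul (by positivity) (hkpos _).ne', Real.log_pow, Real.log_inv]
    ring
  have hobs : ∀ p : ChannelSpace d, r⁻¹ • obs r p = p.1 + r⁻¹ • p.2 := by
    intro p
    rw [obs, smul_add, inv_smul_smul₀ hr0.ne']
  have hki : Integrable (fun p => Real.log (k (r⁻¹ • obs r p))) (channelLaw μ) := by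
    refine ((integrable_const A).add ((integrable_norm_sq_obs h2 r).const_mul
      (r⁻¹ ^ 2 / 2))).mono' (Measurable.aestronglyMeasurable (by fun_prop))
      (.of_forall fun p => (hkle _).trans (le_of_eq ?_))
    rw [norm_smul, Real.norm_of_nonneg (by positivity)]
    simp only [Pi.add_apply]
    ring
  have hmk : Measurable fun w => Real.log (r⁻¹ ^ d * k (r⁻¹ • w)) := by fun_prop
  have hmZ : Measurable fun w => Real.log (partitionFn μ r w * gaussianDensity w) := by fun_prop
  -- Gibbs' inequality for the output, tested on the density `k` dilated by `r`; the dilation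
  -- accounts for d log r.
  have gibbs := hD.integral_log_le
    ((integrable_map_measure hmZ.aestronglyMeasurable (by fun_prop)).2
      (h.isIsotropic.integrable_log_obsDensity r))
    (h := fun w => r⁻¹ ^ d * k (r⁻¹ • w)) (by fun_prop) ?_
    (.of_forall fun w => mul_pos (by positivity) (hkpos _))
    ((integrable_map_measure hmk.aestronglyMeasurable (by fun_prop)).2 (by
      simp only [Function.comp_def, hlog]
      exact (integrable_const _).add hki))
  · rw [integral_map (by fun_prop) hmk.aestronglyMeasurable, integral_map (by fun_prop)
      hmZ.aestronglyMeasurable, h.isIsotropic.integral_log_obsDensity] at gibbs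
    simp only [hlog] at gibbs
    rw [integral_add (integrable_const _) hki] at gibbs
    simp only [hobs] at gibbs
    rw [h.isDensityOf.entropy_eq]
    simp at gibbs
    linarith
  · have h1 := lintegral_eq_lintegral_smul_sub (g := fun w => ENNReal.ofReal (k w))
      (by fun_prop) (inv_pos.2 hr0) 0
    rw [hk1] at h1
    simp_rw [ENNReal.ofReal_mul (pow_nonneg (inv_nonneg.2 hr0.le) d)]
    rw [lintegral_const_mul _ (by fun_prop), h1]
    simp

end LargeSignal

/-! ### Monotonicity along the channel and the entropy jump. -/

section Dissipation

variable {d : ℕ} {μ : Measure (EuclideanSpace ℝ (Fin d))} [IsProbabilityMeasure μ] {r c : ℝ}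
  {f : EuclideanSpace ℝ (Fin d) → ℝ}

lemma IsIsotropicLogConcave.meanCovEnergy_le (h : IsIsotropicLogConcave μ f) (hr : 0 < r) :
    meanCovEnergy μ r ≤ covEnergy μ r := by
  rw [h.covEnergy_eq hr, meanCovEnergy]
  refine Finset.sum_le_sum fun i _ => Finset.sum_le_sum fun j _ => ?_
  rw [← sub_nonneg, ← h.integral_sub_meanCov_sq hr]
  exact integral_nonneg fun p => sq_nonneg _

/-- The distance of the mean conditional covariance matrix to that of the Gaussian law. -/
lemma meanCov_defect_nonneg (μ : Measure (EuclideanSpace ℝ (Fin d))) (r : ℝ) :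
    0 ≤ d - 2 * (1 + r ^ 2) * ∑ i, meanCov μ r i i + (1 + r ^ 2) ^ 2 * meanCovEnergy μ r := by
  -- For the standard Gaussian law the conditional covariance is I/(1 + r²), so the sum measures the
  -- departure from it.
  have key : ∑ i, ∑ j, ((if i = j then 1 else 0) - (1 + r ^ 2) * meanCov μ r i j) ^ 2 =
      d - 2 * (1 + r ^ 2) * ∑ i, meanCov μ r i i + (1 + r ^ 2) ^ 2 * meanCovEnergy μ r := by
    have e : ∀ i j : Fin d, ((if i = j then 1 else 0) - (1 + r ^ 2) * meanCov μ r i j) ^ 2 =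
        (if i = j then 1 - 2 * (1 + r ^ 2) * meanCov μ r i j else 0) +
          (1 + r ^ 2) ^ 2 * meanCov μ r i j ^ 2 := fun i j => by split_ifs <;> ring
    simp_rw [e, Finset.sum_add_distrib, ← Finset.mul_sum, meanCovEnergy]
    simp [Finset.mul_sum]
  rw [← key]
  exact Finset.sum_nonneg fun i _ => Finset.sum_nonneg fun j _ => sq_nonneg _

/-- Among all laws with the same covariance, the conditional expectation has the least energy for
the Gaussian law. -/
lemma IsIsotropicLogConcave.le_estEnergy (h : IsIsotropicLogConcave μ f) (hr : 0 < r) :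
    d * r ^ 2 / (1 + r ^ 2) ≤ estEnergy μ r := by
  have h2 := h.isIsotropic.integrable_norm_sq
  have key : ∀ i : Fin d, r ^ 2 / (1 + r ^ 2) ≤ 1 - meanCov μ r i i := by
    intro i
    have mC := h.isIsotropic.memLp_condMean hr r i
    have mO := memLp_obs_coord h2 r i
    have i1 := mC.integrable_fun_mul mC
    have i2 := mC.integrable_fun_mul mO
    have i3 := mO.integrable_fun_mul mO
    -- The coefficient of the best linear estimator of the input. The conditional mean has at least
    -- its energy, which is also the Gaussian value.
    set b := r / (1 + r ^ 2) with hb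
    have h0 : 0 ≤ ∫ p, (condMean μ r i (obs r p) - b * obs r p i) ^ 2 ∂(channelLaw μ) :=
      integral_nonneg fun p => sq_nonneg _
    have e : ∀ p, (condMean μ r i (obs r p) - b * obs r p i) ^ 2 =
        condMean μ r i (obs r p) * condMean μ r i (obs r p) -
          (2 * b * (condMean μ r i (obs r p) * obs r p i) -
            b ^ 2 * (obs r p i * obs r p i)) := fun p => by ring
    have i4 : Integrable (fun p => 2 * b * (condMean μ r i (obs r p) * obs r p i) -
      b ^ 2 * (obs r p i * obs r p i)) (channelLaw μ) := (i2.const_mul _).sub (i3.const_mul _)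
    simp_rw [e] at h0
    rw [integral_sub i1 i4, integral_sub (i2.const_mul _) (i3.const_mul _), integral_const_mul,
      integral_const_mul, h.integral_condMean_mul hr, h.isIsotropic.integral_condMean_mul_obs hr,
      h.isIsotropic.integral_obs_mul_obs] at h0
    simp only [if_true] at h0
    have e2 : 2 * b * (r * 1) - b ^ 2 * ((1 + r ^ 2) * 1) = r ^ 2 / (1 + r ^ 2) := by
      rw [hb]; field_simp; ring
    linarith
  rw [h.estEnergy_eq hr]
  have := Finset.sum_le_sum fun i (_ : i ∈ Finset.univ) => key i
  simp only [Finset.sum_const, Finset.card_univ, Fintype.card_fin, nsmul_eq_mul,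
    Finset.sum_sub_distrib, mul_one] at this
  rwa [mul_div_assoc]

lemma estEnergy_nonneg (μ : Measure (EuclideanSpace ℝ (Fin d))) (r : ℝ) : 0 ≤ estEnergy μ r :=
  integral_nonneg fun _ => Finset.sum_nonneg fun _ _ => sq_nonneg _

/-- Conditional expectation contracts the L² norm, and E|X|² = d. -/
lemma IsIsotropicLogConcave.estEnergy_le (h : IsIsotropicLogConcave μ f) (hr : 0 < r) :
    estEnergy μ r ≤ d := by
  have key : ∀ i : Fin d, ∫ p, condMean μ r i (obs r p) ^ 2 ∂(channelLaw μ) ≤ 1 := by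
    intro i
    have h2 := h.isIsotropic.integrable_norm_sq
    have mC := h.isIsotropic.memLp_condMean hr r i
    have mX := memLp_fst_coord h2 i
    have i1 := mC.integrable_sq
    have i2 := mC.integrable_fun_mul mX
    have i3 := mX.integrable_fun_mul mX
    have h0 : 0 ≤ ∫ p : EuclideanSpace ℝ (Fin d) × EuclideanSpace ℝ (Fin d),
        (condMean μ r i (obs r p) - p.1 i) ^ 2 ∂(channelLaw μ) :=
      integral_nonneg fun p => sq_nonneg _
    have e : ∀ p : EuclideanSpace ℝ (Fin d) × EuclideanSpace ℝ (Fin d),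
        (condMean μ r i (obs r p) - p.1 i) ^ 2 = condMean μ r i (obs r p) ^ 2 -
          (2 * (condMean μ r i (obs r p) * p.1 i) - p.1 i * p.1 i) := fun p => by ring
    have i4 : Integrable (fun p : EuclideanSpace ℝ (Fin d) × EuclideanSpace ℝ (Fin d) =>
      2 * (condMean μ r i (obs r p) * p.1 i) - p.1 i * p.1 i) (channelLaw μ) :=
      (i2.const_mul _).sub i3
    have e2 := h.isIsotropic.integral_mul_fst hr (F := condMean μ r i) (measurable_condMean h2 i)
      mC i
    simp_rw [← sq] at e2
    simp_rw [e] at h0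
    rw [integral_sub i1 i4, integral_sub (i2.const_mul _) i3, integral_const_mul, e2,
      integral_prod _ i3] at h0
    simp only [integral_const, probReal_univ, one_smul, h.isIsotropic.covariance, if_true] at h0
    linarith
  rw [estEnergy, integral_finsetSum _ fun i _ =>
    (h.isIsotropic.memLp_condMean hr r i).integrable_sq]
  simpa using Finset.sum_le_sum fun i (_ : i ∈ Finset.univ) => key i

/-- A functional comparing `μ`, its self-convolution and the Gaussian law along the Gaussian
channel; under a Poincaré inequality it is monotone in the signal strength. -/
noncomputable def jumpFunctional (μ : Measure (EuclideanSpace ℝ (Fin d))) (c r : ℝ) : ℝ :=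
  r ^ 2 * (estEnergy μ r - estEnergy (selfConvolution μ) r) +
    2 * (logPartition μ r - logPartition (selfConvolution μ) r) -
      c / 8 * (d * Real.log (1 + r ^ 2) - d * r ^ 2 + 2 * logPartition μ r +
        r ^ 2 * (estEnergy μ r - d * r ^ 2 / (1 + r ^ 2)))

/-- The left side is, up to the factors c and 2r, the derivative of the Gaussian part subtracted in
`jumpFunctional`. The spectral gap bounds it by the variance K - n, which is what `fisher_jump`
supplies on the other side. -/
lemma IsIsotropicLogConcave.poincare_dissipation (h : IsIsotropicLogConcave μ f)
    (hP : SatisfiesPoincare μ c) (hc : 0 < c) (hc1 : c ≤ 1) (hr : 0 < r) :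
    c * (2 * (estEnergy μ r - d * r ^ 2 / (1 + r ^ 2)) +
      r ^ 2 * (covEnergy μ r - d / (1 + r ^ 2) ^ 2)) ≤
        4 * (r ^ 2 * (covEnergy μ r - meanCovEnergy μ r)) := by
  have hB := h.mul_le_of_poincare hP hc hr
  have hβ := meanCov_defect_nonneg μ r
  have hV := h.meanCovEnergy_le hr
  have hq := h.estEnergy_eq hr
  set m := ∑ i, meanCov μ r i i
  set n := meanCovEnergy μ r
  set K := covEnergy μ r
  set t := r ^ 2
  have ht : 0 < t := pow_pos hr 2
  set β := d - 2 * (1 + t) * m + (1 + t) ^ 2 * n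
  have htV : 0 ≤ t * (K - n) := mul_nonneg ht.le (by linarith)
  rw [hq]
  -- The expression splits into the quantity controlled by `mul_le_of_poincare`, a term of
  -- favourable sign (the defect β of the mean covariance), and the variance itself. Since c ≤ 1,
  -- the first costs 2 and the last 1; the constant 4 leaves room.
  have e : 2 * (d - m - d * t / (1 + t)) + t * (K - d / (1 + t) ^ 2) =
      2 * (d - (1 + 2 * t) * m + t * (1 + t) * n) / (1 + t) - t * β / (1 + t) ^ 2 +
        t * (K - n) := by
    simp only [β]
    field_simp
    ring
  have h1 : c * (2 * (d - (1 + 2 * t) * m + t * (1 + t) * n) / (1 + t)) ≤ 2 * (t * (K - n)) := by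
    rw [mul_div_assoc', div_le_iff₀ (by positivity)]
    nlinarith
  have h2 : 0 ≤ c * (t * β / (1 + t) ^ 2) := by positivity
  have h3 : c * (t * (K - n)) ≤ t * (K - n) := mul_le_of_le_one_left htV hc1
  rw [e]
  linarith

/-- The terms r²q and 2L are combined so that the derivative is 2r times the right side of
`fisher_jump` minus c/8 times the expression bounded in `poincare_dissipation`. The factors 1/2 and
4 in these two inequalities are what make the constant 8. -/
lemma IsIsotropicLogConcave.exists_hasDerivAt_jumpFunctional (h : IsIsotropicLogConcave μ f)
    (hP : SatisfiesPoincare μ c) (hc : 0 < c) (hc1 : c ≤ 1) (hr : 0 < r) :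
    ∃ D, 0 ≤ D ∧ HasDerivAt (jumpFunctional μ c) D r := by
  have hν := h.selfConvolution
  have hsq : HasDerivAt (fun r : ℝ => r ^ 2) (2 * r) r := by simpa using hasDerivAt_pow 2 r
  have q1 := h.hasDerivAt_estEnergy hr
  have q2 := hν.hasDerivAt_estEnergy hr
  have l1 := h.isIsotropic.hasDerivAt_logPartition hr
  have l2 := hν.isIsotropic.hasDerivAt_logPartition hr
  have hpos : (0:ℝ) < 1 + r ^ 2 := by positivity
  have hlog := (hsq.const_add 1).log hpos.ne'
  have hdiv := (hsq.const_mul (d : ℝ)).fun_div (hsq.const_add 1) hpos.ne'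
  have H := ((hsq.fun_mul (q1.fun_sub q2)).fun_add ((l1.fun_sub l2).const_mul 2)).fun_sub
    ((((hlog.const_mul (d : ℝ)).fun_sub (hsq.const_mul (d : ℝ))).fun_add (l1.const_mul 2)).fun_add
      (hsq.fun_mul (q1.fun_sub hdiv)) |>.const_mul (c / 8))
  have hF := h.fisher_jump hr
  have hS := h.poincare_dissipation hP hc hc1 hr
  refine ⟨_, ?_, H⟩
  have e : ∀ q qU K KU : ℝ, 2 * r * (q - qU) + r ^ 2 * (2 * r * K - 2 * r * KU) +
      2 * (r * q - r * qU) - c / 8 * (d * (2 * r / (1 + r ^ 2)) - d * (2 * r) + 2 * (r * q) +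
        (2 * r * (q - d * r ^ 2 / (1 + r ^ 2)) + r ^ 2 * (2 * r * K -
          (d * (2 * r) * (1 + r ^ 2) - d * r ^ 2 * (2 * r)) / (1 + r ^ 2) ^ 2))) =
      2 * r * (2 * (q - qU) + r ^ 2 * (K - KU) - c / 8 * (2 * (q - d * r ^ 2 / (1 + r ^ 2)) +
        r ^ 2 * (K - d / (1 + r ^ 2) ^ 2))) := by
    intro q qU K KU
    field_simp
    ring
  rw [e]
  refine mul_nonneg (by positivity) ?_
  linarith

/-- With no signal nothing distinguishes the laws: logarithmic and energy terms are at most r²d in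
absolute value. -/
lemma IsIsotropicLogConcave.tendsto_jumpFunctional (h : IsIsotropicLogConcave μ f) :
    Filter.Tendsto (jumpFunctional μ c) (nhdsWithin 0 (Set.Ioi 0)) (nhds 0) := by
  have hsq : Filter.Tendsto (fun r : ℝ => r ^ 2) (nhdsWithin 0 (Set.Ioi 0)) (nhds 0) := by
    have : Continuous fun r : ℝ => r ^ 2 := by fun_prop
    simpa using (this.tendsto 0).mono_left nhdsWithin_le_nhds
  have hd : Filter.Tendsto (fun r : ℝ => r ^ 2 * d) (nhdsWithin 0 (Set.Ioi 0)) (nhds 0) := by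
    simpa using hsq.mul_const (d : ℝ)
  have hL : ∀ {ν : Measure (EuclideanSpace ℝ (Fin d))} [IsProbabilityMeasure ν],
      IsIsotropic ν → Filter.Tendsto (logPartition ν) (nhdsWithin 0 (Set.Ioi 0)) (nhds 0) := by
    intro ν _ hν
    refine squeeze_zero_norm' ?_ hd
    filter_upwards [self_mem_nhdsWithin] with r hr
    have h1 := hν.le_logPartition r
    have h2 := hν.logPartition_le hr
    have : 0 ≤ r ^ 2 * (d : ℝ) := by positivity
    rw [Real.norm_eq_abs, abs_le]
    constructor <;> linarith
  have hQ : ∀ {ν : Measure (EuclideanSpace ℝ (Fin d))} [IsProbabilityMeasure ν]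
      {g : EuclideanSpace ℝ (Fin d) → ℝ}, IsIsotropicLogConcave ν g →
      Filter.Tendsto (fun r => r ^ 2 * estEnergy ν r) (nhdsWithin 0 (Set.Ioi 0)) (nhds 0) := by
    intro ν _ g hν
    refine squeeze_zero_norm' ?_ hd
    filter_upwards [self_mem_nhdsWithin] with r hr
    rw [Real.norm_of_nonneg (mul_nonneg (sq_nonneg r) (estEnergy_nonneg ν r))]
    exact mul_le_mul_of_nonneg_left (hν.estEnergy_le hr) (sq_nonneg r)
  have hC : Filter.Tendsto (fun r : ℝ => d * Real.log (1 + r ^ 2) - d * r ^ 2 -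
      r ^ 2 * (d * r ^ 2 / (1 + r ^ 2))) (nhdsWithin 0 (Set.Ioi 0)) (nhds 0) := by
    have : Continuous fun r : ℝ => d * Real.log (1 + r ^ 2) - d * r ^ 2 -
      r ^ 2 * (d * r ^ 2 / (1 + r ^ 2)) := by
      have hne : ∀ r : ℝ, 1 + r ^ 2 ≠ 0 := fun r => by positivity
      fun_prop (disch := assumption)
    simpa using (this.tendsto 0).mono_left nhdsWithin_le_nhds
  have hν := h.selfConvolution
  have := (((hQ h).sub (hQ hν)).add (((hL h.isIsotropic).sub (hL hν.isIsotropic)).const_mul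
    2)).sub ((hC.add (((hL h.isIsotropic).const_mul 2).add (hQ h))).const_mul (c / 8))
  simp only [sub_zero, mul_zero, add_zero] at this
  refine this.congr fun r => ?_
  simp only [jumpFunctional]
  ring

lemma nonneg_of_deriv_nonneg {F : ℝ → ℝ} (hF : ∀ r, 0 < r → ∃ D, 0 ≤ D ∧ HasDerivAt F D r)
    (h0 : Filter.Tendsto F (nhdsWithin 0 (Set.Ioi 0)) (nhds 0)) {r : ℝ} (hr : 0 < r) : 0 ≤ F r := by
  have hm : MonotoneOn F (Set.Ioi 0) := by
    refine monotoneOn_of_deriv_nonneg (convex_Ioi 0) (fun x hx => ?_) (fun x hx => ?_)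
      (fun x hx => ?_)
    · obtain ⟨D, -, hD⟩ := hF x hx
      exact hD.continuousAt.continuousWithinAt
    · obtain ⟨D, -, hD⟩ := hF x (interior_subset hx)
      exact hD.differentiableAt.differentiableWithinAt
    · obtain ⟨D, hD0, hD⟩ := hF x (interior_subset hx)
      rwa [hD.deriv]
  refine le_of_tendsto h0 ?_
  filter_upwards [Ioo_mem_nhdsGT hr] with x hx
  exact hm hx.1 hr hx.2.le

theorem IsIsotropicLogConcave.jumpFunctional_nonneg (h : IsIsotropicLogConcave μ f)
    (hP : SatisfiesPoincare μ c) (hc : 0 < c) (hc1 : c ≤ 1) (hr : 0 < r) :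
    0 ≤ jumpFunctional μ c r :=
  nonneg_of_deriv_nonneg (fun _ hr => h.exists_hasDerivAt_jumpFunctional hP hc hc1 hr)
    h.tendsto_jumpFunctional hr

/-- Along the channel the difference of estimation energies is integrable against `dr / r` at
infinity, since the entropies converge. -/
lemma IsIsotropicLogConcave.exists_estEnergy_sub_lt (h : IsIsotropicLogConcave μ f) {ε : ℝ}
    (hε : 0 < ε) (R : ℝ) :
    ∃ r ≥ R, r ^ 2 * (estEnergy μ r - estEnergy (_root_.selfConvolution μ) r) < ε := by
  by_contra! hcon
  have hν := h.selfConvolution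
  obtain ⟨R₁, hR₁⟩ := hν.exists_obsEntropy_le one_pos
  set R₀ := max (max R R₁) 1 with hR₀
  have hR0 : 1 ≤ R₀ := le_max_right _ _
  -- Were the difference of energies at least ε/r² from some point on, L - L_U would grow at least
  -- like ε log r, because its derivative is r(q - q_U).
  set F : ℝ → ℝ := fun r => logPartition μ r - logPartition (_root_.selfConvolution μ) r -
    ε * Real.log r with hF
  have hpos : ∀ r, R₀ ≤ r → 0 < r := fun r hr => by linarith
  have hder : ∀ r, R₀ ≤ r → HasDerivAt F (r * estEnergy μ r -
      r * estEnergy (_root_.selfConvolution μ) r - ε * r⁻¹) r := fun r hr =>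
    ((h.isIsotropic.hasDerivAt_logPartition (hpos r hr)).fun_sub
      (hν.isIsotropic.hasDerivAt_logPartition (hpos r hr))).fun_sub
        ((Real.hasDerivAt_log (hpos r hr).ne').const_mul ε)
  have hm : MonotoneOn F (Set.Ici R₀) := by
    refine monotoneOn_of_deriv_nonneg (convex_Ici R₀) (fun x hx => ?_) (fun x hx => ?_)
      (fun x hx => ?_)
    · exact (hder x hx).continuousAt.continuousWithinAt
    · exact (hder x (interior_subset hx)).differentiableAt.differentiableWithinAt
    · have hx' := interior_subset hx
      rw [(hder x hx').deriv]
      have h1 := hcon x (((le_max_left _ _).trans (le_max_left _ _)).trans hx')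
      have h0 := hpos x hx'
      have : x * estEnergy μ x - x * estEnergy (_root_.selfConvolution μ) x - ε * x⁻¹ =
          (x ^ 2 * (estEnergy μ x - estEnergy (_root_.selfConvolution μ) x) - ε) * x⁻¹ := by
        field_simp
      rw [this]
      exact mul_nonneg (by linarith) (by positivity)
  -- L - L_U equals the difference of the output entropies, in which the terms d log r cancel; it
  -- stays bounded because both converge after normalization.
  set B := entropy (_root_.selfConvolution μ) + 1 - entropy μ with hB
  have hub : ∀ r, R₀ ≤ r → F R₀ + ε * Real.log r ≤ B := by
    intro r hr
    have h1 := hm (Set.mem_Ici.2 le_rfl) hr hr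
    have h2 := hR₁ r (((le_max_right _ _).trans (le_max_left _ _)).trans hr)
    have h3 := h.isIsotropic.entropy_add_le_obsEntropy h.isDensityOf h.integrable_log (hpos r hr)
    simp only [obsEntropy] at h2 h3
    simp only [hF] at h1 ⊢
    linarith
  have hlim : Filter.Tendsto (fun r => F R₀ + ε * Real.log r) Filter.atTop Filter.atTop :=
    Filter.tendsto_atTop_add_const_left _ _ (Real.tendsto_log_atTop.const_mul_atTop hε)
  obtain ⟨r, hr1, hr2⟩ := ((hlim.eventually_gt_atTop B).and
    (Filter.eventually_ge_atTop R₀)).exists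
  exact absurd (hub r hr2) (not_le.2 hr1)

/-- A spectral gap yields an entropy jump for isotropic log-concave laws. -/
theorem IsIsotropicLogConcave.entropy_jump (h : IsIsotropicLogConcave μ f)
    (hP : SatisfiesPoincare μ c) (hc : 0 < c) (hd : 1 ≤ d) :
    c / 8 * (entropy (stdGaussian (EuclideanSpace ℝ (Fin d))) - entropy μ) ≤
      entropy (_root_.selfConvolution μ) - entropy μ := by
  have hc1 := hP.le_one hc.le h.isIsotropic hd
  have hν := h.selfConvolution
  refine le_of_forall_pos_le_add fun ε hε => ?_
  obtain ⟨R₁, hR₁⟩ := h.exists_obsEntropy_le (half_pos hε)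
  -- The entropies enter `jumpFunctional` doubled: an error ε/4 here and ε/2 for the energies add up
  -- to ε, and another ε comes from the Gaussian gap. Halving at the end leaves ε.
  obtain ⟨R₂, hR₂⟩ := hν.exists_obsEntropy_le (half_pos (half_pos hε))
  obtain ⟨r, hr, hlt⟩ := h.exists_estEnergy_sub_lt (half_pos hε) (max (max R₁ R₂) 1)
  have hr0 : 0 < r := one_pos.trans_le ((le_max_right _ _).trans hr)
  have h1 := hR₁ r (((le_max_left _ _).trans (le_max_left _ _)).trans hr)
  have h2 := hR₂ r (((le_max_right _ _).trans (le_max_left _ _)).trans hr)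
  have h3 := h.isIsotropic.entropy_add_le_obsEntropy h.isDensityOf h.integrable_log hr0
  have h4 := h.jumpFunctional_nonneg hP hc hc1 hr0
  have h5 := h.le_estEnergy hr0
  have h6 : 0 ≤ r ^ 2 * (estEnergy μ r - d * r ^ 2 / (1 + r ^ 2)) :=
    mul_nonneg (sq_nonneg r) (sub_nonneg.2 h5)
  have h7 : 2 * (d * Real.log r) ≤ d * Real.log (1 + r ^ 2) := by
    have : Real.log (r ^ 2) ≤ Real.log (1 + r ^ 2) := Real.log_le_log (by positivity) (by linarith)
    rw [Real.log_pow] at this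
    push_cast at this
    have := mul_le_mul_of_nonneg_left this (Nat.cast_nonneg (α := ℝ) d)
    linarith
  rw [entropy_stdGaussian]
  simp only [obsEntropy] at h1 h2 h3
  simp only [jumpFunctional] at h4
  -- Twice the entropy gap between the Gaussian of covariance (1 + r²)I and the output, plus an
  -- energy term that is nonnegative and may be dropped.
  set A := d * Real.log (1 + r ^ 2) - d * r ^ 2 + 2 * logPartition μ r +
    r ^ 2 * (estEnergy μ r - d * r ^ 2 / (1 + r ^ 2)) with hA
  have hA1 : 2 * (d / 2 * Real.log (2 * Real.pi) + d / 2 - entropy μ) - ε ≤ A := by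
    rw [hA]; linarith
  have hA2 := mul_le_mul_of_nonneg_left hA1 (by positivity : 0 ≤ c / 8)
  have hcε : c / 8 * ε ≤ ε := mul_le_of_le_one_left hε.le (by linarith)
  linarith

end Dissipation

/-! ### From laws to random vectors, and the bound by the Poincaré constant. -/

section Conclusion

variable {d : ℕ} {μ : Measure (EuclideanSpace ℝ (Fin d))} [IsProbabilityMeasure μ]
  {f : EuclideanSpace ℝ (Fin d) → ℝ}

lemma map_add_eq_selfConvolution {Ω : Type*} [MeasurableSpace Ω] {P : Measure Ω}
    [IsProbabilityMeasure P] {X Y : Ω → EuclideanSpace ℝ (Fin d)} (hXY : IdentDistrib X Y P P)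
    (hi : IndepFun X Y P) :
    P.map (fun w => (√2 : ℝ)⁻¹ • (X w + Y w)) = selfConvolution (P.map X) := by
  have hX := hXY.aemeasurable_fst
  have hY := hXY.aemeasurable_snd
  have e := (indepFun_iff_map_prod_eq_prod_map_map hX hY).1 hi
  rw [← hXY.map_eq] at e
  rw [selfConvolution, ← e, AEMeasurable.map_map_of_aemeasurable (by fun_prop)
    (hX.prodMk hY)]
  rfl

lemma IsIsotropicLogConcave.isotropicConstant_le_of_poincare (h : IsIsotropicLogConcave μ f)
    {c : ℝ} (hP : SatisfiesPoincare μ c) (hc : 0 < c) (hd : 1 ≤ d) :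
    isotropicConstant f ≤ Real.exp (16 / c) := by
  have := h.isotropicConstant_le hd (by positivity) (h.entropy_jump hP hc hd)
  rwa [show 2 / (c / 8) = 16 / c by field_simp; norm_num] at this

/-- A strict inequality yields an admissible constant below `C`, so whether the infimum is attained
plays no role. -/
lemma satisfiesPoincare_of_poincareConstant_lt {C : ℝ}
    (h : poincareConstant μ < ENNReal.ofReal C) : SatisfiesPoincare μ C⁻¹ := by
  intro s hs hi h0
  obtain ⟨C', hC', hlt⟩ := sInf_lt_iff.1 h
  have hC : 0 < C := ENNReal.ofReal_pos.1 (bot_le.trans_lt hlt)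
  calc ENNReal.ofReal C⁻¹ * ∫⁻ x, ‖s x‖ₑ ^ 2 ∂μ
      ≤ ENNReal.ofReal C⁻¹ * (ENNReal.ofReal C * ∫⁻ x, ‖∇ s x‖ₑ ^ 2 ∂μ) := by
        gcongr
        exact (hC' s hs hi h0).trans (mul_le_mul_left hlt.le _)
    _ = ∫⁻ x, ‖∇ s x‖ₑ ^ 2 ∂μ := by
        rw [← mul_assoc, ← ENNReal.ofReal_mul (inv_nonneg.2 hC.le), inv_mul_cancel₀ hC.ne',
          ENNReal.ofReal_one, one_mul]

lemma IsIsotropicLogConcave.isotropicConstant_le_poincareConstant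
    (h : IsIsotropicLogConcave μ f) (hd : 1 ≤ d) :
    ENNReal.ofReal (isotropicConstant f) ≤
      EReal.exp ((16 * poincareConstant μ : ℝ≥0∞) : EReal) := by
  -- An infinite Poincaré constant makes the right side infinite.
  rcases eq_or_ne (poincareConstant μ) ⊤ with hp | hp
  · simp [hp]
  set p := (poincareConstant μ).toReal with hp'
  have hpe : poincareConstant μ = ENNReal.ofReal p := (ENNReal.ofReal_toReal hp).symm
  have h16 : (16 * poincareConstant μ : ℝ≥0∞) = ENNReal.ofReal (16 * p) := by
    rw [hpe, ENNReal.ofReal_mul (by norm_num), ENNReal.ofReal_ofNat]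
  have hp0 : 0 ≤ p := ENNReal.toReal_nonneg
  rw [h16, EReal.coe_ennreal_ofReal, max_eq_left (by positivity), EReal.exp_coe]
  -- The infimum is approached from above: for y > exp(16 p) the constant (log y)/16 exceeds p, and
  -- its reciprocal is a spectral gap giving precisely the bound y. This also covers p = 0.
  refine ENNReal.ofReal_le_ofReal (le_of_forall_gt_imp_ge_of_dense fun y hy => ?_)
  have hy0 : 0 < y := (Real.exp_pos _).trans hy
  have hC : p < Real.log y / 16 := by
    have := (Real.lt_log_iff_exp_lt hy0).2 hy
    linarith
  have hC0 : 0 < Real.log y / 16 := hp0.trans_lt hC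
  have hP := satisfiesPoincare_of_poincareConstant_lt (μ := μ) (C := Real.log y / 16) (by
    rwa [hpe, ENNReal.ofReal_lt_ofReal_iff hC0])
  have := h.isotropicConstant_le_of_poincare hP (inv_pos.2 hC0) hd
  rwa [div_inv_eq_mul, mul_div_cancel₀ _ (by norm_num), Real.exp_log hy0] at this

end Conclusion

theorem mainTheorem3 :
    (∀ (d : ℕ) (_ : 1 ≤ d) (Ω : Type*) [MeasurableSpace Ω] (P : Measure Ω)
      [IsProbabilityMeasure P] (X Y : Ω → EuclideanSpace ℝ (Fin d))
      (f : EuclideanSpace ℝ (Fin d) → ℝ),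
      IdentDistrib X Y P P → IndepFun X Y P → IsIsotropicLogConcave (P.map X) f →
        -- the entropies below are finite
        (HasFiniteEntropy (P.map X) ∧
          HasFiniteEntropy (P.map (fun w => (√2 : ℝ)⁻¹ • (X w + Y w)))) ∧
        -- an entropy jump bounds the isotropic constant
        (∀ κ : ℝ, 0 < κ → κ < 1 → HasEntropyJump P X Y κ →
          isotropicConstant f ≤ Real.exp (2 / κ)) ∧
        -- a spectral gap `c` gives an entropy jump with constant `c / 8 ∈ (0, 1)`
        (∀ c : ℝ, 0 < c → SatisfiesPoincare (P.map X) c →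
          c / 8 < 1 ∧ HasEntropyJump P X Y (c / 8)) ∧
        -- the bound in terms of the Poincaré constant (an inequality in `[0, ∞]`)
        ENNReal.ofReal (isotropicConstant f) ≤
          EReal.exp ((16 * poincareConstant (P.map X) : ℝ≥0∞) : EReal)) ∧
    (KLSConjecture → SlicingConjecture) := by
  refine ⟨fun d hd Ω _ P _ X Y f hXY hi h => ?_, fun ⟨c, hc, hKLS⟩ => ⟨Real.exp (16 / c),
    fun d hd μ f _ h => h.isotropicConstant_le_of_poincare (hKLS d hd μ f ‹_› h) hc hd⟩⟩
  have : IsProbabilityMeasure (P.map X) := Measure.isProbabilityMeasure_map hXY.aemeasurable_fst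
  have hU := map_add_eq_selfConvolution hXY hi
  refine ⟨⟨h.hasFiniteEntropy, ?_⟩, fun κ hκ _ hjump => ?_, fun c hc hP => ⟨?_, ?_⟩,
    h.isotropicConstant_le_poincareConstant hd⟩
  · rw [hU]
    exact h.selfConvolution.hasFiniteEntropy
  · rw [HasEntropyJump, hU] at hjump
    exact h.isotropicConstant_le hd hκ hjump
  · have := hP.le_one hc.le h.isIsotropic hd
    linarith
  · rw [HasEntropyJump, hU]
    exact h.entropy_jump hP hc hd
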